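/- Let $\Gamma_0=\{(t,0):-1<t<1\}$, $w(t)=\sqrt{1-t^2}$, $k>0$ and $s>-1/2$. For $r\in\mathbb R$ let $W^r$ be the space of (formal) Chebyshev series $u=\sum_{n\ge 0}a_nT_n$, $a_n\in\mathbb C$, with $\|u\|_{W^r}^2=\sum_n(1+n^2)^r|a_n|^2<\infty$; a function $u$ on $(-1,1)$ is identified with the series with $a_n=\frac{2-\delta_{0n}}{\pi}\int_{-1}^1u\,T_n\,w^{-1}\,dt$. With $\gamma_k(x,y)=\frac i4H_0^{(1)}(k|x-y|)$ and $\nu=(0,1)$ put $$V_1^{H,w}u(x)=\int_{\Gamma_0}\gamma_k(x,y)\frac{u(y)}{w(y)}\,dy,\qquad V_2^{H,w}u(x)=\mathrm{f.p.}\int_{\Gamma_0}\partial_{\nu_x}\partial_{\nu_y}\gamma_k(x,y)\,w(y)u(y)\,dy$$ (Hadamard finite part), and $$V_{1,0}u(t)=\int_{-1}^1\frac{-1}{2\pi}\log|t-\tau|\,\frac{u(\tau)}{w(\tau)}\,d\tau,\qquad V_{2,0}u(t)=\frac{d}{dt}\int_{-1}^1\frac{-1}{2\pi}\log|t-\tau|\,(wu)'(\tau)\,d\tau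 .$$ Then $V_1^{H,w},V_{1,0}$ (defined on the polynomials $T_n$) extend uniquely to bounded operators $W^s\to W^{s+1}$, and $V_2^{H,w},V_{2,0}$ extend uniquely to bounded operators $W^{s+1}\to W^s$. Put $\widehat J^H=V_1^{H,w}V_2^{H,w}$ and $\widehat J_0=V_{1,0}V_{2,0}$ on $W^{s+1}$, and $J^H=V_2^{H,w}V_1^{H,w}$ and $J_0=V_{2,0}V_{1,0}$ on $W^s$. The point spectra of $\widehat J^H$ and $J^H$ coincide up to compact perturbations, in the following sense. 1. $\widehat J^H-\widehat J_0$ is compact on $W^{s+1}$ and $J^H-J_0$ is compact on $W^s$. 2. Let $d_0=\frac{\log 2}{2}$, $d_n=\frac1{2n}$ for $n>0$, and $e_n=-\frac{n+1}2$ for $n\ge0$. For all $n\ge0$, $$\widehat J_0T_n=e_nd_nT_n+(e_n-e_{n-2})\sum_{\substack{0\le j\le n-2\\ j\equiv n\ (2)}}\epsilon_jd_jT_j,\qquad \epsilon_0=\tfrac12,\ \epsilon_j=1\ (j>0),$$ (the second term being absent for $n=0,1$), and $e_nd_n=\lambda_n$, where $\lambda_0=-\frac{\log2}4$ and $\lambda_n=-\frac14-\frac1{4n}$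 for $n>0$. 3. The sets of eigenvalues of $\widehat J_0$ on $W^{s+1}$ and of $J_0$ on $W^s$ are equal, and both are $$\{\lambda_n:n\ge0\}\ \cup\ \Big\{-\tfrac14+re^{i\theta}:\ \tfrac\pi2<\theta<\tfrac{3\pi}2,\ 0<r<-\frac{\cos\theta}{4s+2}\Big\}.$$ -/

import Mathlib

open Real Set Filter Topology MeasureTheory

noncomputable section

/-! ### The Chebyshev-based spaces -/

/-- The space `W^s` of (formal) Chebyshev series `u = ∑ aₙ Tₙ` with
`∑ (1 + n²)^s |aₙ|² < ∞`, an element being given by its coefficients `aₙ`.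
(For `s ≥ 0` these are functions, for `s < 0` distributions.) -/
def ChebSubmodule (s : ℝ) : Submodule ℂ (ℕ → ℂ) where
  carrier := {a | Summable fun n : ℕ => (1 + (n : ℝ) ^ 2) ^ s * ‖a n‖ ^ 2}
  zero_mem' := by simp [summable_zero]
  add_mem' := by
    intro a b ha hb
    have hab := (ha.add hb).mul_left 2
    refine Summable.of_nonneg_of_le (fun n => by positivity) (fun n => ?_) hab
    have h1 : ‖a n + b n‖ ^ 2 ≤ 2 * (‖a n‖ ^ 2 + ‖b n‖ ^ 2) := by
      nlinarith [norm_add_le (a n) (b n), norm_nonneg (a n + b n), norm_nonneg (a n),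
        norm_nonneg (b n), sq_nonneg (‖a n‖ - ‖b n‖)]
    have h2 : (0 : ℝ) ≤ (1 + (n : ℝ) ^ 2) ^ s := by positivity
    calc (1 + (n : ℝ) ^ 2) ^ s * ‖(a + b) n‖ ^ 2
        ≤ (1 + (n : ℝ) ^ 2) ^ s * (2 * (‖a n‖ ^ 2 + ‖b n‖ ^ 2)) :=
          mul_le_mul_of_nonneg_left h1 h2
      _ = _ := by ring
  smul_mem' := by
    intro c a ha
    have h := Summable.mul_left (‖c‖ ^ 2) ha
    refine h.congr (fun n => ?_)
    simp only [Pi.smul_apply, smul_eq_mul, norm_mul]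
    ring

/-- `W^s` as a type of its own, to be given the norm below. -/
def ChebW (s : ℝ) : Type := ChebSubmodule s

namespace ChebW

variable {s : ℝ}

instance : AddCommGroup (ChebW s) := inferInstanceAs (AddCommGroup (ChebSubmodule s))

instance : Module ℂ (ChebW s) := inferInstanceAs (Module ℂ (ChebSubmodule s))

/-- The `n`-th Chebyshev coefficient of an element of `W^s`. -/
def coeff (u : ChebW s) (n : ℕ) : ℂ := u.1 n

theorem coeff_add (u v : ChebW s) (n : ℕ) : (u + v).coeff n = u.coeff n + v.coeff n := rfl

theorem coeff_smul (c : ℂ) (u : ChebW s) (n : ℕ) : (c • u).coeff n = c * u.coeff n := rfl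

theorem summable_coeff (u : ChebW s) :
    Summable fun n : ℕ => (1 + (n : ℝ) ^ 2) ^ s * ‖u.coeff n‖ ^ 2 := u.2

theorem ext_coeff {u v : ChebW s} (h : ∀ n, u.coeff n = v.coeff n) : u = v :=
  Subtype.ext (funext h)

theorem norm_weight_sq (a : ℂ) (n : ℕ) :
    ‖(((1 + (n : ℝ) ^ 2) ^ (s / 2) : ℝ) : ℂ) * a‖ ^ 2 = (1 + (n : ℝ) ^ 2) ^ s * ‖a‖ ^ 2 := by
  have h : (0 : ℝ) < 1 + (n : ℝ) ^ 2 := by positivity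
  rw [norm_mul, mul_pow, Complex.norm_real, Real.norm_eq_abs, sq_abs, ← Real.rpow_natCast,
    ← Real.rpow_mul h.le]
  congr 2
  push_cast
  ring

/-- The map `(aₙ) ↦ ((1 + n²)^{s/2} aₙ)` from `W^s` to `ℓ²`. -/
def toL2 (s : ℝ) : ChebW s →ₗ[ℂ] lp (fun _ : ℕ => ℂ) 2 where
  toFun u := ⟨fun n => (((1 + (n : ℝ) ^ 2) ^ (s / 2) : ℝ) : ℂ) * u.coeff n, by
    refine memℓp_gen ?_
    refine u.summable_coeff.congr (fun n => ?_)
    rw [← norm_weight_sq]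
    simp⟩
  map_add' u v := by
    ext n
    exact mul_add _ _ _
  map_smul' c u := by
    ext n
    simp [coeff_smul]
    ring

theorem toL2_injective (s : ℝ) : Function.Injective (toL2 s) := by
  intro u v h
  refine ext_coeff (fun n => ?_)
  have hn : (((1 + (n : ℝ) ^ 2) ^ (s / 2) : ℝ) : ℂ) * u.coeff n =
      (((1 + (n : ℝ) ^ 2) ^ (s / 2) : ℝ) : ℂ) * v.coeff n :=
    congrFun (congrArg Subtype.val h) n
  have hw : (((1 + (n : ℝ) ^ 2) ^ (s / 2) : ℝ) : ℂ) ≠ 0 := by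
    have h0 : (0 : ℝ) < (1 + (n : ℝ) ^ 2) ^ (s / 2) := by positivity
    exact_mod_cast h0.ne'
  exact mul_left_cancel₀ hw hn

/-- The norm of `W^s` (see `norm_sq_eq`). -/
instance : NormedAddCommGroup (ChebW s) :=
  NormedAddCommGroup.induced (ChebW s) (lp (fun _ : ℕ => ℂ) 2) (toL2 s) (toL2_injective s)

instance : NormedSpace ℂ (ChebW s) :=
  NormedSpace.induced ℂ (ChebW s) (lp (fun _ : ℕ => ℂ) 2) (toL2 s)

theorem norm_sq_eq (u : ChebW s) :
    ‖u‖ ^ 2 = ∑' n : ℕ, (1 + (n : ℝ) ^ 2) ^ s * ‖u.coeff n‖ ^ 2 := by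
  have h : ‖u‖ = ‖toL2 s u‖ := rfl
  have h2 := lp.norm_rpow_eq_tsum (p := 2) (by simp) (toL2 s u)
  simp only [ENNReal.toReal_ofNat, Real.rpow_ofNat] at h2
  rw [h, h2]
  exact tsum_congr (fun n => norm_weight_sq (u.coeff n) n)

/-- The Chebyshev polynomial `Tₙ` as an element of `W^s`. -/
def chebT (s : ℝ) (n : ℕ) : ChebW s :=
  ⟨Pi.single n 1, by
    refine summable_of_ne_finset_zero (s := {n}) (fun m hm => ?_)
    have hmn : m ≠ n := by simpa using hm
    simp [Pi.single_eq_of_ne hmn]⟩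

end ChebW

/-- The Chebyshev polynomial of the first kind as a (complex valued) function on the line. -/
def chebTFun (n : ℕ) (t : ℝ) : ℂ := (((Polynomial.Chebyshev.T ℝ (n : ℤ)).eval t : ℝ) : ℂ)

/-- The weight `w(t) = √(1 - t²)`. -/
def chebWeight (t : ℝ) : ℂ := ((√(1 - t ^ 2) : ℝ) : ℂ)

/-- The function `f` on `(-1,1)`, integrable with respect to `dt / w(t)`, is the element `u`
of `W^s`: the coefficients of `u` are
`(2 - δ₀ₙ)/π ∫_{-1}^1 f(t) Tₙ(t) / w(t) dt`. -/
def Represents {s : ℝ} (u : ChebW s) (f : ℝ → ℂ) : Prop :=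
  IntervalIntegrable (fun t => f t / chebWeight t) volume (-1) 1 ∧
  ∀ n : ℕ, u.coeff n = ((if n = 0 then 1 else 2 : ℝ) / π : ℝ) *
    ∫ t in (-1 : ℝ)..1, f t * chebTFun n t / chebWeight t

/-! ### The fundamental solution of the Helmholtz equation -/

/-- The Bessel function `J₀`. -/
def besselJ0 (x : ℝ) : ℝ := ∑' m : ℕ, (-1) ^ m * (x / 2) ^ (2 * m) / (m.factorial : ℝ) ^ 2

/-- The Bessel function of the second kind `Y₀`, on `x > 0`. -/
def besselY0 (x : ℝ) : ℝ :=
  2 / π * (Real.log (x / 2) + Real.eulerMascheroniConstant) * besselJ0 x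
    - 2 / π * ∑' m : ℕ, (-1) ^ m * (harmonic m : ℝ) * (x / 2) ^ (2 * m) / (m.factorial : ℝ) ^ 2

/-- The Hankel function `H₀⁽¹⁾ = J₀ + i Y₀`, on `x > 0`. -/
def hankelH0 (x : ℝ) : ℂ := (besselJ0 x : ℂ) + Complex.I * (besselY0 x : ℂ)

/-- `γ_k(x,y) = (i/4) H₀⁽¹⁾(k|x-y|)` in the plane. -/
def helmholtzFund (k : ℝ) (x y : EuclideanSpace ℝ (Fin 2)) : ℂ :=
  Complex.I / 4 * hankelH0 (k * dist x y)

/-- The parametrization `t ↦ (t, 0)` of the segment `Γ₀`. -/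
def segPoint (t : ℝ) : EuclideanSpace ℝ (Fin 2) := !₂[t, 0]

/-- The unit normal of `Γ₀`. -/
def segNormal : EuclideanSpace ℝ (Fin 2) := !₂[0, 1]

/-- The kernel `∂_{ν_x} ∂_{ν_y} γ_k(x,y)` at the points `x = (t,0)`, `y = (τ,0)` of `Γ₀`. -/
def hyperKernel (k t τ : ℝ) : ℂ :=
  lineDeriv ℝ (fun x => lineDeriv ℝ (fun y => helmholtzFund k x y) (segPoint τ) segNormal)
    (segPoint t) segNormal

/-! ### The integral operators

Each operator is given as the relation "`g` is the image of `u` on `(-1,1)`", which includes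
the existence of all integrals, derivatives and finite parts that occur in it. -/

/-- The function `F` of `ε > 0` has Hadamard finite part `c` as `ε → 0⁺`, for divergent part
a multiple of `1/ε`. -/
def IsFinitePart (F : ℝ → ℂ) (c : ℂ) : Prop :=
  ∃ a : ℂ, Tendsto (fun ε : ℝ => F ε - a / (ε : ℂ)) (𝓝[>] 0) (𝓝 c)

/-- `g = V₁^{H,w} u`: `g(t) = ∫_{Γ₀} γ_k(t,τ) u(τ)/w(τ) dτ`. -/
def IsV1 (k : ℝ) (u g : ℝ → ℂ) : Prop :=
  ∀ t ∈ Ioo (-1 : ℝ) 1,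
    IntervalIntegrable
      (fun τ => helmholtzFund k (segPoint t) (segPoint τ) * (u τ / chebWeight τ)) volume (-1) 1 ∧
    g t = ∫ τ in (-1 : ℝ)..1, helmholtzFund k (segPoint t) (segPoint τ) * (u τ / chebWeight τ)

/-- `g = V₂^{H,w} u`: `g(t) = f.p. ∫_{Γ₀} ∂_{ν_x} ∂_{ν_y} γ_k(t,τ) w(τ) u(τ) dτ`. -/
def IsV2 (k : ℝ) (u g : ℝ → ℂ) : Prop :=
  ∀ t ∈ Ioo (-1 : ℝ) 1,
    (∀ ε > 0, IntegrableOn (fun τ => hyperKernel k t τ * (chebWeight τ * u τ))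
      {τ | τ ∈ Ioo (-1 : ℝ) 1 ∧ ε < |t - τ|}) ∧
    IsFinitePart (fun ε => ∫ τ in {τ | τ ∈ Ioo (-1 : ℝ) 1 ∧ ε < |t - τ|},
      hyperKernel k t τ * (chebWeight τ * u τ)) (g t)

/-- `g(t) = ∫_{-1}^1 -1/(2π) log|t-τ| v(τ) dτ`. -/
def IsLogPotential (v g : ℝ → ℂ) : Prop :=
  ∀ t ∈ Ioo (-1 : ℝ) 1,
    IntervalIntegrable
      (fun τ => ((-1 / (2 * π) * Real.log |t - τ| : ℝ) : ℂ) * v τ) volume (-1) 1 ∧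
    g t = ∫ τ in (-1 : ℝ)..1, ((-1 / (2 * π) * Real.log |t - τ| : ℝ) : ℂ) * v τ

/-- The principal part of `V₁^{H,w}`: `g(t) = ∫_{-1}^1 -1/(2π) log|t-τ| u(τ)/w(τ) dτ`. -/
def IsV1Principal (u g : ℝ → ℂ) : Prop :=
  IsLogPotential (fun τ => u τ / chebWeight τ) g

/-- The principal part of `V₂^{H,w}`:
`g(t) = d/dt ∫_{-1}^1 -1/(2π) log|t-τ| (w u)'(τ) dτ`. -/
def IsV2Principal (u g : ℝ → ℂ) : Prop :=
  ∃ v p : ℝ → ℂ,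
    (∀ τ ∈ Ioo (-1 : ℝ) 1, HasDerivAt (fun r => chebWeight r * u r) (v τ) τ) ∧
    IsLogPotential v p ∧
    ∀ t ∈ Ioo (-1 : ℝ) 1, HasDerivAt p (g t) t

/-- The bounded operator `A : W^s → W^r` is (the continuous extension of) the integral operator
`R`: they agree on every `Tₙ`. The `Tₙ` span a dense subspace of `W^s`. -/
def Realizes {s r : ℝ} (A : ChebW s →L[ℂ] ChebW r) (R : (ℝ → ℂ) → (ℝ → ℂ) → Prop) : Prop :=
  ∀ n : ℕ, ∃ g : ℝ → ℂ, R (chebTFun n) g ∧ Represents (A (ChebW.chebT s n)) g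

/-! ### Spectra -/

/-- The set of eigenvalues of a bounded operator. -/
def pointSpectrum {s : ℝ} (A : ChebW s →L[ℂ] ChebW s) : Set ℂ :=
  {z | Module.End.HasEigenvalue (A : ChebW s →ₗ[ℂ] ChebW s) z}

/-- `d₀ = (log 2)/2`, `dₙ = 1/(2n)` for `n > 0`. -/
def dEig (n : ℕ) : ℝ := if n = 0 then Real.log 2 / 2 else 1 / (2 * n)

/-- `eₙ = -(n+1)/2`. -/
def eEig (n : ℕ) : ℝ := -((n : ℝ) + 1) / 2

/-- `λ₀ = -(log 2)/4`, `λₙ = -1/4 - 1/(4n)` for `n > 0`. -/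
def discreteEig (n : ℕ) : ℝ := if n = 0 then -(Real.log 2) / 4 else -1 / 4 - 1 / (4 * n)

/-- The complementary part of the point spectrum. -/
def complementarySpectrum (s : ℝ) : Set ℂ :=
  {z | ∃ r θ : ℝ, π / 2 < θ ∧ θ < 3 * π / 2 ∧ 0 < r ∧ r < -Real.cos θ / (4 * s + 2) ∧
    z.re + 1 / 4 = r * Real.cos θ ∧ z.im = r * Real.sin θ}

end

/-! In Chebyshev coefficients both principal parts are explicit. The logarithmic potential is
diagonal, `T_n ↦ d_n T_n` (`logOp`), and the hypersingular operator is upper triangular, `T_n ↦ e_n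
T_n - ∑ ε_j T_j` over `j < n` of the parity of `n` (`hyperOp`). Both follow from the finite Hilbert
transform of `T_n / w`, which is `π U_{n-1}` (`tendsto_truncCauchy`), by integration by parts on a
segment with a neighbourhood of the singularity removed. The tail sums in the triangular operator
are bounded from `W^{s+1}` to `W^s` by a weighted Hardy inequality (`exists_hardy_bound`); this is
where `s > -1/2` enters.

Compactness rests on the form of the fundamental solution on the segment: `-1/(2π) log|t-τ|
α((t-τ)²) + β((t-τ)²)` with entire `α`, `β` and `α(0) = 1`. Multiplying a kernel by `t - τ` amounts
to taking the commutator `ad` of the operator with multiplication by the variable. Hence `V₁` is a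
norm convergent series in even powers of `ad` applied to `logOp` and to a rank one operator. Since
`d_n - d_{n+1} = O(n⁻²)`, the commutator of `logOp` is already compact into `W^{s+1}`, so only the
leading term `logOp` is not compact. Two normal derivatives turn the kernel into `1/(2π(t-τ)²)` plus
a kernel of the same logarithmic type. The first gives `hyperOp`; the second gives an operator that
factors through a compact embedding. Products of compact perturbations are again compact
perturbations.

For the point spectrum, `logOp` is invertible, so the two products have the same eigenvalues. Each
diagonal entry `λ_n` is an eigenvalue because a finite section is singular. For any other `z`,
subtracting the eigenvalue equations at `j` and `j + 2` cancels the tails and leaves a two term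
recurrence for `b_n = d_n u_n`, with quotient `(j + c) / (j + 2 - c)`, `c = 1 / (4 (z + 1/4))`. Its
solutions are Pochhammer quotients of size `n^{Re c - 1}`, which lie in `W^{s+1}` exactly when `Re c
< -(s + 1/2)`; inversion turns this half plane into the stated disc
(`mem_complementarySpectrum_iff`). -/

namespace ChebW

/-! ### Weighted sequence spaces: completeness, coefficient functionals, Chebyshev expansion. -/

/-- The weight `(1 + n²)^s` of the space `W^s`. -/
noncomputable def wt (s : ℝ) (n : ℕ) : ℝ := (1 + (n : ℝ) ^ 2) ^ s

theorem wt_pos (s : ℝ) (n : ℕ) : 0 < wt s n := by unfold wt; positivity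

theorem wt_add (s r : ℝ) (n : ℕ) : wt (s + r) n = wt s n * wt r n := by
  unfold wt; exact Real.rpow_add (by positivity) _ _

theorem wt_one (n : ℕ) : wt 1 n = 1 + (n : ℝ) ^ 2 := by simp [wt]

theorem sum_le_norm_sq {s : ℝ} (u : ChebW s) (F : Finset ℕ) :
    ∑ n ∈ F, wt s n * ‖u.coeff n‖ ^ 2 ≤ ‖u‖ ^ 2 := by
  rw [norm_sq_eq]
  exact u.summable_coeff.sum_le_tsum F (fun n _ => mul_nonneg (wt_pos s n).le (sq_nonneg _))

theorem norm_sq_le_of_sum_le {s : ℝ} (u : ChebW s) (C : ℝ)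
    (h : ∀ F : Finset ℕ, ∑ n ∈ F, wt s n * ‖u.coeff n‖ ^ 2 ≤ C) : ‖u‖ ^ 2 ≤ C := by
  rw [norm_sq_eq]
  exact u.summable_coeff.tsum_le_of_sum_le h

/-- A sequence with finite `W^s` norm as an element of `W^s`. -/
def mk {s : ℝ} (a : ℕ → ℂ) (ha : Summable fun n => wt s n * ‖a n‖ ^ 2) : ChebW s := ⟨a, ha⟩

@[simp] theorem coeff_mk {s : ℝ} (a : ℕ → ℂ) (ha : Summable fun n => wt s n * ‖a n‖ ^ 2) (n : ℕ) :
    (mk a ha).coeff n = a n := rfl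

@[simp] theorem coeff_zero {s : ℝ} (n : ℕ) : (0 : ChebW s).coeff n = 0 := rfl

theorem coeff_sub {s : ℝ} (u v : ChebW s) (n : ℕ) : (u - v).coeff n = u.coeff n - v.coeff n := rfl

theorem coeff_chebT (s : ℝ) (n m : ℕ) : (chebT s n).coeff m = if m = n then 1 else 0 := by
  change (Pi.single n 1 : ℕ → ℂ) m = _
  rw [Pi.single_apply]

theorem coeff_chebT_of_ne (s : ℝ) {n m : ℕ} (h : m ≠ n) : (chebT s n).coeff m = 0 := by
  simp [coeff_chebT, h]

theorem isometry_toL2 (s : ℝ) : Isometry (toL2 s) :=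
  AddMonoidHomClass.isometry_of_norm _ (fun _ => rfl)

theorem toL2_surjective (s : ℝ) : Function.Surjective (toL2 s) := by
  intro f
  have hne : ∀ n : ℕ, (((1 + (n : ℝ) ^ 2) ^ (s / 2) : ℝ) : ℂ) ≠ 0 := fun n => by
    have h0 : (0 : ℝ) < (1 + (n : ℝ) ^ 2) ^ (s / 2) := by positivity
    exact_mod_cast h0.ne'
  have key : ∀ n : ℕ, (((1 + (n : ℝ) ^ 2) ^ (s / 2) : ℝ) : ℂ) *
      ((((1 + (n : ℝ) ^ 2) ^ (s / 2) : ℝ) : ℂ)⁻¹ * f n) = f n := fun n =>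
    mul_inv_cancel_left₀ (hne n) _
  refine ⟨mk (fun n => (((1 + (n : ℝ) ^ 2) ^ (s / 2) : ℝ) : ℂ)⁻¹ * f n) ?_, ?_⟩
  · have := (lp.memℓp f).summable (by simp)
    refine this.congr fun n => ?_
    rw [wt, ← norm_weight_sq, key]
    simp
  · ext n
    exact key n

/-- Completeness is needed for norm convergent series of operators and for norm limits of compact
operators to be compact. -/
instance (s : ℝ) : CompleteSpace (ChebW s) :=
  ((isometry_toL2 s).isUniformInducing.completeSpace_congr (toL2_surjective s)).2 inferInstance

/-- A bounded operator given by its effect on coefficients. -/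
noncomputable def ofCoeff {s r : ℝ} (T : ChebW s →ₗ[ℂ] (ℕ → ℂ)) (C : ℝ)
    (hC : ∀ u, ∀ F : Finset ℕ, ∑ n ∈ F, wt r n * ‖T u n‖ ^ 2 ≤ C ^ 2 * ‖u‖ ^ 2) :
    ChebW s →L[ℂ] ChebW r :=
  -- The bound on finite partial sums yields at once that the image lies in `W^r` and that the
  -- operator is bounded.
  LinearMap.mkContinuous
    { toFun := fun u => mk (T u) (summable_of_sum_le
        (fun n => mul_nonneg (wt_pos r n).le (sq_nonneg _)) (hC u))
      map_add' := fun u v => ext_coeff fun n => by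
        change T (u + v) n = T u n + T v n
        simp
      map_smul' := fun c u => ext_coeff fun n => by
        change T (c • u) n = c * T u n
        simp }
    |C| (fun u => by
      refine abs_le_of_sq_le_sq' ?_ (by positivity) |>.2
      rw [mul_pow, sq_abs]
      exact norm_sq_le_of_sum_le _ _ (hC u))

theorem norm_ofCoeff_le {s r : ℝ} (T : ChebW s →ₗ[ℂ] (ℕ → ℂ)) (C : ℝ)
    (hC : ∀ u, ∀ F : Finset ℕ, ∑ n ∈ F, wt r n * ‖T u n‖ ^ 2 ≤ C ^ 2 * ‖u‖ ^ 2) :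
    ‖ofCoeff T C hC‖ ≤ |C| :=
  LinearMap.mkContinuous_norm_le _ (abs_nonneg C) _

/-- The coefficient functionals. -/
noncomputable def coeffCLM (s : ℝ) (n : ℕ) : ChebW s →L[ℂ] ℂ :=
  LinearMap.mkContinuous
    { toFun := fun u => u.coeff n
      map_add' := fun u v => coeff_add u v n
      map_smul' := fun c u => coeff_smul c u n }
    (√(wt s n))⁻¹ (fun u => by
      have h := sum_le_norm_sq u {n}
      rw [Finset.sum_singleton] at h
      have h1 := Real.sqrt_pos.2 (wt_pos s n)
      change ‖u.coeff n‖ ≤ _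
      rw [inv_mul_eq_div, le_div_iff₀ h1]
      refine abs_le_of_sq_le_sq' ?_ (norm_nonneg _) |>.2
      rw [mul_pow, Real.sq_sqrt (wt_pos s n).le]
      linarith)

@[simp] theorem coeffCLM_apply (s : ℝ) (n : ℕ) (u : ChebW s) : coeffCLM s n u = u.coeff n := rfl

theorem coeff_sum {s : ℝ} {ι : Type*} (F : Finset ι) (u : ι → ChebW s) (n : ℕ) :
    (∑ i ∈ F, u i).coeff n = ∑ i ∈ F, (u i).coeff n := by
  exact map_sum (coeffCLM s n) u F

/-- The Chebyshev expansion converges in `W^s`. -/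
theorem hasSum_chebT {s : ℝ} (u : ChebW s) : HasSum (fun n => u.coeff n • chebT s n) u := by
  have hu := u.summable_coeff
  rw [HasSum, tendsto_iff_norm_sub_tendsto_zero]
  -- Pythagoras: the squared norm of the remainder is the tail of the series for `‖u‖²`.
  have key : ∀ F : Finset ℕ, ‖∑ n ∈ F, u.coeff n • chebT s n - u‖ ^ 2 =
      ∑' n, wt s n * ‖u.coeff n‖ ^ 2 - ∑ n ∈ F, wt s n * ‖u.coeff n‖ ^ 2 := by
    intro F
    have h1 : ∀ n, (∑ m ∈ F, u.coeff m • chebT s m - u).coeff n =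
        (if n ∈ F then 0 else - u.coeff n) := by
      intro n
      rw [coeff_sub, coeff_sum]
      simp only [coeff_smul, coeff_chebT, mul_ite, mul_one, mul_zero]
      rw [Finset.sum_ite_eq]
      split_ifs <;> simp
    rw [norm_sq_eq, eq_sub_iff_add_eq']
    have h2 : HasSum (fun n => if n ∈ F then wt s n * ‖u.coeff n‖ ^ 2 else 0)
        (∑ n ∈ F, if n ∈ F then wt s n * ‖u.coeff n‖ ^ 2 else 0) :=
      hasSum_sum_of_ne_finset_zero (fun n hn => if_neg hn)
    have h3 := (∑ m ∈ F, u.coeff m • chebT s m - u).summable_coeff.hasSum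
    rw [Finset.sum_congr rfl (fun n hn => if_pos hn)] at h2
    refine (h2.add h3).unique ?_
    convert hu.hasSum using 2 with n
    · rw [h1]
      by_cases hn : n ∈ F <;> simp [hn, wt]
    · rfl
  have h0 : Tendsto (fun F : Finset ℕ => ‖∑ n ∈ F, u.coeff n • chebT s n - u‖ ^ 2) atTop (𝓝 0) := by
    simp_rw [key]
    have := (tendsto_const_nhds (x := ∑' n, wt s n * ‖u.coeff n‖ ^ 2)).sub hu.hasSum
    simpa [wt] using this
  have := h0.sqrt
  simpa [Real.sqrt_sq (norm_nonneg _)] using this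

/-- Bounded operators agreeing on the Chebyshev polynomials are equal. -/
theorem clm_ext {s r : ℝ} {A B : ChebW s →L[ℂ] ChebW r}
    (h : ∀ n, A (chebT s n) = B (chebT s n)) : A = B := by
  ext1 u
  have hA := (hasSum_chebT u).mapL A
  have hB := (hasSum_chebT u).mapL B
  simp only [map_smul, h] at hA hB
  exact hA.unique hB

end ChebW

/-! ### Diagonal operators and shifts; a compactness criterion. -/

namespace ChebW

/-- Comparability from both sides is assumed so that exponents of either sign are covered: a
negative power reverses the inequality between the bases. -/
theorem rpow_le_four_rpow_abs_mul {x y : ℝ} (hx : 0 < x) (hy : 0 < y) (h1 : x ≤ 4 * y)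
    (h2 : y ≤ 4 * x) (r : ℝ) : x ^ r ≤ 4 ^ |r| * y ^ r := by
  rcases le_or_gt 0 r with hr | hr
  · rw [abs_of_nonneg hr, ← Real.mul_rpow (by norm_num) hy.le]
    exact Real.rpow_le_rpow hx.le h1 hr
  · have h3 : y ^ (-r) ≤ 4 ^ (-r) * x ^ (-r) := by
      rw [← Real.mul_rpow (by norm_num) hx.le]
      exact Real.rpow_le_rpow hy.le h2 (by linarith)
    rw [abs_of_neg hr]
    rw [Real.rpow_neg hx.le, Real.rpow_neg hy.le] at h3
    have hxr := Real.rpow_pos_of_pos hx r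
    have hyr := Real.rpow_pos_of_pos hy r
    field_simp at h3
    linarith

theorem wt_le_succ (r : ℝ) (n : ℕ) : wt r n ≤ 4 ^ |r| * wt r (n + 1) := by
  unfold wt
  refine rpow_le_four_rpow_abs_mul (by positivity) (by positivity) ?_ ?_ r <;>
    push_cast <;> nlinarith [sq_nonneg ((n : ℝ) - 1), sq_nonneg ((n : ℝ) + 1), sq_nonneg (n : ℝ)]

theorem wt_succ_le (r : ℝ) (n : ℕ) : wt r (n + 1) ≤ 4 ^ |r| * wt r n := by
  unfold wt
  refine rpow_le_four_rpow_abs_mul (by positivity) (by positivity) ?_ ?_ r <;>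
    push_cast <;> nlinarith [sq_nonneg ((n : ℝ) - 1), sq_nonneg ((n : ℝ) + 1), sq_nonneg (n : ℝ)]

/-- The operator `u ↦ (cₙ u_{σ n})ₙ`. -/
noncomputable def reindex (s r : ℝ) (c : ℕ → ℂ) (σ : ℕ → ℕ) (K : ℝ)
    (hσ : InjOn σ {n | c n ≠ 0}) (hK : ∀ n, wt r n * ‖c n‖ ^ 2 ≤ K ^ 2 * wt s (σ n)) :
    ChebW s →L[ℂ] ChebW r :=
  ofCoeff
    { toFun := fun u n => c n * u.coeff (σ n)
      map_add' := fun u v => by ext n; simp [coeff_add, mul_add]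
      map_smul' := fun a u => by ext n; simp [coeff_smul]; ring }
    K (fun u F => by
      classical
      have h1 : ∑ n ∈ F, wt r n * ‖c n * u.coeff (σ n)‖ ^ 2 ≤
          ∑ n ∈ F with c n ≠ 0, K ^ 2 * (wt s (σ n) * ‖u.coeff (σ n)‖ ^ 2) := by
        rw [Finset.sum_filter]
        refine Finset.sum_le_sum fun n _ => ?_
        split_ifs with h
        · rw [norm_mul, mul_pow, ← mul_assoc, ← mul_assoc]
          exact mul_le_mul_of_nonneg_right (hK n) (sq_nonneg _)
        · simp [not_not.1 h]
      refine h1.trans ?_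
      -- Injectivity of `σ` on the support of `c` makes this a sum over distinct coefficients of
      -- `u`, hence a partial sum of `‖u‖²`.
      rw [← Finset.mul_sum, ← Finset.sum_image (s := F.filter (fun n => c n ≠ 0)) (g := σ)
        (f := fun m => wt s m * ‖u.coeff m‖ ^ 2)]
      · exact mul_le_mul_of_nonneg_left (sum_le_norm_sq u _) (sq_nonneg K)
      · intro a ha b hb h
        exact hσ (by simpa using (Finset.mem_filter.1 ha).2)
          (by simpa using (Finset.mem_filter.1 hb).2) h)

theorem norm_reindex_le {s r : ℝ} {c : ℕ → ℂ} {σ : ℕ → ℕ} {K : ℝ}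
    {hσ : InjOn σ {n | c n ≠ 0}} {hK : ∀ n, wt r n * ‖c n‖ ^ 2 ≤ K ^ 2 * wt s (σ n)} :
    ‖reindex s r c σ K hσ hK‖ ≤ |K| := norm_ofCoeff_le _ _ _

/-- The diagonal operator with entries `m`. -/
noncomputable def diag (s r : ℝ) (m : ℕ → ℂ) (K : ℝ)
    (hK : ∀ n, wt r n * ‖m n‖ ^ 2 ≤ K ^ 2 * wt s n) : ChebW s →L[ℂ] ChebW r :=
  reindex s r m id K (injOn_id _) hK

theorem coeff_diag {s r : ℝ} {m : ℕ → ℂ} {K : ℝ}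
    {hK : ∀ n, wt r n * ‖m n‖ ^ 2 ≤ K ^ 2 * wt s n} (u : ChebW s) (n : ℕ) :
    (diag s r m K hK u).coeff n = m n * u.coeff n := rfl

theorem sqrt_four_rpow_sq (r : ℝ) : (√((4 : ℝ) ^ |r|)) ^ 2 = 4 ^ |r| :=
  Real.sq_sqrt (by positivity)

/-- The shift `Tₙ ↦ Tₙ₊₁`. -/
noncomputable def shiftUp (s : ℝ) : ChebW s →L[ℂ] ChebW s :=
  -- The entry `0` at `n = 0` discards the truncated value `0 - 1 = 0`, which would spoil
  -- injectivity.
  reindex s s (fun n => if n = 0 then 0 else 1) (fun n => n - 1) √((4 : ℝ) ^ |s|)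
    (by
      intro a ha b hb h
      simp only [ne_eq, ite_eq_left_iff, one_ne_zero, imp_false, not_not, mem_ofPred_eq] at ha hb h
      omega)
    (by
      rintro (_ | n)
      · simpa using mul_nonneg (sq_nonneg _) (wt_pos s _).le
      · rw [sqrt_four_rpow_sq]
        simpa using wt_succ_le s n)

theorem coeff_shiftUp_zero {s : ℝ} (u : ChebW s) : (shiftUp s u).coeff 0 = 0 := by
  change (if 0 = 0 then (0 : ℂ) else 1) * u.coeff (0 - 1) = 0
  simp

theorem coeff_shiftUp_succ {s : ℝ} (u : ChebW s) (n : ℕ) :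
    (shiftUp s u).coeff (n + 1) = u.coeff n := by
  change (if n + 1 = 0 then (0 : ℂ) else 1) * u.coeff (n + 1 - 1) = u.coeff n
  simp

/-- The shift `Tₙ ↦ Tₙ₋₁`, `T₀ ↦ 0`. -/
noncomputable def shiftDown (s : ℝ) : ChebW s →L[ℂ] ChebW s :=
  reindex s s (fun _ => 1) (fun n => n + 1) √((4 : ℝ) ^ |s|)
    (fun a _ b _ h => by simpa using h)
    (fun n => by
      rw [sqrt_four_rpow_sq]
      simpa using wt_le_succ s n)

theorem coeff_shiftDown {s : ℝ} (u : ChebW s) (n : ℕ) :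
    (shiftDown s u).coeff n = u.coeff (n + 1) := by
  exact one_mul _

theorem isCompactOperator_smulRight_chebT {s r : ℝ} (f : ChebW s →L[ℂ] ℂ) (v : ChebW r) :
    IsCompactOperator (f.smulRight v) := by
  have : f.smulRight v = (ContinuousLinearMap.toSpanSingleton ℂ v).comp f := by
    ext u; simp
  rw [this]
  exact (isCompactOperator_of_locallyCompactSpace_rng
    (ContinuousLinearMap.toSpanSingleton ℂ v)).comp_clm f

theorem isCompactOperator_sum {s r : ℝ} {ι : Type*} (F : Finset ι) (A : ι → ChebW s →L[ℂ] ChebW r)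
    (h : ∀ i ∈ F, IsCompactOperator (A i)) : IsCompactOperator (∑ i ∈ F, A i : ChebW s →L[ℂ] ChebW r) := by
  classical
  induction F using Finset.induction_on with
  | empty => simpa using isCompactOperator_zero
  | insert i F hi ih =>
    rw [Finset.sum_insert hi]
    exact (h i (by simp)).add (ih fun j hj => h j (by simp [hj]))

/-- A diagonal operator whose entries, measured in the norms of the two spaces, tend to zero
is compact. -/
theorem isCompactOperator_diag {s r : ℝ} {m : ℕ → ℂ} {K : ℝ}
    {hK : ∀ n, wt r n * ‖m n‖ ^ 2 ≤ K ^ 2 * wt s n}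
    (h0 : Tendsto (fun n => wt r n * ‖m n‖ ^ 2 / wt s n) atTop (𝓝 0)) :
    IsCompactOperator (diag s r m K hK) := by
  classical
  -- The finite sections have finite rank, and what remains is a diagonal operator whose relative
  -- entries are all small; so the sections converge in operator norm.
  have key : Tendsto (fun N => ∑ n ∈ Finset.range N,
      (coeffCLM s n).smulRight (m n • chebT r n)) atTop (𝓝 (diag s r m K hK)) := by
    rw [Metric.tendsto_atTop]
    intro ε hε
    obtain ⟨N, hN⟩ := (h0.eventually_lt_const
      (show 0 < (ε / 2) ^ 2 by positivity)).exists_forall_of_atTop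
    refine ⟨N, fun M hM => ?_⟩
    rw [dist_comm, dist_eq_norm]
    have hle : ∀ n, wt r n * ‖if n < M then 0 else m n‖ ^ 2 ≤ (ε / 2) ^ 2 * wt s n := by
      intro n
      split_ifs with h
      · simpa using mul_nonneg (sq_nonneg _) (wt_pos s _).le
      · have := (hN n (by omega)).le
        rwa [div_le_iff₀ (wt_pos s n)] at this
    have heq : diag s r m K hK - ∑ n ∈ Finset.range M,
        (coeffCLM s n).smulRight (m n • chebT r n) =
        diag s r (fun n => if n < M then 0 else m n) (ε / 2) hle := by
      ext1 u
      refine ext_coeff fun n => ?_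
      rw [_root_.sub_apply, coeff_sub, _root_.sum_apply, coeff_sum,
        coeff_diag, coeff_diag]
      simp only [ContinuousLinearMap.smulRight_apply, coeffCLM_apply, coeff_smul, coeff_chebT,
        mul_ite, mul_one, mul_zero, Finset.sum_ite_eq, Finset.mem_range]
      split_ifs <;> ring
    rw [heq]
    refine (norm_reindex_le).trans_lt ?_
    rw [abs_of_pos (by positivity)]
    linarith
  refine isCompactOperator_of_tendsto key (Eventually.of_forall fun N => ?_)
  exact isCompactOperator_sum _ _ fun n _ => isCompactOperator_smulRight_chebT _ _

end ChebW

/-! ### Weighted Hardy inequality for tail sums in steps of two. -/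

namespace ChebW

/-- Differences of powers at consecutive points are comparable to the derivative. -/
theorem abs_mul_rpow_sub_one_le {a x y : ℝ} (hx : 1 ≤ x) (hy1 : x ≤ y) (hy2 : y ≤ x + 1) :
    |a| * y ^ (a - 1) ≤ 4 ^ |a - 1| * |(x + 1) ^ a - x ^ a| := by
  obtain ⟨ξ, hξ, h⟩ := exists_hasDerivAt_eq_slope (fun z : ℝ => z ^ a)
    (fun z => a * z ^ (a - 1)) (show x < x + 1 by linarith)
    (ContinuousOn.rpow_const continuousOn_id fun z hz => Or.inl
      (show z ≠ 0 from (by linarith [hz.1] : 0 < z).ne'))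
    (fun z hz => Real.hasDerivAt_rpow_const (Or.inl (by linarith [hz.1] : 0 < z).ne'))
  have hξ1 := hξ.1
  have hξ2 := hξ.2
  have h' : (x + 1) ^ a - x ^ a = a * ξ ^ (a - 1) := by
    rw [h]; simp
  rw [h', abs_mul, abs_of_nonneg (Real.rpow_nonneg (by linarith : (0 : ℝ) ≤ ξ) _)]
  have := rpow_le_four_rpow_abs_mul (x := y) (y := ξ) (by linarith) (by linarith)
    (by linarith) (by linarith) (a - 1)
  nlinarith [abs_nonneg a, mul_le_mul_of_nonneg_left this (abs_nonneg a)]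

/-- An integral test done by telescoping: by the mean value theorem each term is at most a constant
times a consecutive difference of `x ^ (-σ)`. The companion `sum_rpow_le` does the same with `x ^
σ`. -/
theorem sum_rpow_neg_le {σ : ℝ} (hσ : 0 < σ) (n N : ℕ) :
    ∑ i ∈ Finset.range N, ((n : ℝ) + 1 + (i + 1)) ^ (-1 - σ) ≤
      4 ^ (σ + 1) / σ * ((n : ℝ) + 1) ^ (-σ) := by
  have key : ∀ N : ℕ, ∑ i ∈ Finset.range N, ((n : ℝ) + 1 + (i + 1)) ^ (-1 - σ) ≤
      4 ^ (σ + 1) / σ * (((n : ℝ) + 1) ^ (-σ) - ((n : ℝ) + 1 + N) ^ (-σ)) := by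
    intro N
    induction N with
    | zero => simp
    | succ N ih =>
      rw [Finset.sum_range_succ]
      have h := abs_mul_rpow_sub_one_le (a := -σ) (x := (n : ℝ) + 1 + N) (y := (n : ℝ) + 1 + (N + 1))
        (by have := Nat.cast_nonneg (α := ℝ) n; have := Nat.cast_nonneg (α := ℝ) N; linarith)
        (by linarith) (by linarith)
      have h1 : ((n : ℝ) + 1 + N + 1) ^ (-σ) ≤ ((n : ℝ) + 1 + N) ^ (-σ) :=
        Real.rpow_le_rpow_of_nonpos (by positivity) (by linarith) (by linarith)
      rw [abs_neg, abs_of_pos hσ, show -σ - 1 = -(σ + 1) by ring, abs_neg,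
        abs_of_pos (by linarith : 0 < σ + 1), abs_sub_comm, abs_of_nonneg (sub_nonneg.2 h1),
        show -(σ + 1) = -1 - σ by ring] at h
      rw [mul_comm, ← le_div_iff₀ hσ] at h
      push_cast
      rw [show (n : ℝ) + 1 + (N + 1) = (n : ℝ) + 1 + N + 1 by ring] at *
      calc _ ≤ _ := add_le_add ih h
        _ = _ := by ring
  refine (key N).trans ?_
  have : 0 ≤ ((n : ℝ) + 1 + N) ^ (-σ) := by positivity
  gcongr
  linarith

theorem sum_rpow_le {σ : ℝ} (hσ : 0 < σ) (m : ℕ) :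
    ∑ n ∈ Finset.range m, ((n : ℝ) + 1) ^ (σ - 1) ≤ 4 ^ |σ - 1| / σ * ((m : ℝ) + 1) ^ σ := by
  induction m with
  | zero => simp; positivity
  | succ m ih =>
    rw [Finset.sum_range_succ]
    have h := abs_mul_rpow_sub_one_le (a := σ) (x := (m : ℝ) + 1) (y := (m : ℝ) + 1)
      (by have := Nat.cast_nonneg (α := ℝ) m; linarith) le_rfl (by linarith)
    have h1 : ((m : ℝ) + 1) ^ σ ≤ ((m : ℝ) + 1 + 1) ^ σ :=
      Real.rpow_le_rpow (by positivity) (by linarith) hσ.le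
    rw [abs_of_pos hσ, abs_of_nonneg (sub_nonneg.2 h1), mul_comm, ← le_div_iff₀ hσ] at h
    push_cast
    calc _ ≤ _ := add_le_add ih h
      _ = _ := by ring

theorem wt_le_rpow (s : ℝ) (n : ℕ) : wt s n ≤ 4 ^ |s| * ((n : ℝ) + 1) ^ (2 * s) := by
  rw [Real.rpow_mul (by positivity)]
  refine rpow_le_four_rpow_abs_mul (by positivity) (by positivity) ?_ ?_ s <;>
    simp only [Real.rpow_ofNat] <;> nlinarith [sq_nonneg ((n : ℝ) - 1), Nat.cast_nonneg (α := ℝ) n]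

theorem rpow_le_wt (s : ℝ) (n : ℕ) : ((n : ℝ) + 1) ^ (2 * s) ≤ 4 ^ |s| * wt s n := by
  rw [Real.rpow_mul (by positivity)]
  refine rpow_le_four_rpow_abs_mul (by positivity) (by positivity) ?_ ?_ s <;>
    simp only [Real.rpow_ofNat] <;> nlinarith [sq_nonneg ((n : ℝ) - 1), Nat.cast_nonneg (α := ℝ) n]

/-- Each `‖u_n‖` is at most `W ‖u_n‖² + W⁻¹` with `W` the weight of `W^{s+1}`. The first part sums
to `‖u‖²`, and `W⁻¹` is of size `n^{-2(s+1)}`, summable because `2(s+1) > 1`. -/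
theorem summable_norm_coeff {s : ℝ} (hs : -1 / 2 < s) (u : ChebW (s + 1)) :
    Summable fun n => ‖u.coeff n‖ := by
  have h1 : Summable fun n : ℕ => 4 ^ |s + 1| * ((n : ℝ) + 1) ^ (-(2 * (s + 1))) := by
    refine Summable.mul_left _ ?_
    have := (summable_nat_add_iff 1).2
      (Real.summable_nat_rpow (p := -(2 * (s + 1))).2 (by linarith))
    simpa using this
  refine Summable.of_nonneg_of_le (fun n => norm_nonneg _) (fun n => ?_) (u.summable_coeff.add h1)
  have h2 := rpow_le_wt (s + 1) n
  have hp : 0 < ((n : ℝ) + 1) ^ (2 * (s + 1)) := by positivity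
  have hw := wt_pos (s + 1) n
  change _ ≤ wt (s + 1) n * _ + _
  rw [Real.rpow_neg (by positivity)]
  have h3 : (wt (s + 1) n)⁻¹ ≤ 4 ^ |s + 1| * (((n : ℝ) + 1) ^ (2 * (s + 1)))⁻¹ := by
    rw [← div_eq_mul_inv, inv_eq_one_div, div_le_div_iff₀ hw hp]
    linarith
  refine le_trans ?_ (add_le_add le_rfl h3)
  have h4 : ‖u.coeff n‖ = wt (s + 1) n * ‖u.coeff n‖ * (wt (s + 1) n)⁻¹ := by
    field_simp
  -- Completing the square proves `‖u_n‖ ≤ W ‖u_n‖² + W⁻¹`.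
  have h5 : wt (s + 1) n * ‖u.coeff n‖ ^ 2 + (wt (s + 1) n)⁻¹ - ‖u.coeff n‖ =
      (wt (s + 1) n)⁻¹ * ((wt (s + 1) n * ‖u.coeff n‖ - 1 / 2) ^ 2 + 3 / 4) := by
    field_simp
    ring
  have : 0 ≤ (wt (s + 1) n)⁻¹ * ((wt (s + 1) n * ‖u.coeff n‖ - 1 / 2) ^ 2 + 3 / 4) := by positivity
  linarith

theorem injective_add_two_mul (n : ℕ) : Function.Injective fun i : ℕ => n + 2 * (i + 1) :=
  fun a b h => by simpa using h

theorem summable_coeff_step {s : ℝ} (hs : -1 / 2 < s) (u : ChebW (s + 1)) (n : ℕ) :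
    Summable fun i : ℕ => u.coeff (n + 2 * (i + 1)) :=
  ((summable_norm_coeff hs u).comp_injective (injective_add_two_mul n)).of_norm

/-- The weighted `ℓ²` tail sums occurring in Hardy's inequality. -/
theorem norm_tsum_step_sq_le {s : ℝ} (hs : -1 / 2 < s) (u : ChebW (s + 1)) (n : ℕ)
    (hsum : Summable fun m : ℕ => if n < m then ((m : ℝ) + 1) ^ (s + 3 / 2) * ‖u.coeff m‖ ^ 2 else 0) :
    ‖∑' i : ℕ, u.coeff (n + 2 * (i + 1))‖ ^ 2 ≤
      4 ^ (s + 3 / 2) / (s + 1 / 2) * ((n : ℝ) + 1) ^ (-(s + 1 / 2)) *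
        ∑' m : ℕ, if n < m then ((m : ℝ) + 1) ^ (s + 3 / 2) * ‖u.coeff m‖ ^ 2 else 0 := by
  have hσ : 0 < s + 1 / 2 := by linarith
  have hlim := ((summable_coeff_step hs u n).hasSum.tendsto_sum_nat.norm.pow 2)
  refine le_of_tendsto' hlim fun N => ?_
  have h1 : ‖∑ i ∈ Finset.range N, u.coeff (n + 2 * (i + 1))‖ ≤
      ∑ i ∈ Finset.range N, ‖u.coeff (n + 2 * (i + 1))‖ := norm_sum_le _ _
  -- Cauchy–Schwarz with the weight `(m+1)^{s+3/2}`. The reciprocal weight has exponent `-1 - (s +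
  -- 1/2) < -1`, so its tail beyond `n` is of size `(n+1)^{-(s+1/2)}`.
  have h2 := Finset.sum_sq_le_sum_mul_sum_of_sq_le_mul (Finset.range N)
    (r := fun i => ‖u.coeff (n + 2 * (i + 1))‖)
    (f := fun i => (((n + 2 * (i + 1) : ℕ) : ℝ) + 1) ^ (-1 - (s + 1 / 2)))
    (g := fun i => (((n + 2 * (i + 1) : ℕ) : ℝ) + 1) ^ (s + 3 / 2) * ‖u.coeff (n + 2 * (i + 1))‖ ^ 2)
    (fun i _ => by positivity) (fun i _ => by positivity)
    (fun i _ => by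
      rw [← mul_assoc, ← Real.rpow_add (by positivity), show -1 - (s + 1 / 2) + (s + 3 / 2) = 0 by ring,
        Real.rpow_zero, one_mul])
  have h3 : ∑ i ∈ Finset.range N, (((n + 2 * (i + 1) : ℕ) : ℝ) + 1) ^ (-1 - (s + 1 / 2)) ≤
      4 ^ (s + 3 / 2) / (s + 1 / 2) * ((n : ℝ) + 1) ^ (-(s + 1 / 2)) := by
    have := sum_rpow_neg_le hσ n N
    rw [show s + 1 / 2 + 1 = s + 3 / 2 by ring] at this
    refine le_trans (Finset.sum_le_sum fun i _ => ?_) this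
    refine Real.rpow_le_rpow_of_nonpos (by positivity) ?_ (by linarith)
    push_cast
    have := Nat.cast_nonneg (α := ℝ) i
    linarith
  have h4 : ∑ i ∈ Finset.range N, (((n + 2 * (i + 1) : ℕ) : ℝ) + 1) ^ (s + 3 / 2) *
      ‖u.coeff (n + 2 * (i + 1))‖ ^ 2 ≤
      ∑' m : ℕ, if n < m then ((m : ℝ) + 1) ^ (s + 3 / 2) * ‖u.coeff m‖ ^ 2 else 0 := by
    have := hsum.sum_le_tsum ((Finset.range N).image fun i : ℕ => n + 2 * (i + 1))
      (fun m _ => by split_ifs <;> positivity)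
    rw [Finset.sum_image fun a _ b _ h => injective_add_two_mul n h] at this
    refine le_trans (Finset.sum_le_sum fun i _ => ?_) this
    rw [if_pos (by omega)]
  calc _ ≤ (∑ i ∈ Finset.range N, ‖u.coeff (n + 2 * (i + 1))‖) ^ 2 := by gcongr
    _ ≤ _ := h2
    _ ≤ _ := mul_le_mul h3 h4 (Finset.sum_nonneg fun i _ => by positivity) (by positivity)

/-- A weighted Hardy inequality. -/
theorem exists_hardy_bound {s : ℝ} (hs : -1 / 2 < s) : ∃ C : ℝ, ∀ (u : ChebW (s + 1))
    (F : Finset ℕ), ∑ n ∈ F, wt s n * ‖∑' i : ℕ, u.coeff (n + 2 * (i + 1))‖ ^ 2 ≤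
      C ^ 2 * ‖u‖ ^ 2 := by
  have hσ : 0 < s + 1 / 2 := by linarith
  set A : ℝ := 4 ^ (s + 3 / 2) / (s + 1 / 2) with hA
  set B : ℝ := 4 ^ |s + 1 / 2 - 1| / (s + 1 / 2) with hB
  have hA0 : 0 < A := by positivity
  have hB0 : 0 < B := by positivity
  set D : ℝ := 4 ^ |s| * A * B * 4 ^ |s + 1| with hD
  have hD0 : 0 < D := by positivity
  refine ⟨√D, fun u F => ?_⟩
  rw [Real.sq_sqrt hD0.le]
  set q : ℕ → ℝ := fun m => ((m : ℝ) + 1) ^ (s + 3 / 2) * ‖u.coeff m‖ ^ 2 with hq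
  have hq0 : ∀ m, 0 ≤ q m := fun m => by positivity
  have hqs : Summable q := by
    refine Summable.of_nonneg_of_le hq0 (fun m => ?_) (u.summable_coeff.mul_left (4 ^ |s + 1|))
    change _ ≤ _ * (wt (s + 1) m * _)
    rw [← mul_assoc]
    refine mul_le_mul_of_nonneg_right (le_trans ?_ (rpow_le_wt (s + 1) m)) (sq_nonneg _)
    exact Real.rpow_le_rpow_of_exponent_le (by simp) (by linarith)
  have hqn : ∀ n, Summable fun m => if n < m then q m else 0 := fun n =>
    Summable.of_nonneg_of_le (fun m => by split_ifs <;> simp [hq0])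
      (fun m => by split_ifs <;> simp [hq0]) hqs
  have h1 : ∀ n ∈ F, wt s n * ‖∑' i : ℕ, u.coeff (n + 2 * (i + 1))‖ ^ 2 ≤
      ∑' m, 4 ^ |s| * A * ((n : ℝ) + 1) ^ (s + 1 / 2 - 1) * (if n < m then q m else 0) := by
    intro n _
    have h := norm_tsum_step_sq_le hs u n (hqn n)
    rw [tsum_mul_left]
    calc _ ≤ (4 ^ |s| * ((n : ℝ) + 1) ^ (2 * s)) * (A * ((n : ℝ) + 1) ^ (-(s + 1 / 2)) *
        ∑' m : ℕ, if n < m then q m else 0) :=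
          mul_le_mul (wt_le_rpow s n) h (by positivity) (by positivity)
      _ = _ := by
        rw [show s + 1 / 2 - 1 = 2 * s + -(s + 1 / 2) by ring, Real.rpow_add (by positivity)]
        ring
  refine (Finset.sum_le_sum h1).trans ?_
  -- The order of summation is exchanged: for fixed `m` it remains to sum `(n+1)^{(s+1/2)-1}` over
  -- `n < m`, which costs a factor `(m+1)^{s+1/2}`.
  rw [← Summable.tsum_finsetSum (fun n _ => (hqn n).mul_left _), norm_sq_eq, ← tsum_mul_left]
  refine Summable.tsum_le_tsum (fun m => ?_)
    (summable_sum fun n _ => (hqn n).mul_left _) (u.summable_coeff.mul_left D)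
  have h2 : ∑ n ∈ F, 4 ^ |s| * A * ((n : ℝ) + 1) ^ (s + 1 / 2 - 1) * (if n < m then q m else 0) ≤
      4 ^ |s| * A * q m * ∑ n ∈ Finset.range m, ((n : ℝ) + 1) ^ (s + 1 / 2 - 1) := by
    rw [Finset.mul_sum]
    calc _ = ∑ n ∈ F with n < m, 4 ^ |s| * A * q m * ((n : ℝ) + 1) ^ (s + 1 / 2 - 1) := by
          rw [Finset.sum_filter]
          refine Finset.sum_congr rfl fun n _ => ?_
          split_ifs <;> ring
      _ ≤ _ := Finset.sum_le_sum_of_subset_of_nonneg (fun n hn => by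
          simpa using (Finset.mem_filter.1 hn).2) (fun n _ _ => by positivity)
  refine h2.trans ?_
  have h3 := sum_rpow_le hσ m
  calc _ ≤ 4 ^ |s| * A * q m * (B * ((m : ℝ) + 1) ^ (s + 1 / 2)) := by gcongr
    -- The exponents `s + 3/2` and `s + 1/2` add up to `2(s+1)`, the order of the weight of
    -- `W^{s+1}`.
    _ = 4 ^ |s| * A * B * ((m : ℝ) + 1) ^ (2 * (s + 1)) * ‖u.coeff m‖ ^ 2 := by
      rw [hq, show 2 * (s + 1) = (s + 3 / 2) + (s + 1 / 2) by ring,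
        Real.rpow_add (by positivity) (s + 3 / 2) (s + 1 / 2)]
      ring
    _ ≤ 4 ^ |s| * A * B * (4 ^ |s + 1| * wt (s + 1) m) * ‖u.coeff m‖ ^ 2 := by
      gcongr
      exact rpow_le_wt _ _
    _ = D * ((1 + (m : ℝ) ^ 2) ^ (s + 1) * ‖u.coeff m‖ ^ 2) := by
      rw [hD, wt]; ring

end ChebW

/-! ### The model operators and the commutator with multiplication by the variable. -/

theorem dEig_succ (n : ℕ) : dEig (n + 1) = 1 / (2 * ((n : ℝ) + 1)) := by simp [dEig]

theorem log_two_mem : 1 / 2 < Real.log 2 ∧ Real.log 2 < 1 :=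
  ⟨by linarith [Real.log_two_gt_d9], by linarith [Real.log_two_lt_d9]⟩

theorem dEig_pos (n : ℕ) : 0 < dEig n := by
  rcases n with _ | n
  · simpa [dEig] using Real.log_pos (by norm_num)
  · rw [dEig_succ]; positivity

namespace ChebW

theorem coeff_add_clm {s r : ℝ} (A B : ChebW s →L[ℂ] ChebW r) (u : ChebW s) (n : ℕ) :
    ((A + B) u).coeff n = (A u).coeff n + (B u).coeff n := rfl

theorem coeff_sub_clm {s r : ℝ} (A B : ChebW s →L[ℂ] ChebW r) (u : ChebW s) (n : ℕ) :
    ((A - B) u).coeff n = (A u).coeff n - (B u).coeff n := rfl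

/-- The operator `Tₙ ↦ dₙ Tₙ`, the weighted logarithmic potential. -/
noncomputable def logOp (s : ℝ) : ChebW s →L[ℂ] ChebW (s + 1) :=
  diag s (s + 1) (fun n => (dEig n : ℂ)) 1 (by
    intro n
    rw [wt_add, wt_one, Complex.norm_real, Real.norm_eq_abs, sq_abs, mul_assoc, one_pow, one_mul]
    refine mul_le_of_le_one_right (wt_pos s n).le ?_
    rcases n with _ | n
    · have := log_two_mem
      have h : dEig 0 = Real.log 2 / 2 := by simp [dEig]
      rw [h]
      push_cast
      nlinarith
    · rw [dEig_succ]
      push_cast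
      rw [div_pow, one_pow, mul_one_div, div_le_one (by positivity)]
      nlinarith [Nat.cast_nonneg (α := ℝ) n])

theorem coeff_logOp {s : ℝ} (u : ChebW s) (n : ℕ) :
    (logOp s u).coeff n = (dEig n : ℂ) * u.coeff n := rfl

theorem logOp_chebT (s : ℝ) (n : ℕ) :
    logOp s (chebT s n) = (dEig n : ℂ) • chebT (s + 1) n := by
  refine ext_coeff fun m => ?_
  rw [coeff_logOp, coeff_smul, coeff_chebT, coeff_chebT]
  split_ifs with h <;> simp [h]

/-- The inverse of `logOp`. -/
noncomputable def logInv (s : ℝ) : ChebW (s + 1) →L[ℂ] ChebW s :=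
  diag (s + 1) s (fun n => ((dEig n)⁻¹ : ℝ)) 4 (by
    intro n
    rw [wt_add, wt_one, Complex.norm_real, Real.norm_eq_abs, sq_abs,
      mul_left_comm]
    refine mul_le_mul_of_nonneg_left ?_ (wt_pos s n).le
    rcases n with _ | n
    · simp only [dEig]
      have := log_two_mem
      norm_num
      rw [div_pow, div_le_iff₀ (by nlinarith)]
      nlinarith
    · rw [dEig_succ]
      push_cast
      rw [one_div, inv_inv]
      nlinarith [Nat.cast_nonneg (α := ℝ) n])

theorem coeff_logInv {s : ℝ} (u : ChebW (s + 1)) (n : ℕ) :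
    (logInv s u).coeff n = ((dEig n)⁻¹ : ℝ) * u.coeff n := rfl

theorem logOp_logInv {s : ℝ} (u : ChebW (s + 1)) : logOp s (logInv s u) = u := by
  refine ext_coeff fun n => ?_
  rw [coeff_logOp, coeff_logInv, ← mul_assoc, ← Complex.ofReal_mul,
    mul_inv_cancel₀ (dEig_pos n).ne']
  simp

theorem logOp_injective (s : ℝ) : Function.Injective (logOp s) := by
  intro u v h
  refine ext_coeff fun n => ?_
  have h1 := congrArg (fun w => w.coeff n) h
  simp only [coeff_logOp] at h1
  exact mul_left_cancel₀ (by exact_mod_cast (dEig_pos n).ne') h1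

/-- The embedding `W^{s+1} → W^s`. -/
noncomputable def emb (s : ℝ) : ChebW (s + 1) →L[ℂ] ChebW s :=
  diag (s + 1) s (fun _ => 1) 1 (by
    intro n
    rw [wt_add, wt_one]
    simp only [norm_one, one_pow, mul_one, one_mul]
    nlinarith [wt_pos s n, sq_nonneg (n : ℝ), mul_nonneg (wt_pos s n).le (sq_nonneg (n : ℝ))])

theorem coeff_emb {s : ℝ} (u : ChebW (s + 1)) (n : ℕ) : (emb s u).coeff n = u.coeff n :=
  one_mul _

theorem emb_chebT (s : ℝ) (n : ℕ) : emb s (chebT (s + 1) n) = chebT s n := by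
  refine ext_coeff fun m => ?_
  rw [coeff_emb, coeff_chebT, coeff_chebT]

theorem tendsto_one_div_wt_one : Tendsto (fun n : ℕ => 1 / (1 + (n : ℝ) ^ 2)) atTop (𝓝 0) := by
  refine Filter.Tendsto.div_atTop tendsto_const_nhds ?_
  refine tendsto_atTop_mono (fun n => ?_) (tendsto_natCast_atTop_atTop (R := ℝ))
  nlinarith [sq_nonneg ((n : ℝ) - 1)]

theorem isCompactOperator_emb (s : ℝ) : IsCompactOperator (emb s) := by
  refine isCompactOperator_diag ?_
  refine tendsto_one_div_wt_one.congr fun n => ?_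
  have := wt_pos s n
  rw [wt_add, wt_one]
  simp only [norm_one, one_pow, mul_one]
  field_simp

/-- Multiplication by the variable, `T₀ ↦ T₁`, `Tₙ ↦ (Tₙ₊₁ + Tₙ₋₁)/2`. -/
noncomputable def mulX (s : ℝ) : ChebW s →L[ℂ] ChebW s :=
  (shiftUp s).comp (diag s s (fun n => if n = 0 then 1 else 1 / 2) 1 (fun n => by
    rw [one_pow, one_mul]
    refine mul_le_of_le_one_right (wt_pos s n).le ?_
    split_ifs <;> norm_num)) + (1 / 2 : ℂ) • shiftDown s

theorem coeff_mulX_zero {s : ℝ} (u : ChebW s) : (mulX s u).coeff 0 = 1 / 2 * u.coeff 1 := by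
  rw [mulX, coeff_add_clm]
  change ((shiftUp s) _).coeff 0 + 1 / 2 * (shiftDown s u).coeff 0 = _
  rw [coeff_shiftUp_zero, coeff_shiftDown, zero_add]

theorem coeff_mulX_succ {s : ℝ} (u : ChebW s) (n : ℕ) :
    (mulX s u).coeff (n + 1) =
      (if n = 0 then 1 else 1 / 2) * u.coeff n + 1 / 2 * u.coeff (n + 2) := by
  rw [mulX, coeff_add_clm]
  change ((shiftUp s) _).coeff (n + 1) + 1 / 2 * (shiftDown s u).coeff (n + 1) = _
  rw [coeff_shiftUp_succ, coeff_shiftDown]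
  rfl

theorem mulX_chebT_zero (s : ℝ) : mulX s (chebT s 0) = chebT s 1 := by
  refine ext_coeff fun m => ?_
  rcases m with _ | m
  · rw [coeff_mulX_zero]; simp [coeff_chebT]
  · rw [coeff_mulX_succ]; rcases m with _ | m <;> simp [coeff_chebT]

theorem mulX_chebT_succ (s : ℝ) (n : ℕ) :
    mulX s (chebT s (n + 1)) = (1 / 2 : ℂ) • chebT s (n + 2) + (1 / 2 : ℂ) • chebT s n := by
  refine ext_coeff fun m => ?_
  rw [coeff_add, coeff_smul, coeff_smul]
  rcases m with _ | m
  · rw [coeff_mulX_zero]; simp only [coeff_chebT]; split_ifs <;> first | contradiction | omega | simp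
  · rw [coeff_mulX_succ]; simp only [coeff_chebT]; split_ifs <;> first | contradiction | omega | simp

/-- The rank one operator with kernel `1` with respect to `dt / w`. -/
noncomputable def meanOp (s r : ℝ) : ChebW s →L[ℂ] ChebW r :=
  (coeffCLM s 0).smulRight ((π : ℂ) • chebT r 0)

theorem meanOp_chebT (s r : ℝ) (n : ℕ) :
    meanOp s r (chebT s n) = ((if n = 0 then π else 0 : ℝ) : ℂ) • chebT r 0 := by
  rw [meanOp, ContinuousLinearMap.smulRight_apply, coeffCLM_apply, coeff_chebT]
  split_ifs with h h' h' <;> first | omega | simp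

theorem isCompactOperator_meanOp (s r : ℝ) : IsCompactOperator (meanOp s r) :=
  isCompactOperator_smulRight_chebT _ _

/-- The commutator with the multiplication by the variable. -/
noncomputable def ad (s r : ℝ) : (ChebW s →L[ℂ] ChebW r) →L[ℂ] (ChebW s →L[ℂ] ChebW r) :=
  ContinuousLinearMap.compL ℂ (ChebW s) (ChebW r) (ChebW r) (mulX r) -
    (ContinuousLinearMap.compL ℂ (ChebW s) (ChebW s) (ChebW r)).flip (mulX s)

theorem ad_apply {s r : ℝ} (A : ChebW s →L[ℂ] ChebW r) :
    ad s r A = (mulX r).comp A - A.comp (mulX s) := rfl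

theorem isCompactOperator_ad {s r : ℝ} {A : ChebW s →L[ℂ] ChebW r} (hA : IsCompactOperator A) :
    IsCompactOperator (ad s r A) :=
  (hA.clm_comp (mulX r)).sub (hA.comp_clm (mulX s))

theorem isCompactOperator_ad_pow {s r : ℝ} {A : ChebW s →L[ℂ] ChebW r} (hA : IsCompactOperator A)
    (n : ℕ) : IsCompactOperator ((ad s r ^ n) A) := by
  induction n with
  | zero => exact hA
  | succ n ih =>
    rw [pow_succ', mul_apply_eq_comp]
    exact isCompactOperator_ad ih

/-- The entries `d_n` are only of order `1/n`; the extra order gained by consecutive differences is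
what makes the commutator of `logOp` compact into `W^{s+1}`. -/
theorem abs_dEig_sub_le (n : ℕ) : |dEig n - dEig (n + 1)| ≤ 2 / (1 + (n : ℝ) ^ 2) := by
  rcases n with _ | n
  · have := log_two_mem
    simp only [dEig]
    norm_num
    rw [abs_le]; constructor <;> linarith
  · rw [dEig_succ, dEig_succ]
    push_cast
    rw [abs_of_nonneg (sub_nonneg.2 (by gcongr; linarith)),
      div_sub_div _ _ (by positivity) (by positivity), div_le_div_iff₀ (by positivity) (by positivity)]
    nlinarith [Nat.cast_nonneg (α := ℝ) n, sq_nonneg (n : ℝ)]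

theorem wt_mul_sq_le {s : ℝ} {n : ℕ} {z : ℂ} (hz : ‖z‖ ≤ 10 / (1 + (n : ℝ) ^ 2)) :
    wt (s + 1) n * ‖z‖ ^ 2 ≤ (100 * (1 / (1 + (n : ℝ) ^ 2))) * wt s n := by
  have hw := wt_pos s n
  have h1 : (0 : ℝ) < 1 + (n : ℝ) ^ 2 := by positivity
  have h2 : ‖z‖ ^ 2 ≤ (10 / (1 + (n : ℝ) ^ 2)) ^ 2 := by gcongr
  rw [wt_add, wt_one]
  calc wt s n * (1 + (n : ℝ) ^ 2) * ‖z‖ ^ 2 ≤ wt s n * (1 + (n : ℝ) ^ 2) *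
      (10 / (1 + (n : ℝ) ^ 2)) ^ 2 := by gcongr
    _ = _ := by field_simp; norm_num

/-- A diagonal operator with entries `O(n⁻²)` gains more than one order. -/
noncomputable def smoothDiag (s : ℝ) (m : ℕ → ℂ) (hm : ∀ n, ‖m n‖ ≤ 10 / (1 + (n : ℝ) ^ 2)) :
    ChebW s →L[ℂ] ChebW (s + 1) :=
  diag s (s + 1) m 10 (fun n => (wt_mul_sq_le (hm n)).trans (by
    refine mul_le_mul_of_nonneg_right ?_ (wt_pos s n).le
    have : 1 / (1 + (n : ℝ) ^ 2) ≤ 1 := by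
      rw [div_le_one (by positivity)]; nlinarith [sq_nonneg (n : ℝ)]
    linarith))

theorem coeff_smoothDiag {s : ℝ} {m : ℕ → ℂ} {hm : ∀ n, ‖m n‖ ≤ 10 / (1 + (n : ℝ) ^ 2)}
    (u : ChebW s) (n : ℕ) : (smoothDiag s m hm u).coeff n = m n * u.coeff n := rfl

theorem isCompactOperator_smoothDiag (s : ℝ) (m : ℕ → ℂ)
    (hm : ∀ n, ‖m n‖ ≤ 10 / (1 + (n : ℝ) ^ 2)) : IsCompactOperator (smoothDiag s m hm) := by
  refine isCompactOperator_diag ?_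
  have h0 := tendsto_one_div_wt_one.const_mul 100
  rw [mul_zero] at h0
  refine squeeze_zero (fun n => ?_) (fun n => ?_) h0
  · exact div_nonneg (mul_nonneg (wt_pos _ _).le (sq_nonneg _)) (wt_pos _ _).le
  · rw [div_le_iff₀ (wt_pos s n)]
    exact wt_mul_sq_le (hm n)

theorem norm_upEntry_le (n : ℕ) :
    ‖((if n = 0 then 1 else 1 / 2 : ℂ) * (dEig n - dEig (n + 1) : ℝ))‖ ≤
      10 / (1 + (n : ℝ) ^ 2) := by
  rw [norm_mul, Complex.norm_real, Real.norm_eq_abs]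
  have h1 : ‖(if n = 0 then 1 else 1 / 2 : ℂ)‖ ≤ 1 := by split_ifs <;> norm_num
  calc _ ≤ 1 * (2 / (1 + (n : ℝ) ^ 2)) := by gcongr; exact abs_dEig_sub_le n
    _ ≤ _ := by rw [one_mul]; gcongr; norm_num

theorem norm_downEntry_le (n : ℕ) :
    ‖(1 / 2 : ℂ) * (dEig n - dEig (n - 1) : ℝ)‖ ≤ 10 / (1 + (n : ℝ) ^ 2) := by
  rcases n with _ | n
  -- The truncated index `0 - 1 = 0` makes this entry zero. It is never read, since the shift down
  -- discards the coefficient of index `0`.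
  · simp
  · rw [norm_mul, Complex.norm_real, Real.norm_eq_abs, Nat.add_sub_cancel, abs_sub_comm]
    have h2 := abs_dEig_sub_le n
    -- The shift of index costs a bounded factor; half of the resulting `20` is the constant `10`
    -- demanded by `smoothDiag`.
    have h3 : 2 / (1 + (n : ℝ) ^ 2) ≤ 20 / (1 + ((n + 1 : ℕ) : ℝ) ^ 2) := by
      rw [div_le_div_iff₀ (by positivity) (by positivity)]
      push_cast
      nlinarith [sq_nonneg ((n : ℝ) - 1)]
    calc _ ≤ (1 / 2) * (20 / (1 + ((n + 1 : ℕ) : ℝ) ^ 2)) := by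
          gcongr
          · norm_num
          · exact h2.trans h3
      _ = _ := by ring

/-- Multiplication by the variable has entries only next to the diagonal, so its commutator with a
diagonal operator has entries there too, each multiplied by a difference of consecutive `d_n`. -/
theorem ad_logOp (s : ℝ) : ad s (s + 1) (logOp s) =
    (shiftUp (s + 1)).comp (smoothDiag s _ norm_upEntry_le) +
      (shiftDown (s + 1)).comp (smoothDiag s _ norm_downEntry_le) := by
  ext1 u
  refine ext_coeff fun n => ?_
  rw [ad_apply, coeff_sub_clm, coeff_add_clm]
  simp only [ContinuousLinearMap.comp_apply]
  rcases n with _ | n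
  · rw [coeff_mulX_zero, coeff_logOp, coeff_logOp, coeff_mulX_zero, coeff_shiftUp_zero,
      coeff_shiftDown, coeff_smoothDiag]
    push_cast
    simp only [zero_add]
    ring
  · rw [coeff_mulX_succ, coeff_logOp, coeff_logOp, coeff_logOp, coeff_mulX_succ,
      coeff_shiftUp_succ, coeff_shiftDown, coeff_smoothDiag, coeff_smoothDiag]
    push_cast
    ring

/-- The commutator of the logarithmic potential and the multiplication by the variable is of
lower order. -/
theorem isCompactOperator_ad_logOp (s : ℝ) : IsCompactOperator (ad s (s + 1) (logOp s)) := by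
  rw [ad_logOp]
  have h1 := (isCompactOperator_smoothDiag s _ norm_upEntry_le).clm_comp (shiftUp (s + 1))
  have h2 := (isCompactOperator_smoothDiag s _ norm_downEntry_le).clm_comp (shiftDown (s + 1))
  exact h1.add h2

/-- The diagonal operator `Tₙ ↦ eₙ Tₙ`. -/
noncomputable def hyperDiag (s : ℝ) : ChebW (s + 1) →L[ℂ] ChebW s :=
  diag (s + 1) s (fun n => (eEig n : ℂ)) 1 (by
    intro n
    rw [wt_add, wt_one, Complex.norm_real, Real.norm_eq_abs, sq_abs, one_pow, one_mul]
    refine mul_le_mul_of_nonneg_left ?_ (wt_pos s n).le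
    rw [eEig]
    nlinarith [sq_nonneg ((n : ℝ) - 1)])

/-- The tail sums `ε_j ∑_{n > j, n ≡ j (2)} uₙ`. -/
noncomputable def tailOp (s : ℝ) (hs : -1 / 2 < s) : ChebW (s + 1) →L[ℂ] ChebW s :=
  ofCoeff
    { toFun := fun u j => (if j = 0 then 1 / 2 else 1 : ℂ) * ∑' i : ℕ, u.coeff (j + 2 * (i + 1))
      map_add' := fun u v => by
        ext j
        rw [Pi.add_apply, ← mul_add,
          ← (summable_coeff_step hs u j).tsum_add (summable_coeff_step hs v j)]
        rfl
      map_smul' := fun a u => by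
        ext j
        change (if j = 0 then 1 / 2 else 1 : ℂ) * ∑' i : ℕ, a * u.coeff (j + 2 * (i + 1)) =
          a * ((if j = 0 then 1 / 2 else 1 : ℂ) * ∑' i : ℕ, u.coeff (j + 2 * (i + 1)))
        rw [tsum_mul_left, mul_left_comm] }
    (exists_hardy_bound hs).choose (fun u F => by
      refine le_trans (Finset.sum_le_sum fun n _ => ?_) ((exists_hardy_bound hs).choose_spec u F)
      refine mul_le_mul_of_nonneg_left ?_ (wt_pos s n).le
      change ‖(if n = 0 then 1 / 2 else 1 : ℂ) * ∑' i : ℕ, u.coeff (n + 2 * (i + 1))‖ ^ 2 ≤ _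
      rw [norm_mul, mul_pow]
      refine mul_le_of_le_one_left (sq_nonneg _) ?_
      split_ifs <;> norm_num)

/-- The principal part of the weighted hypersingular operator. -/
noncomputable def hyperOp (s : ℝ) (hs : -1 / 2 < s) : ChebW (s + 1) →L[ℂ] ChebW s :=
  hyperDiag s - tailOp s hs

theorem coeff_hyperOp {s : ℝ} (hs : -1 / 2 < s) (u : ChebW (s + 1)) (j : ℕ) :
    (hyperOp s hs u).coeff j = (eEig j : ℂ) * u.coeff j -
      (if j = 0 then 1 / 2 else 1 : ℂ) * ∑' i : ℕ, u.coeff (j + 2 * (i + 1)) := rfl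

theorem tsum_coeff_chebT (s : ℝ) (n j : ℕ) :
    ∑' i : ℕ, (chebT s n).coeff (j + 2 * (i + 1)) = if j < n ∧ j % 2 = n % 2 then 1 else 0 := by
  split_ifs with h
  -- The only index with `j + 2(i+1) = n` is `i = (n-j)/2 - 1`.
  · rw [tsum_eq_single ((n - j) / 2 - 1) fun i hi => coeff_chebT_of_ne _ (by omega), coeff_chebT,
      if_pos (by omega)]
  · rw [tsum_congr fun i => coeff_chebT_of_ne s (n := n) (m := j + 2 * (i + 1)) (by omega),
      tsum_zero]

theorem hyperOp_chebT {s : ℝ} (hs : -1 / 2 < s) (n : ℕ) :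
    hyperOp s hs (chebT (s + 1) n) = (eEig n : ℂ) • chebT s n -
      ∑ j ∈ (Finset.range n).filter (fun j => j % 2 = n % 2),
        (if j = 0 then 1 / 2 else 1 : ℂ) • chebT s j := by
  refine ext_coeff fun m => ?_
  rw [coeff_hyperOp, coeff_sub, coeff_sum, tsum_coeff_chebT]
  simp only [coeff_smul, coeff_chebT, mul_ite, mul_one, mul_zero, Finset.sum_ite_eq,
    Finset.mem_filter, Finset.mem_range]
  split_ifs with h1 h2 h3 <;> simp_all

theorem logOp_hyperOp_chebT {s : ℝ} (hs : -1 / 2 < s) (n : ℕ) :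
    (logOp s).comp (hyperOp s hs) (chebT (s + 1) n) =
      ((eEig n * dEig n : ℝ) : ℂ) • chebT (s + 1) n +
      ((eEig n - eEig (n - 2) : ℝ) : ℂ) •
        ∑ j ∈ (Finset.range n).filter (fun j => j % 2 = n % 2),
          (((if j = 0 then 1 / 2 else 1) * dEig j : ℝ) : ℂ) • chebT (s + 1) j := by
  rw [ContinuousLinearMap.comp_apply, hyperOp_chebT, map_sub, map_smul, logOp_chebT, smul_smul,
    map_sum, sub_eq_add_neg]
  congr 1
  · push_cast; rfl
  -- For `n = 0, 1` the sum is empty, so the truncated `n - 2` is harmless; for `n ≥ 2` one has `e_n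
  -- - e_{n-2} = -1`.
  rcases n with _ | _ | n
  · simp
  · rw [show (Finset.range (0 + 1)).filter (fun j => j % 2 = (0 + 1) % 2) = ∅ by decide]; simp
  · have h : eEig (n + 1 + 1) - eEig (n + 1 + 1 - 2) = -1 := by
      rw [show n + 1 + 1 - 2 = n from rfl, eEig, eEig]; push_cast; ring
    rw [h, Complex.ofReal_neg, Complex.ofReal_one, neg_one_smul]
    congr 1
    refine Finset.sum_congr rfl fun j _ => ?_
    rw [map_smul, logOp_chebT, smul_smul]
    split_ifs <;> simp

end ChebW

/-! ### The point spectrum of the principal part. -/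

theorem eEig_mul_dEig (n : ℕ) : eEig n * dEig n = discreteEig n := by
  rcases n with _ | n
  · simp [eEig, dEig, discreteEig]; ring
  · have : ((n + 1 : ℕ) : ℝ) ≠ 0 := by positivity
    rw [eEig, dEig, discreteEig, if_neg (Nat.succ_ne_zero n), if_neg (Nat.succ_ne_zero n)]
    field_simp
    ring

/-- The quotient of two Pochhammer products behaves like a power. -/
theorem tendsto_norm_prod_div_rpow {p q : ℂ} (hp : ∀ l : ℕ, p + l ≠ 0) (hq : ∀ l : ℕ, q + l ≠ 0) :
    ∃ K : ℝ, K ≠ 0 ∧ Tendsto (fun n : ℕ =>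
      ‖∏ l ∈ Finset.range (n + 1), (p + l) / (q + l)‖ / (n : ℝ) ^ (p - q).re) atTop (𝓝 K) := by
  -- The hypotheses say that `p` and `q` are not poles of the Gamma function.
  have hp' : Complex.Gamma p ≠ 0 := Complex.Gamma_ne_zero fun m h => hp m (by rw [h]; ring)
  have hq' : Complex.Gamma q ≠ 0 := Complex.Gamma_ne_zero fun m h => hq m (by rw [h]; ring)
  refine ⟨‖Complex.Gamma q / Complex.Gamma p‖, norm_ne_zero_iff.2 (div_ne_zero hq' hp'), ?_⟩
  -- Euler's product: `GammaSeq z n = n^z n! / ∏_{j ≤ n} (z + j)`. In the quotient of the sequences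
  -- for `q` and `p` the factorials cancel and `n^{q-p}` times the product remains.
  refine (((Complex.GammaSeq_tendsto_Gamma q).div (Complex.GammaSeq_tendsto_Gamma p) hp').norm).congr' ?_
  filter_upwards [eventually_gt_atTop 0] with n hn
  have hn' : (0 : ℝ) < n := by exact_mod_cast hn
  have h1 : ∀ z : ℂ, ‖(n : ℂ) ^ z‖ = (n : ℝ) ^ z.re := fun z => by
    rw [← Complex.ofReal_natCast, Complex.norm_cpow_eq_rpow_re_of_pos hn']
  have hP : ∏ j ∈ Finset.range (n + 1), (p + j) ≠ 0 := Finset.prod_ne_zero_iff.2 fun j _ => hp j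
  have hQ : ∏ j ∈ Finset.range (n + 1), (q + j) ≠ 0 := Finset.prod_ne_zero_iff.2 fun j _ => hq j
  have hf : (n.factorial : ℂ) ≠ 0 := by exact_mod_cast n.factorial_ne_zero
  have hnp : ‖∏ j ∈ Finset.range (n + 1), (p + j)‖ ≠ 0 := norm_ne_zero_iff.2 hP
  have hnq : ‖∏ j ∈ Finset.range (n + 1), (q + j)‖ ≠ 0 := norm_ne_zero_iff.2 hQ
  have hnf : ‖(n.factorial : ℂ)‖ ≠ 0 := norm_ne_zero_iff.2 hf
  have r1 := (Real.rpow_pos_of_pos hn' p.re).ne'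
  have r2 := (Real.rpow_pos_of_pos hn' q.re).ne'
  rw [Pi.div_apply, Complex.GammaSeq, Complex.GammaSeq, Finset.prod_div_distrib, Complex.sub_re,
    Real.rpow_sub hn']
  simp only [norm_div, norm_mul, h1]
  field_simp

/-- The index `n + 1` on the left matches the `n + 1` factors in `tendsto_norm_prod_div_rpow`. -/
theorem tendsto_wt_div_rpow (r : ℝ) (m : ℕ) :
    Tendsto (fun n : ℕ => ChebW.wt r (m + 2 * (n + 1)) / (n : ℝ) ^ (2 * r)) atTop (𝓝 (4 ^ r)) := by
  have h0 : Tendsto (fun n : ℕ => ((m : ℝ) + 2) / n) atTop (𝓝 0) :=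
    tendsto_const_div_atTop_nhds_zero_nat _
  have h2 : Tendsto (fun n : ℕ => 1 / (n : ℝ)) atTop (𝓝 0) :=
    tendsto_const_div_atTop_nhds_zero_nat _
  have h1 : Tendsto (fun n : ℕ => ((1 / (n : ℝ)) ^ 2 + (2 + ((m : ℝ) + 2) / n) ^ 2) ^ r) atTop
      (𝓝 (((0 : ℝ) ^ 2 + (2 + 0) ^ 2) ^ r)) :=
    ((h2.pow 2).add ((h0.const_add 2).pow 2)).rpow_const (Or.inl (by norm_num))
  rw [show (0 : ℝ) ^ 2 + (2 + 0) ^ 2 = 4 by norm_num] at h1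
  refine h1.congr' ?_
  filter_upwards [eventually_gt_atTop 0] with n hn
  have hn' : (0 : ℝ) < n := by exact_mod_cast hn
  rw [ChebW.wt, Real.rpow_mul hn'.le, ← Real.div_rpow (by positivity) (by positivity)]
  congr 1
  rw [Real.rpow_two]
  push_cast
  field_simp
  ring

/-- After a shift of the index by one the terms are comparable, from both sides, to `n^{2r + 2
Re(p-q)}`. -/
theorem summable_wt_mul_norm_prod_sq_iff {p q : ℂ} (hp : ∀ l : ℕ, p + l ≠ 0)
    (hq : ∀ l : ℕ, q + l ≠ 0) (r : ℝ) (m : ℕ) :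
    Summable (fun i : ℕ => ChebW.wt r (m + 2 * i) * ‖∏ l ∈ Finset.range i, (p + l) / (q + l)‖ ^ 2) ↔
      2 * r + 2 * (p - q).re < -1 := by
  obtain ⟨K, hK, hlim⟩ := tendsto_norm_prod_div_rpow hp hq
  rw [← Real.summable_nat_rpow, ← summable_nat_add_iff 1]
  refine Asymptotics.IsTheta.summable_iff_nat ?_
  have h := (tendsto_wt_div_rpow r m).mul (hlim.pow 2)
  refine (Asymptotics.isTheta_of_div_tendsto_nhds_ne_zero (h.congr' ?_)
    (mul_ne_zero (by positivity) (pow_ne_zero 2 hK))).symm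
  filter_upwards [eventually_gt_atTop 0] with n hn
  have hn' : (0 : ℝ) < n := by exact_mod_cast hn
  rw [Real.rpow_add hn', show 2 * (p - q).re = (p - q).re * 2 by ring, Real.rpow_mul hn'.le (p - q).re,
    Real.rpow_two]
  rw [div_pow, div_mul_div_comm]

/-- With `z + 1/4 = r e^{iθ}` one has `Re (1 / (4 (z + 1/4))) = cos θ / (4r)`: inversion maps the
disc onto a half plane. -/
theorem mem_complementarySpectrum_iff {s : ℝ} (hs : -1 / 2 < s) (z : ℂ) :
    z ∈ complementarySpectrum s ↔
      z + 1 / 4 ≠ 0 ∧ (1 / (4 * (z + 1 / 4))).re < -(s + 1 / 2) := by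
  constructor
  · rintro ⟨r, θ, h1, h2, hr, hr2, hre, him⟩
    have hn : Real.cos θ ^ 2 + Real.sin θ ^ 2 = 1 := Real.cos_sq_add_sin_sq θ
    generalize Real.cos θ = C at *
    generalize Real.sin θ = S at *
    have hz : z + 1 / 4 = (r : ℂ) * (C + S * Complex.I) := by
      apply Complex.ext
      · simp [← hre]
      · simp [him]
    have hmul : (z + 1 / 4) * (C - S * Complex.I) = r := by
      rw [hz]
      have : (C : ℂ) ^ 2 + (S : ℂ) ^ 2 = 1 := by exact_mod_cast hn
      linear_combination (r : ℂ) * this - r * (S : ℂ) ^ 2 * Complex.I_sq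
    have hrc : (r : ℂ) ≠ 0 := by exact_mod_cast hr.ne'
    have hne : z + 1 / 4 ≠ 0 := fun h => by rw [h, zero_mul] at hmul; exact hrc hmul.symm
    refine ⟨hne, ?_⟩
    have hinv : 1 / (4 * (z + 1 / 4)) = ((1 / (4 * r) : ℝ) : ℂ) * (C - S * Complex.I) := by
      rw [div_eq_iff (mul_ne_zero (by norm_num) hne)]
      push_cast
      rw [div_mul_eq_mul_div, one_mul, div_mul_eq_mul_div, eq_div_iff (mul_ne_zero (by norm_num) hrc)]
      linear_combination -4 * hmul
    rw [hinv, Complex.re_ofReal_mul]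
    have : ((C : ℂ) - S * Complex.I).re = C := by simp
    rw [this]
    rw [lt_div_iff₀ (by linarith)] at hr2
    rw [one_div_mul_eq_div, div_lt_iff₀ (by linarith)]
    linarith
  · rintro ⟨hne, hre⟩
    set μ : ℂ := z + 1 / 4 with hμ
    have hnorm : 0 < ‖μ‖ := norm_pos_iff.2 hne
    have hq : (1 / (4 * μ)).re = μ.re / (4 * ‖μ‖ ^ 2) := by
      rw [one_div, Complex.inv_re, Complex.normSq_eq_norm_sq, norm_mul]
      norm_num
      field_simp
    rw [hq, div_lt_iff₀ (by positivity)] at hre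
    have hneg : μ.re < 0 := by
      have := mul_pos (show 0 < s + 1 / 2 by linarith) (show 0 < 4 * ‖μ‖ ^ 2 by positivity)
      linarith
    have harg : |Complex.arg (-μ)| < π / 2 :=
      Complex.abs_arg_lt_pi_div_two_iff.2 (Or.inl (by simpa using hneg))
    have hc := Complex.norm_mul_cos_arg (-μ)
    have hsn := Complex.norm_mul_sin_arg (-μ)
    rw [norm_neg] at hc hsn
    simp only [Complex.neg_re, Complex.neg_im] at hc hsn
    rw [abs_lt] at harg
    have h4 : 0 < 4 * s + 2 := by linarith
    -- Since `Re μ < 0`, the argument of `-μ` lies in `(-π/2, π/2)`, and adding `π` puts the angle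
    -- in the required interval.
    refine ⟨‖μ‖, Complex.arg (-μ) + π, by linarith [harg.1], by linarith [harg.2], hnorm, ?_, ?_, ?_⟩
    · rw [Real.cos_add_pi, neg_neg, lt_div_iff₀ h4]
      have : ‖μ‖ * (‖μ‖ * (4 * s + 2)) < ‖μ‖ * Real.cos (Complex.arg (-μ)) := by
        rw [hc]; nlinarith
      exact lt_of_mul_lt_mul_left this hnorm.le
    · rw [Real.cos_add_pi, mul_neg, hc, neg_neg, hμ]; simp
    · rw [Real.sin_add_pi, mul_neg, hsn, neg_neg, hμ]; simp

theorem mem_pointSpectrum_iff {s : ℝ} (A : ChebW s →L[ℂ] ChebW s) (z : ℂ) :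
    z ∈ pointSpectrum A ↔ ∃ u : ChebW s, u ≠ 0 ∧ A u = z • u := by
  constructor
  · intro h
    obtain ⟨v, hv⟩ := Module.End.HasEigenvalue.exists_hasEigenvector h
    exact ⟨v, hv.2, hv.apply_eq_smul⟩
  · rintro ⟨u, hu, h⟩
    exact Module.End.hasEigenvalue_of_hasEigenvector
      (x := u) ⟨Module.End.mem_eigenspace_iff.2 h, hu⟩

theorem discreteEig_succ (n : ℕ) : discreteEig (n + 1) = -1 / 4 - 1 / (4 * ((n : ℝ) + 1)) := by
  simp [discreteEig]

namespace ChebW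

/-- The map `logOp` is a bijection which intertwines the two products, so it carries eigenvectors to
eigenvectors in both directions. -/
theorem pointSpectrum_comp_comm {s : ℝ} (B : ChebW (s + 1) →L[ℂ] ChebW s) :
    pointSpectrum ((logOp s).comp B) = pointSpectrum (B.comp (logOp s)) := by
  ext z
  rw [mem_pointSpectrum_iff, mem_pointSpectrum_iff]
  constructor
  · rintro ⟨u, hu, h⟩
    refine ⟨logInv s u, fun h0 => hu ?_, logOp_injective s ?_⟩
    · rw [← logOp_logInv u, h0, map_zero]
    · rw [ContinuousLinearMap.comp_apply, logOp_logInv, map_smul, logOp_logInv]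
      exact h
  · rintro ⟨u, hu, h⟩
    refine ⟨logOp s u, fun h0 => hu (logOp_injective s (by rw [h0, map_zero])), ?_⟩
    rw [ContinuousLinearMap.comp_apply, ← map_smul, ← h]
    rfl

/-- The eigenvalue equation in terms of coefficients. -/
theorem hyperOp_logOp_eq_smul_iff {s : ℝ} (hs : -1 / 2 < s) (u : ChebW s) (z : ℂ) :
    (hyperOp s hs).comp (logOp s) u = z • u ↔
      ∀ j, ((discreteEig j : ℂ) - z) * u.coeff j = (if j = 0 then 1 / 2 else 1 : ℂ) *
        ∑' i : ℕ, (logOp s u).coeff (j + 2 * (i + 1)) := by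
  have h : ∀ j, ((hyperOp s hs).comp (logOp s) u).coeff j = (discreteEig j : ℂ) * u.coeff j -
      (if j = 0 then 1 / 2 else 1 : ℂ) * ∑' i : ℕ, (logOp s u).coeff (j + 2 * (i + 1)) := fun j => by
    rw [ContinuousLinearMap.comp_apply, coeff_hyperOp, coeff_logOp u j, ← mul_assoc,
      ← eEig_mul_dEig, Complex.ofReal_mul]
  constructor
  · intro heq j
    have := h j
    rw [heq, coeff_smul] at this
    linear_combination -this
  · intro heq
    refine ext_coeff fun j => ?_
    rw [h, coeff_smul]
    linear_combination heq j

theorem tsum_step_eq {s : ℝ} (hs : -1 / 2 < s) (u : ChebW (s + 1)) (j : ℕ) :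
    ∑' i : ℕ, u.coeff (j + 2 * (i + 1)) =
      u.coeff (j + 2) + ∑' i : ℕ, u.coeff (j + 2 + 2 * (i + 1)) := by
  rw [(summable_coeff_step hs u j).tsum_eq_zero_add]
  congr 1
  refine tsum_congr fun i => ?_
  congr 1
  ring

/-- By triangularity the span of `T_0, …, T_n` is invariant, and the last row of the section of the
operator minus `λ_n` vanishes. The section is therefore singular. -/
theorem discreteEig_mem_pointSpectrum {s : ℝ} (hs : -1 / 2 < s) (n : ℕ) :
    (discreteEig n : ℂ) ∈ pointSpectrum ((hyperOp s hs).comp (logOp s)) := by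
  set J := (hyperOp s hs).comp (logOp s) with hJ
  -- the finite section, with values in the coefficients below `n`
  let v : (Fin (n + 1) → ℂ) →ₗ[ℂ] ChebW s :=
    { toFun := fun x => ∑ i, x i • chebT s i
      map_add' := fun x y => by simp [add_smul, Finset.sum_add_distrib]
      map_smul' := fun c x => by simp [Finset.smul_sum, smul_smul] }
  have hv : ∀ x m, (v x).coeff m = if h : m < n + 1 then x ⟨m, h⟩ else 0 := by
    intro x m
    change (∑ i, x i • chebT s i).coeff m = _
    rw [coeff_sum]
    simp only [coeff_smul, coeff_chebT]
    split_ifs with h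
    · rw [Finset.sum_eq_single ⟨m, h⟩] <;> simp +contextual [Fin.ext_iff, eq_comm]
    · refine Finset.sum_eq_zero fun i _ => ?_
      rw [if_neg (by have := i.2; omega), mul_zero]
  let f : (Fin (n + 1) → ℂ) →ₗ[ℂ] (Fin n → ℂ) :=
    { toFun := fun x j => (J (v x) - (discreteEig n : ℂ) • v x).coeff j
      map_add' := fun x y => by
        ext j
        simp only [map_add, smul_add, Pi.add_apply, coeff_sub, coeff_add]
        ring
      map_smul' := fun c x => by
        ext j
        simp only [map_smul, Pi.smul_apply, coeff_sub, coeff_smul, smul_eq_mul, RingHom.id_apply]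
        ring }
  -- There are `n` equations, of indices below `n`, for `n + 1` unknowns. The equation of index `n`
  -- holds because the diagonal entry is `λ_n`, and those above are trivial.
  have hker := LinearMap.ker_ne_bot_of_finrank_lt (f := f) (by simp)
  obtain ⟨x, hx, hx0⟩ := (Submodule.ne_bot_iff _).1 hker
  rw [mem_pointSpectrum_iff]
  refine ⟨v x, fun h0 => hx0 (funext fun i => ?_), ?_⟩
  · have := hv x i
    rw [h0, dif_pos i.2] at this
    simpa using this.symm
  · refine ext_coeff fun m => ?_
    rcases lt_or_ge m n with h | h
    · have := congrFun (LinearMap.mem_ker.1 hx) ⟨m, h⟩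
      change (J (v x) - (discreteEig n : ℂ) • v x).coeff m = 0 at this
      rw [coeff_sub] at this
      exact sub_eq_zero.1 this
    · rw [hJ, ContinuousLinearMap.comp_apply, coeff_hyperOp, coeff_logOp, coeff_smul, ← mul_assoc,
        ← Complex.ofReal_mul, eEig_mul_dEig]
      have h1 : ∀ i : ℕ, (logOp s (v x)).coeff (m + 2 * (i + 1)) = 0 := fun i => by
        rw [coeff_logOp, hv, dif_neg (by omega), mul_zero]
      rw [tsum_congr h1, tsum_zero, mul_zero, sub_zero]
      rcases h.eq_or_lt with rfl | h
      · rfl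
      · rw [hv, dif_neg (by omega), mul_zero, mul_zero]

/-- The part of the point spectrum off the diagonal. -/
theorem mem_complementarySpectrum_of_mem_pointSpectrum {s : ℝ} (hs : -1 / 2 < s) {z : ℂ}
    (hz : z ∈ pointSpectrum ((hyperOp s hs).comp (logOp s)))
    (hne : ∀ n, z ≠ (discreteEig n : ℂ)) : z ∈ complementarySpectrum s := by
  rw [mem_pointSpectrum_iff] at hz
  obtain ⟨u, hu, heq⟩ := hz
  rw [hyperOp_logOp_eq_smul_iff] at heq
  have hd : ∀ n, ((discreteEig n : ℂ) - z) ≠ 0 := fun n h => hne n (sub_eq_zero.1 h).symm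
  set b : ℕ → ℂ := fun n => (logOp s u).coeff n with hb
  have hbu : ∀ n, b n = (dEig n : ℂ) * u.coeff n := fun n => coeff_logOp u n
  have hb0 : ∀ n, b n ≠ 0 ↔ u.coeff n ≠ 0 := fun n => by
    rw [hbu, mul_ne_zero_iff]
    have : (dEig n : ℂ) ≠ 0 := by exact_mod_cast (dEig_pos n).ne'
    simp [this]
  set μ : ℂ := z + 1 / 4 with hμ
  -- the two term recurrence
  have hrec : ∀ j : ℕ, 1 ≤ j → (-(2 * (j : ℂ) * μ) - 1 / 2) * b j =
      (1 / 2 - 2 * ((j : ℂ) + 2) * μ) * b (j + 2) := by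
    intro j hj
    have e1 := heq j
    have e2 := heq (j + 2)
    rw [if_neg (by omega), one_mul] at e1 e2
    rw [tsum_step_eq hs] at e1
    obtain ⟨j, rfl⟩ : ∃ i, j = i + 1 := ⟨j - 1, by omega⟩
    have f1 : u.coeff (j + 1) = 2 * ((j : ℂ) + 1) * b (j + 1) := by
      rw [hbu, dEig_succ]
      have : (j : ℂ) + 1 ≠ 0 := by exact_mod_cast Nat.succ_ne_zero j
      push_cast
      field_simp
    have f2 : u.coeff (j + 1 + 2) = 2 * ((j : ℂ) + 3) * b (j + 1 + 2) := by
      rw [hbu, show j + 1 + 2 = j + 2 + 1 by ring, dEig_succ]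
      have : (j : ℂ) + 2 + 1 ≠ 0 := by exact_mod_cast Nat.succ_ne_zero (j + 2)
      push_cast
      field_simp
      ring
    -- The tail beyond `j + 2` is eliminated between the equations at `j` and at `j + 2`. The
    -- restriction `j ≥ 1` avoids the exceptional factor `1/2` and the exceptional `d_0`.
    rw [← e2, f1] at e1
    rw [f2] at e1
    change _ = b (j + 1 + 2) + _ at e1
    rw [show j + 1 + 2 = j + 2 + 1 by ring, discreteEig_succ] at e1
    rw [discreteEig_succ, show j + 2 + 1 = j + 1 + 2 by ring] at e1
    have g1 : (j : ℂ) + 1 ≠ 0 := by exact_mod_cast Nat.succ_ne_zero j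
    have g2 : (j : ℂ) + 2 + 1 ≠ 0 := by exact_mod_cast Nat.succ_ne_zero (j + 2)
    have g3 : (1 / (4 * ((j : ℂ) + 1))) * (2 * ((j : ℂ) + 1)) = 1 / 2 := by field_simp; norm_num
    have g4 : (1 / (4 * ((j : ℂ) + 2 + 1))) * (2 * ((j : ℂ) + 3)) = 1 / 2 := by
      rw [show (j : ℂ) + 3 = (j : ℂ) + 2 + 1 by ring]; field_simp; norm_num
    push_cast at e1 ⊢
    linear_combination e1 + b (j + 1) * g3 - b (j + 1 + 2) * g4
  have hstep : ∀ j : ℕ, 1 ≤ j → b j ≠ 0 →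
      b (j + 2) ≠ 0 ∧ (2 * (j : ℂ) * μ + 1 / 2) ≠ 0 ∧ (1 / 2 - 2 * ((j : ℂ) + 2) * μ) ≠ 0 := by
    intro j hj hbj
    have h1 : (2 * (j : ℂ) * μ + 1 / 2) ≠ 0 := by
      obtain ⟨i, rfl⟩ : ∃ i, j = i + 1 := ⟨j - 1, by omega⟩
      intro h
      refine hd (i + 1) ?_
      rw [discreteEig_succ]
      have g1 : (i : ℂ) + 1 ≠ 0 := by exact_mod_cast Nat.succ_ne_zero i
      push_cast at h ⊢
      have : z = -1 / 4 - 1 / (4 * ((i : ℂ) + 1)) := by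
        rw [hμ] at h
        field_simp
        linear_combination 2 * h
      rw [this]; ring
    have h2 : (1 / 2 - 2 * ((j : ℂ) + 2) * μ) * b (j + 2) ≠ 0 := by
      rw [← hrec j hj]
      refine mul_ne_zero (fun h => h1 ?_) hbj
      linear_combination -h
    exact ⟨right_ne_zero_of_mul h2, h1, left_ne_zero_of_mul h2⟩
  -- If all `b_n` with `n ≥ 1` vanished, the equation of index `0` would force `u_0 = 0` as well,
  -- because `z ≠ λ_0`.
  obtain ⟨m, hm1, hm⟩ : ∃ m, 1 ≤ m ∧ b m ≠ 0 := by
    by_contra! hcon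
    refine hu (ext_coeff fun n => ?_)
    have hpos : ∀ n, 1 ≤ n → u.coeff n = 0 := fun n hn => by
      by_contra h
      exact (hb0 n).2 h (hcon n hn)
    rcases n with _ | n
    · have e := heq 0
      rw [tsum_congr (fun i : ℕ => (hcon (0 + 2 * (i + 1)) (by omega) :
        (logOp s u).coeff (0 + 2 * (i + 1)) = 0)), tsum_zero, mul_zero] at e
      exact (mul_eq_zero.1 e).resolve_left (hd 0)
    · exact hpos _ (by omega)
  have hall : ∀ i : ℕ, b (m + 2 * i) ≠ 0 := by
    intro i
    induction i with
    | zero => exact hm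
    | succ i ih => exact (hstep (m + 2 * i) (by omega) ih).1
  have hbs : Summable fun i : ℕ => ‖b (m + 2 * (i + 1))‖ :=
    (summable_norm_coeff hs (logOp s u)).comp_injective (injective_add_two_mul m)
  -- At `μ = 0` the recurrence reads `b_{j+2} = -b_j`; a nonzero sequence of constant modulus is not
  -- summable.
  have hμ0 : μ ≠ 0 := by
    intro h0
    have hconst : ∀ i, ‖b (m + 2 * i)‖ = ‖b m‖ := by
      intro i
      induction i with
      | zero => rfl
      | succ i ih =>
        have := hrec (m + 2 * i) (by omega)
        rw [h0, show m + 2 * i + 2 = m + 2 * (i + 1) by ring] at this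
        have h3 : b (m + 2 * (i + 1)) = - b (m + 2 * i) := by linear_combination -2 * this
        rw [h3, norm_neg, ih]
    have hlim := hbs.tendsto_atTop_zero
    simp only [hconst] at hlim
    exact norm_ne_zero_iff.2 hm (tendsto_nhds_unique tendsto_const_nhds hlim)
  -- Dividing the recurrence by `2μ` gives `b_{j+2} / b_j = (j + c) / (j + 2 - c)`; with `j = m +
  -- 2l` this is a quotient of Pochhammer factors.
  set c : ℂ := 1 / (4 * μ) with hc
  have hcμ : c * μ = 1 / 4 := by rw [hc]; field_simp
  have hp : ∀ l : ℕ, ((m : ℂ) + c) / 2 + l ≠ 0 := by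
    intro l h
    refine (hstep (m + 2 * l) (by omega) (hall l)).2.1 ?_
    push_cast
    linear_combination 4 * μ * h - 2 * hcμ
  have hq : ∀ l : ℕ, ((m : ℂ) + 2 - c) / 2 + l ≠ 0 := by
    intro l h
    refine (hstep (m + 2 * l) (by omega) (hall l)).2.2 ?_
    push_cast
    linear_combination -4 * μ * h - 2 * hcμ
  have hprod : ∀ i : ℕ, b (m + 2 * i) =
      b m * ∏ l ∈ Finset.range i, (((m : ℂ) + c) / 2 + l) / (((m : ℂ) + 2 - c) / 2 + l) := by
    intro i
    induction i with
    | zero => simp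
    | succ i ih =>
      rw [Finset.prod_range_succ, ← mul_assoc, ← ih, mul_div_assoc', eq_div_iff (hq i)]
      have := hrec (m + 2 * i) (by omega)
      rw [show m + 2 * i + 2 = m + 2 * (i + 1) by ring] at this
      push_cast at this
      refine mul_left_cancel₀ hμ0 ?_
      linear_combination (1 / 4) * this - (b (m + 2 * (i + 1)) + b (m + 2 * i)) / 2 * hcμ
  have hsum : Summable fun i : ℕ => wt (s + 1) (m + 2 * i) *
      ‖∏ l ∈ Finset.range i, (((m : ℂ) + c) / 2 + l) / (((m : ℂ) + 2 - c) / 2 + l)‖ ^ 2 := by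
    have h1 := ((logOp s u).summable_coeff.comp_injective
      (i := fun i : ℕ => m + 2 * i) (fun a b h => by simpa using h)).mul_left ((‖b m‖ ^ 2)⁻¹)
    refine h1.congr fun i => ?_
    change _ * (wt (s + 1) (m + 2 * i) * ‖b (m + 2 * i)‖ ^ 2) = _
    have h2 : ‖b m‖ ≠ 0 := norm_ne_zero_iff.2 hm
    rw [hprod, norm_mul]
    field_simp
  -- The criterion reads `2(s+1) + 2(Re c - 1) < -1`, that is `Re c < -(s + 1/2)`.
  rw [summable_wt_mul_norm_prod_sq_iff hp hq] at hsum
  rw [mem_complementarySpectrum_iff hs]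
  refine ⟨hμ0, ?_⟩
  have h4 : (((m : ℂ) + c) / 2 - ((m : ℂ) + 2 - c) / 2).re = c.re - 1 := by
    rw [show ((m : ℂ) + c) / 2 - ((m : ℂ) + 2 - c) / 2 = c - 1 by ring]; simp
  rw [h4] at hsum
  linarith

/-- The recurrence is solved on the odd indices, starting from `b_1 = 1`, which keeps clear of the
exceptional index `0`. The half plane condition puts the solution in `W^{s+1}`; a telescoping sum
then recovers the full eigenvalue equations from the recurrence. -/
theorem mem_pointSpectrum_of_mem_complementarySpectrum {s : ℝ} (hs : -1 / 2 < s) {z : ℂ}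
    (hz : z ∈ complementarySpectrum s) (hne : ∀ n, z ≠ (discreteEig n : ℂ)) :
    z ∈ pointSpectrum ((hyperOp s hs).comp (logOp s)) := by
  rw [mem_complementarySpectrum_iff hs] at hz
  obtain ⟨hμ0, hre⟩ := hz
  set μ : ℂ := z + 1 / 4 with hμ
  set c : ℂ := 1 / (4 * μ) with hc
  have hcμ : c * μ = 1 / 4 := by rw [hc]; field_simp
  have hp : ∀ l : ℕ, (1 + c) / 2 + l ≠ 0 := by
    intro l h
    refine hne (2 * l + 1) ?_
    rw [discreteEig_succ]
    have h1 : (2 * (l : ℂ) + 1) ≠ 0 := by exact_mod_cast Nat.succ_ne_zero (2 * l)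
    push_cast
    have h2 : (2 * (l : ℂ) + 1) * μ = -1 / 4 := by linear_combination 2 * μ * h - hcμ
    have h3 : μ = -(1 / (4 * (2 * (l : ℂ) + 1))) := by
      field_simp
      linear_combination 4 * h2
    linear_combination h3 - hμ
  -- A zero of the denominator would mean `c = 3 + 2l`, whereas `Re c` is negative.
  have hq : ∀ l : ℕ, (3 - c) / 2 + l ≠ 0 := by
    intro l h
    have h1 : c = 3 + 2 * l := by linear_combination -2 * h
    rw [h1] at hre
    have h2 : ((3 : ℂ) + 2 * l).re = 3 + 2 * l := by simp
    rw [h2] at hre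
    linarith [Nat.cast_nonneg (α := ℝ) l]
  have hpq : ((1 + c) / 2 - (3 - c) / 2).re = c.re - 1 := by
    rw [show (1 + c) / 2 - (3 - c) / 2 = c - 1 by ring]; simp
  set Q : ℕ → ℂ := fun i => ∏ l ∈ Finset.range i, ((1 + c) / 2 + l) / ((3 - c) / 2 + l) with hQ
  have hQs : ∀ i : ℕ, (2 * (2 * (i : ℂ) + 3) * μ - 1 / 2) * Q (i + 1) =
      (2 * (2 * (i : ℂ) + 1) * μ + 1 / 2) * Q i := by
    intro i
    have h1 : Q (i + 1) * ((3 - c) / 2 + i) = Q i * ((1 + c) / 2 + i) := by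
      rw [hQ]
      simp only [Finset.prod_range_succ]
      rw [mul_assoc, div_mul_cancel₀ _ (hq i)]
    linear_combination 4 * μ * h1 + 2 * (Q (i + 1) + Q i) * hcμ
  -- The sequence `Q_i` is of size `i^{Re c - 1}` and the factor grows linearly, so the product is
  -- of size `i^{Re c}` with `Re c < 0`.
  have hQlim : Tendsto (fun i : ℕ => (2 * (2 * (i : ℂ) + 1) * μ + 1 / 2) * Q i) atTop (𝓝 0) := by
    rw [← tendsto_add_atTop_iff_nat 1]
    obtain ⟨K, -, hK⟩ := tendsto_norm_prod_div_rpow hp hq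
    rw [hpq] at hK
    have hpow : Tendsto (fun n : ℕ => (n : ℝ) ^ c.re) atTop (𝓝 0) := by
      have := (tendsto_rpow_neg_atTop (y := -c.re) (by linarith)).comp
        (tendsto_natCast_atTop_atTop (R := ℝ))
      simpa [Function.comp_def] using this
    have hlin : Tendsto (fun n : ℕ => ‖4 * μ + (6 * μ + 1 / 2) / (n : ℂ)‖) atTop
        (𝓝 ‖4 * μ + 0‖) :=
      ((tendsto_const_div_atTop_nhds_zero_nat _).const_add _).norm
    rw [tendsto_zero_iff_norm_tendsto_zero]
    have := (hlin.mul hK).mul hpow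
    rw [mul_zero] at this
    refine this.congr' ?_
    filter_upwards [eventually_gt_atTop 0] with n hn
    have hn' : (0 : ℝ) < n := by exact_mod_cast hn
    have hnc : (n : ℂ) ≠ 0 := by exact_mod_cast hn'.ne'
    have e1 : (2 * (2 * ((n + 1 : ℕ) : ℂ) + 1) * μ + 1 / 2) =
        (4 * μ + (6 * μ + 1 / 2) / (n : ℂ)) * n := by
      push_cast; field_simp; ring
    have r1 := (Real.rpow_pos_of_pos hn' c.re).ne'
    rw [e1, norm_mul, norm_mul, Complex.norm_natCast, Real.rpow_sub_one hn'.ne', hQ]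
    field_simp
  -- the sequence supported on odd indices
  set b : ℕ → ℂ := fun n => if n % 2 = 1 then Q (n / 2) else 0 with hb
  have hbo : ∀ i : ℕ, b (1 + 2 * i) = Q i := fun i => by
    rw [hb]
    simp only
    rw [if_pos (by omega), show (1 + 2 * i) / 2 = i by omega]
  have hbe : ∀ n : ℕ, n % 2 = 0 → b n = 0 := fun n h => by
    rw [hb]; simp only; rw [if_neg (by omega)]
  have hbs : Summable fun n => wt (s + 1) n * ‖b n‖ ^ 2 := by
    have hinj : Function.Injective fun i : ℕ => 1 + 2 * i := fun a b h => by simpa using h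
    rw [← hinj.summable_iff]
    · have := (summable_wt_mul_norm_prod_sq_iff hp hq (s + 1) 1).2 (by rw [hpq]; linarith)
      refine this.congr fun i => ?_
      simp only [Function.comp_apply, hbo, hQ]
    · intro n hn
      have : n % 2 = 0 := by
        by_contra h
        exact hn ⟨n / 2, by simp only; omega⟩
      rw [hbe n this]; simp
  set B : ChebW (s + 1) := mk b hbs with hB
  rw [mem_pointSpectrum_iff]
  refine ⟨logInv s B, fun h0 => ?_, ?_⟩
  · have h1 : B.coeff 1 = 0 := by rw [← logOp_logInv B, h0, map_zero, coeff_zero]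
    rw [hB, coeff_mk, show 1 = 1 + 2 * 0 from rfl, hbo] at h1
    simp [hQ] at h1
  · rw [hyperOp_logOp_eq_smul_iff, logOp_logInv]
    intro j
    rw [coeff_logInv, hB]
    simp only [coeff_mk]
    rcases Nat.mod_two_eq_zero_or_one j with h | h
    · rw [hbe j h, tsum_congr fun i : ℕ => hbe (j + 2 * (i + 1)) (by omega), tsum_zero]
      simp
    · obtain ⟨p, rfl⟩ : ∃ p, j = 1 + 2 * p := ⟨j / 2, by omega⟩
      rw [if_neg (by omega), one_mul, hbo]
      have hsum := (summable_coeff_step hs B (1 + 2 * p)).hasSum.tendsto_sum_nat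
      have hterm : ∀ i : ℕ, B.coeff (1 + 2 * p + 2 * (i + 1)) = Q (p + (i + 1)) := fun i => by
        rw [hB, coeff_mk, show 1 + 2 * p + 2 * (i + 1) = 1 + 2 * (p + (i + 1)) by ring, hbo]
      -- With `g_i = (2(2i+1)μ + 1/2) Q_i` the recurrence says `g_{i+1} - g_i = Q_{i+1}`. As `g`
      -- tends to zero, the tail beyond `p` sums to `-g_p`.
      have htel : ∀ N : ℕ, ∑ i ∈ Finset.range N, B.coeff (1 + 2 * p + 2 * (i + 1)) =
          (2 * (2 * ((p + N : ℕ) : ℂ) + 1) * μ + 1 / 2) * Q (p + N) -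
            (2 * (2 * (p : ℂ) + 1) * μ + 1 / 2) * Q p := by
        intro N
        induction N with
        | zero => simp
        | succ N ih =>
          rw [Finset.sum_range_succ, ih, hterm, ← add_assoc]
          have := hQs (p + N)
          push_cast at this ⊢
          linear_combination -this
      simp only [htel] at hsum
      have hlim : Tendsto (fun N : ℕ => (2 * (2 * ((p + N : ℕ) : ℂ) + 1) * μ + 1 / 2) * Q (p + N) -
            (2 * (2 * (p : ℂ) + 1) * μ + 1 / 2) * Q p) atTop
            (𝓝 (0 - (2 * (2 * (p : ℂ) + 1) * μ + 1 / 2) * Q p)) := by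
        refine Tendsto.sub_const ?_ _
        have := (tendsto_add_atTop_iff_nat p).2 hQlim
        simpa only [add_comm _ p] using this
      have heq := tendsto_nhds_unique hsum hlim
      have heq' : ∑' i : ℕ, b (1 + 2 * p + 2 * (i + 1)) =
          0 - (2 * (2 * (p : ℂ) + 1) * μ + 1 / 2) * Q p := heq
      rw [heq', show 1 + 2 * p = 2 * p + 1 by ring, discreteEig_succ, dEig_succ]
      have g1 : 2 * (p : ℂ) + 1 ≠ 0 := by exact_mod_cast Nat.succ_ne_zero (2 * p)
      push_cast
      rw [hμ]
      field_simp
      ring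

theorem pointSpectrum_hyperOp_logOp {s : ℝ} (hs : -1 / 2 < s) :
    pointSpectrum ((hyperOp s hs).comp (logOp s)) =
      Set.range (fun n : ℕ => (discreteEig n : ℂ)) ∪ complementarySpectrum s := by
  ext z
  by_cases h : ∃ n, (discreteEig n : ℂ) = z
  · refine ⟨fun _ => Or.inl h, fun _ => ?_⟩
    obtain ⟨n, rfl⟩ := h
    exact discreteEig_mem_pointSpectrum hs n
  · have hne : ∀ n, z ≠ (discreteEig n : ℂ) := fun n hn => h ⟨n, hn.symm⟩
    exact ⟨fun hz => Or.inr (mem_complementarySpectrum_of_mem_pointSpectrum hs hz hne),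
      fun hz => mem_pointSpectrum_of_mem_complementarySpectrum hs
        (hz.resolve_left fun ⟨n, hn⟩ => hne n hn.symm) hne⟩

end ChebW

/-! ### The substitution `t = cos φ` and the logarithmic integral of the weight. -/

section ChangeOfVariables

variable {E : Type*} [NormedAddCommGroup E] [NormedSpace ℝ E]

theorem cos_image_Ioo : Real.cos '' Ioo 0 π = Ioo (-1) 1 := by
  ext x
  constructor
  · rintro ⟨φ, hφ, rfl⟩
    refine ⟨?_, ?_⟩
    · rw [← Real.cos_pi]
      exact Real.strictAntiOn_cos ⟨hφ.1.le, hφ.2.le⟩ ⟨Real.pi_pos.le, le_rfl⟩ hφ.2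
    · rw [← Real.cos_zero]
      exact Real.strictAntiOn_cos ⟨le_rfl, Real.pi_pos.le⟩ ⟨hφ.1.le, hφ.2.le⟩ hφ.1
  · intro hx
    exact ⟨Real.arccos x, ⟨Real.arccos_pos.2 hx.2, Real.arccos_lt_pi.2 hx.1⟩,
      Real.cos_arccos hx.1.le hx.2.le⟩

theorem injOn_cos_Ioo : InjOn Real.cos (Ioo 0 π) :=
  Real.injOn_cos.mono Ioo_subset_Icc_self

theorem sqrt_one_sub_cos_sq {φ : ℝ} (hφ : φ ∈ Ioo 0 π) : √(1 - Real.cos φ ^ 2) = Real.sin φ := by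
  rw [← Real.sin_sq, Real.sqrt_sq (Real.sin_pos_of_mem_Ioo hφ).le]

theorem abs_sin_smul_weight (f : ℝ → E) {φ : ℝ} (hφ : φ ∈ Ioo 0 π) :
    |-Real.sin φ| • ((√(1 - Real.cos φ ^ 2))⁻¹ • f (Real.cos φ)) = f (Real.cos φ) := by
  have := Real.sin_pos_of_mem_Ioo hφ
  rw [sqrt_one_sub_cos_sq hφ, abs_neg, abs_of_pos this, smul_smul, mul_inv_cancel₀ this.ne',
    one_smul]

theorem integrableOn_weight_iff (f : ℝ → E) :
    IntegrableOn (fun t => (√(1 - t ^ 2))⁻¹ • f t) (Ioo (-1) 1) ↔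
      IntegrableOn (fun φ => f (Real.cos φ)) (Ioo 0 π) := by
  rw [← cos_image_Ioo, integrableOn_image_iff_integrableOn_abs_deriv_smul measurableSet_Ioo
    (fun φ _ => (Real.hasDerivAt_cos φ).hasDerivWithinAt) injOn_cos_Ioo]
  exact integrableOn_congr_fun (fun φ hφ => abs_sin_smul_weight f hφ) measurableSet_Ioo

theorem setIntegral_weight (f : ℝ → E) :
    ∫ t in Ioo (-1) 1, (√(1 - t ^ 2))⁻¹ • f t = ∫ φ in Ioo 0 π, f (Real.cos φ) := by
  rw [← cos_image_Ioo, integral_image_eq_integral_abs_deriv_smul measurableSet_Ioo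
    (fun φ _ => (Real.hasDerivAt_cos φ).hasDerivWithinAt) injOn_cos_Ioo]
  exact setIntegral_congr_fun measurableSet_Ioo (fun φ hφ => abs_sin_smul_weight f hφ)

theorem intervalIntegrable_iff_integrableOn_Ioo_neg_one_one {F : Type*} [NormedAddCommGroup F]
    {f : ℝ → F} :
    IntervalIntegrable f volume (-1) 1 ↔ IntegrableOn f (Ioo (-1) 1) :=
  intervalIntegrable_iff_integrableOn_Ioo_of_le (by norm_num)

theorem integral_neg_one_one (f : ℝ → E) : ∫ t in (-1 : ℝ)..1, f t = ∫ t in Ioo (-1) 1, f t := by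
  rw [intervalIntegral.integral_of_le (by norm_num), integral_Ioc_eq_integral_Ioo]

theorem integrableOn_weight_of_continuous {f : ℝ → E} (hf : Continuous f) :
    IntegrableOn (fun t => (√(1 - t ^ 2))⁻¹ • f t) (Ioo (-1) 1) := by
  rw [integrableOn_weight_iff]
  exact ((hf.comp Real.continuous_cos).integrableOn_Icc).mono_set Ioo_subset_Icc_self

end ChangeOfVariables

/-- The logarithm is integrable with respect to the Chebyshev weight. -/
theorem integrableOn_weight_log (t : ℝ) :
    IntegrableOn (fun τ => (√(1 - τ ^ 2))⁻¹ • Real.log |t - τ|) (Ioo (-1) 1) := by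
  rw [integrableOn_weight_iff (f := fun τ => Real.log |t - τ|)]
  have h : MeromorphicOn (fun φ : ℝ => t - Real.cos φ) (uIcc 0 π) := by
    intro x _
    exact ((analyticAt_const).sub Real.analyticAt_cos).meromorphicAt
  have := h.intervalIntegrable_log
  rw [intervalIntegrable_iff_integrableOn_Ioo_of_le Real.pi_pos.le] at this
  refine this.congr_fun (fun φ _ => ?_) measurableSet_Ioo
  simp [Real.log_abs]

theorem integral_log_sin_period (a : ℝ) :
    ∫ x in a..a + π, Real.log (Real.sin x) = -Real.log 2 * π := by
  have hper : Function.Periodic (fun x => Real.log (Real.sin x)) π := fun x => by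
    simp only
    rw [Real.sin_add_pi, Real.log_neg_eq_log]
  rw [hper.intervalIntegral_add_eq a 0, zero_add, integral_log_sin_zero_pi]

/-- With `t = cos θ`, `|cos θ - cos φ|` is `2 |sin((φ+θ)/2) sin((φ-θ)/2)|`. After rescaling, the two
sine integrals fill adjacent halves of one period of `log |sin|`, whose integral is `-π log 2`; so
the value does not depend on `t`. -/
theorem integral_weight_log {t : ℝ} (ht : t ∈ Ioo (-1 : ℝ) 1) :
    ∫ τ in Ioo (-1) 1, (√(1 - τ ^ 2))⁻¹ • Real.log |t - τ| = -π * Real.log 2 := by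
  rw [setIntegral_weight (f := fun τ => Real.log |t - τ|)]
  obtain ⟨θ, hθ, rfl⟩ : t ∈ Real.cos '' Ioo 0 π := by rwa [cos_image_Ioo]
  rw [← integral_Ioc_eq_integral_Ioo, ← intervalIntegral.integral_of_le Real.pi_pos.le]
  have hi : ∀ a b : ℝ, IntervalIntegrable (fun x => Real.log (Real.sin x)) volume a b :=
    fun a b => intervalIntegrable_log_sin
  have hm : ∀ d : ℝ, IntervalIntegrable (fun x => Real.log (Real.sin ((x + d) / 2))) volume 0 π :=
    fun d => by
      have h : MeromorphicOn (fun x : ℝ => Real.sin ((x + d) / 2)) (uIcc 0 π) := fun x _ =>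
        AnalyticAt.meromorphicAt (by fun_prop)
      exact h.intervalIntegrable_log
  have hsplit : ∫ φ in (0 : ℝ)..π, Real.log |Real.cos θ - Real.cos φ| =
      ∫ φ in (0 : ℝ)..π, (Real.log 2 + Real.log (Real.sin ((φ + θ) / 2)) +
        Real.log (Real.sin ((φ + -θ) / 2))) := by
    refine intervalIntegral.integral_congr_ae ?_
    have hne : ∀ᵐ φ : ℝ, φ ≠ θ := by simp [ae_iff, measure_singleton]
    filter_upwards [hne] with φ hφ hmem
    rw [uIoc_of_le Real.pi_pos.le] at hmem
    have h1 : Real.sin ((φ + θ) / 2) ≠ 0 :=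
      (Real.sin_pos_of_mem_Ioo ⟨by linarith [hmem.1, hθ.1], by linarith [hmem.2, hθ.2]⟩).ne'
    have h2 : Real.sin ((φ + -θ) / 2) ≠ 0 := by
      intro h
      rw [Real.sin_eq_zero_iff_of_lt_of_lt] at h
      · exact hφ (by linarith)
      · linarith [hmem.1, hθ.2, Real.pi_pos]
      · linarith [hmem.2, hθ.1, Real.pi_pos]
    rw [Real.cos_sub_cos, Real.log_abs, ← Real.log_mul two_ne_zero h1,
      ← Real.log_mul (mul_ne_zero two_ne_zero h1) h2]
    congr 1
    rw [show (θ - φ) / 2 = -((φ + -θ) / 2) by ring, Real.sin_neg, add_comm θ φ]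
    ring
  have e1 : ∫ φ in (0 : ℝ)..π, Real.log (Real.sin ((φ + θ) / 2)) =
      2 * ∫ x in θ / 2..θ / 2 + π / 2, Real.log (Real.sin x) := by
    have := intervalIntegral.integral_comp_div_add (a := 0) (b := π)
      (fun x => Real.log (Real.sin x)) (two_ne_zero (α := ℝ)) (θ / 2)
    rw [show (0 : ℝ) / 2 + θ / 2 = θ / 2 by ring, smul_eq_mul, add_comm (π / 2)] at this
    rw [← this]
    simp only [add_div]
  have e2 : ∫ φ in (0 : ℝ)..π, Real.log (Real.sin ((φ + -θ) / 2)) =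
      2 * ∫ x in θ / 2 - π / 2..θ / 2, Real.log (Real.sin x) := by
    have := intervalIntegral.integral_comp_sub_div (a := 0) (b := π)
      (fun x => Real.log (Real.sin x)) (two_ne_zero (α := ℝ)) (θ / 2)
    rw [show θ / 2 - (0 : ℝ) / 2 = θ / 2 by ring, smul_eq_mul] at this
    rw [← this]
    refine intervalIntegral.integral_congr fun φ _ => ?_
    rw [show (φ + -θ) / 2 = -(θ / 2 - φ / 2) by ring, Real.sin_neg, Real.log_neg_eq_log]
  rw [hsplit, intervalIntegral.integral_add ((intervalIntegrable_const).add (hm θ)) (hm (-θ)),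
    intervalIntegral.integral_add intervalIntegrable_const (hm θ), e1, e2,
    intervalIntegral.integral_const]
  have h3 := intervalIntegral.integral_add_adjacent_intervals
    (hi (θ / 2 - π / 2) (θ / 2)) (hi (θ / 2) (θ / 2 + π / 2))
  have h4 := integral_log_sin_period (θ / 2 - π / 2)
  rw [show θ / 2 - π / 2 + π = θ / 2 + π / 2 by ring] at h4
  rw [h4] at h3
  simp only [smul_eq_mul, sub_zero]
  linear_combination 2 * h3

/-! ### Integrals over the segment with a neighbourhood of the singularity removed. -/

/-- The segment with a symmetric neighbourhood of `t` removed. -/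
def truncSet (t ε : ℝ) : Set ℝ := {τ | τ ∈ Ioo (-1 : ℝ) 1 ∧ ε < |t - τ|}

theorem measurableSet_truncSet (t ε : ℝ) : MeasurableSet (truncSet t ε) :=
  measurableSet_Ioo.inter
    (measurableSet_lt (f := fun _ => ε) (g := fun τ => |t - τ|) measurable_const (by fun_prop))

theorem truncSet_subset (t ε : ℝ) : truncSet t ε ⊆ Ioo (-1) 1 := fun _ h => h.1

section Trunc

variable {E : Type*} [NormedAddCommGroup E] [NormedSpace ℝ E]

theorem tendsto_integral_truncSet {f : ℝ → E} (hf : IntegrableOn f (Ioo (-1) 1)) (t : ℝ) :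
    Tendsto (fun ε => ∫ τ in truncSet t ε, f τ) (𝓝[>] 0) (𝓝 (∫ τ in Ioo (-1) 1, f τ)) := by
  have h : ∀ ε, ∫ τ in truncSet t ε, f τ =
      ∫ τ in Ioo (-1) 1, (truncSet t ε).indicator f τ := fun ε => by
    rw [setIntegral_indicator (measurableSet_truncSet t ε),
      inter_eq_right.2 (truncSet_subset t ε)]
  simp only [h]
  refine tendsto_integral_filter_of_dominated_convergence (fun τ => ‖f τ‖) ?_ ?_ hf.norm ?_
  · exact Eventually.of_forall fun ε =>
      hf.aestronglyMeasurable.indicator (measurableSet_truncSet t ε)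
  · exact Eventually.of_forall fun ε => Eventually.of_forall fun τ => norm_indicator_le_norm_self _ _
  · have hne : ∀ᵐ τ : ℝ ∂(volume.restrict (Ioo (-1 : ℝ) 1)), τ ≠ t :=
      ae_restrict_of_ae (by simp [ae_iff, measure_singleton])
    filter_upwards [hne, ae_restrict_mem measurableSet_Ioo] with τ hτ hmem
    refine tendsto_const_nhds.congr' ?_
    have hpos : 0 < |t - τ| := abs_pos.2 (sub_ne_zero.2 hτ.symm)
    filter_upwards [mem_nhdsWithin_of_mem_nhds (Iio_mem_nhds hpos)] with ε hε
    exact (indicator_of_mem (show τ ∈ truncSet t ε from ⟨hmem, hε⟩) f).symm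

theorem integrableOn_truncSet_smul {f : ℝ → E} (hf : IntegrableOn f (Ioo (-1) 1)) {h : ℝ → ℝ}
    (hm : Measurable h) {t ε C : ℝ} (hC : ∀ τ ∈ truncSet t ε, |h τ| ≤ C) :
    IntegrableOn (fun τ => h τ • f τ) (truncSet t ε) := by
  refine Integrable.bdd_smul (hf.mono_set (truncSet_subset t ε)) C hm.aestronglyMeasurable ?_
  filter_upwards [ae_restrict_mem (measurableSet_truncSet t ε)] with τ hτ
  exact hC τ hτ

theorem integrableOn_truncSet_div {f : ℝ → ℝ} (hf : IntegrableOn f (Ioo (-1) 1)) {t ε : ℝ}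
    (hε : 0 < ε) : IntegrableOn (fun τ => f τ / (τ - t)) (truncSet t ε) := by
  refine (integrableOn_truncSet_smul hf (h := fun τ => (τ - t)⁻¹) (by fun_prop)
    (C := ε⁻¹) (t := t) (ε := ε) fun τ hτ => ?_).congr_fun (fun τ _ => ?_)
    (measurableSet_truncSet t ε)
  · rw [abs_inv, abs_sub_comm]
    exact inv_anti₀ hε hτ.2.le
  · simp only [smul_eq_mul]; rw [div_eq_inv_mul]

theorem truncSet_eq {t ε : ℝ} (hε : 0 < ε) (h1 : ε < 1 - t)
    (h2 : ε < 1 + t) : truncSet t ε = Ioo (-1) (t - ε) ∪ Ioo (t + ε) 1 := by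
  ext τ
  simp only [truncSet, mem_ofPred_eq, mem_union, mem_Ioo, lt_abs]
  constructor
  · rintro ⟨⟨h3, h4⟩, h5 | h5⟩
    · left; constructor <;> linarith
    · right; constructor <;> linarith
  · rintro (⟨h3, h4⟩ | ⟨h3, h4⟩)
    · exact ⟨⟨h3, by linarith⟩, Or.inl (by linarith)⟩
    · exact ⟨⟨by linarith, h4⟩, Or.inr (by linarith)⟩

theorem eventually_small {t : ℝ} (ht : t ∈ Ioo (-1 : ℝ) 1) :
    ∀ᶠ ε in 𝓝[>] (0 : ℝ), 0 < ε ∧ ε < 1 - t ∧ ε < 1 + t := by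
  filter_upwards [self_mem_nhdsWithin,
    mem_nhdsWithin_of_mem_nhds (Iio_mem_nhds (show 0 < 1 - t by linarith [ht.2])),
    mem_nhdsWithin_of_mem_nhds (Iio_mem_nhds (show 0 < 1 + t by linarith [ht.1]))] with ε a b c
  exact ⟨a, b, c⟩

theorem integral_truncSet_eq {G g : ℝ → ℝ} {t ε : ℝ} (hε : 0 < ε)
    (h1 : ε < 1 - t) (h2 : ε < 1 + t) (hG : ContinuousOn G (Icc (-1) 1 \ {t}))
    (hg : ∀ τ ∈ Ioo (-1 : ℝ) 1, τ ≠ t → HasDerivAt G (g τ) τ)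
    (hi : IntegrableOn g (truncSet t ε)) :
    ∫ τ in truncSet t ε, g τ = G (t - ε) - G (-1) + (G 1 - G (t + ε)) := by
  rw [truncSet_eq hε h1 h2] at hi ⊢
  have hi1 := hi.mono_set subset_union_left
  have hi2 := hi.mono_set subset_union_right
  rw [setIntegral_union (Set.disjoint_left.2 fun x hx hx' => by linarith [hx.2, hx'.1])
    measurableSet_Ioo hi1 hi2, ← integral_Ioc_eq_integral_Ioo, ← integral_Ioc_eq_integral_Ioo,
    ← intervalIntegral.integral_of_le (by linarith), ← intervalIntegral.integral_of_le (by linarith)]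
  congr 1
  · refine intervalIntegral.integral_eq_sub_of_hasDerivAt_of_le (by linarith)
      (hG.mono fun x hx => ⟨⟨hx.1, by linarith [hx.2, hε]⟩, fun h => ?_⟩)
      (fun x hx => hg x ⟨hx.1, by linarith [hx.2, hε]⟩ (by linarith [hx.2] : x < t).ne)
      ((intervalIntegrable_iff_integrableOn_Ioo_of_le (by linarith)).2 hi1)
    have : x = t := h
    linarith [hx.2]
  · refine intervalIntegral.integral_eq_sub_of_hasDerivAt_of_le (by linarith)
      (hG.mono fun x hx => ⟨⟨by linarith [hx.1, hε], hx.2⟩, fun h => ?_⟩)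
      (fun x hx => hg x ⟨by linarith [hx.1, hε], hx.2⟩ (by linarith [hx.1] : t < x).ne')
      ((intervalIntegrable_iff_integrableOn_Ioo_of_le (by linarith)).2 hi2)
    have : x = t := h
    linarith [hx.1]

end Trunc

/-! ### Chebyshev identities, derivatives and moments. -/

/-- The real Chebyshev polynomials of the first kind as functions. -/
noncomputable def chT (n : ℤ) (τ : ℝ) : ℝ := (Polynomial.Chebyshev.T ℝ n).eval τ

/-- The real Chebyshev polynomials of the second kind as functions. -/
noncomputable def chU (n : ℤ) (τ : ℝ) : ℝ := (Polynomial.Chebyshev.U ℝ n).eval τ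

@[fun_prop] theorem continuous_chT (n : ℤ) : Continuous (chT n) := by unfold chT; fun_prop

@[fun_prop] theorem continuous_chU (n : ℤ) : Continuous (chU n) := by unfold chU; fun_prop

theorem chT_zero (τ : ℝ) : chT 0 τ = 1 := by simp [chT]

theorem chT_one (τ : ℝ) : chT 1 τ = τ := by simp [chT]

theorem chT_neg (n : ℤ) (τ : ℝ) : chT (-n) τ = chT n τ := by simp [chT]

theorem chU_zero (τ : ℝ) : chU 0 τ = 1 := by simp [chU]

theorem chU_neg_one (τ : ℝ) : chU (-1) τ = 0 := by simp [chU]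

theorem chT_add_two (n : ℤ) (τ : ℝ) : chT (n + 2) τ = 2 * τ * chT (n + 1) τ - chT n τ := by
  simp [chT, Polynomial.Chebyshev.T_add_two]

theorem chU_add_two (n : ℤ) (τ : ℝ) : chU (n + 2) τ = 2 * τ * chU (n + 1) τ - chU n τ := by
  simp [chU, Polynomial.Chebyshev.U_add_two]

theorem two_mul_chT (n : ℤ) (τ : ℝ) : 2 * chT n τ = chU n τ - chU (n - 2) τ := by
  have := congrArg (Polynomial.eval τ) (Polynomial.Chebyshev.two_mul_T_eq_U_sub_U ℝ (n - 2))
  simpa [chT, chU] using this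

theorem chT_cos (n : ℤ) (φ : ℝ) : chT n (Real.cos φ) = Real.cos (n * φ) := by
  simp [chT]

theorem abs_chT_le (n : ℤ) {τ : ℝ} (h : τ ∈ Ioo (-1 : ℝ) 1) : |chT n τ| ≤ 1 := by
  obtain ⟨φ, -, rfl⟩ : τ ∈ Real.cos '' Ioo 0 π := by rwa [cos_image_Ioo]
  rw [chT_cos]
  exact Real.abs_cos_le_one _

/-- `2 (1 - τ²) U_{n-1} = T_{n-1} - T_{n+1}`. -/
theorem two_mul_one_sub_sq_mul_chU (n : ℤ) (τ : ℝ) :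
    2 * ((1 - τ ^ 2) * chU (n - 1) τ) = chT (n - 1) τ - chT (n + 1) τ := by
  have h1 := congrArg (Polynomial.eval τ)
    (Polynomial.Chebyshev.one_sub_X_sq_mul_U_eq_pol_in_T ℝ (n - 1))
  have h2 := chT_add_two (n - 1) τ
  simp only [Polynomial.eval_mul, Polynomial.eval_sub, Polynomial.eval_one, Polynomial.eval_pow,
    Polynomial.eval_X] at h1
  change (1 - τ ^ 2) * chU (n - 1) τ = τ * chT (n - 1 + 1) τ - chT (n - 1 + 2) τ at h1
  rw [show n - 1 + 2 = n + 1 by ring, show n - 1 + 1 = n by ring] at *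
  linarith

theorem hasDerivAt_chT (n : ℤ) (τ : ℝ) : HasDerivAt (chT n) (n * chU (n - 1) τ) τ := by
  have := (Polynomial.Chebyshev.T ℝ n).hasDerivAt τ
  rw [Polynomial.Chebyshev.T_derivative_eq_U] at this
  have h2 : HasDerivAt (chT n) _ τ := this
  exact h2.congr_deriv (by simp [chU])

theorem one_sub_sq_pos {τ : ℝ} (h : τ ∈ Ioo (-1 : ℝ) 1) : 0 < 1 - τ ^ 2 := by
  nlinarith [h.1, h.2]

theorem hasDerivAt_weight {τ : ℝ} (h : τ ∈ Ioo (-1 : ℝ) 1) :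
    HasDerivAt (fun τ => √(1 - τ ^ 2)) (-τ / √(1 - τ ^ 2)) τ := by
  have h1 : HasDerivAt (fun τ : ℝ => 1 - τ ^ 2) (-(2 * τ)) τ := by
    simpa using ((hasDerivAt_pow 2 τ).const_sub 1)
  convert h1.sqrt (one_sub_sq_pos h).ne' using 1
  field_simp

/-- `(w T_n)' = -((n+1) T_{n+1} - (n-1) T_{n-1}) / (2 w)`. -/
theorem hasDerivAt_weight_mul_chT (n : ℤ) {τ : ℝ} (h : τ ∈ Ioo (-1 : ℝ) 1) :
    HasDerivAt (fun τ => √(1 - τ ^ 2) * chT n τ)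
      (-(1 / 2) * ((n + 1) * chT (n + 1) τ - (n - 1) * chT (n - 1) τ) / √(1 - τ ^ 2)) τ := by
  refine ((hasDerivAt_weight h).mul (hasDerivAt_chT n τ)).congr_deriv ?_
  have hw : 0 < √(1 - τ ^ 2) := Real.sqrt_pos.2 (one_sub_sq_pos h)
  have hsq := Real.sq_sqrt (one_sub_sq_pos h).le
  have h1 := two_mul_one_sub_sq_mul_chU n τ
  have h2 := chT_add_two (n - 1) τ
  rw [show n - 1 + 2 = n + 1 by ring, show n - 1 + 1 = n by ring] at h2
  rw [eq_div_iff hw.ne']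
  field_simp
  rw [hsq]
  linear_combination (n : ℝ) * h1 + h2

/-- `(w U_{n-1})' = -n T_n / w`. -/
theorem hasDerivAt_weight_mul_chU (n : ℤ) {τ : ℝ} (h : τ ∈ Ioo (-1 : ℝ) 1) :
    HasDerivAt (fun τ => √(1 - τ ^ 2) * chU (n - 1) τ) (-n * chT n τ / √(1 - τ ^ 2)) τ := by
  -- Rewriting through `2 w² U_{n-1} = T_{n-1} - T_{n+1}` leaves only polynomials of the first kind
  -- to differentiate.
  have e : ∀ x ∈ Ioo (-1 : ℝ) 1, √(1 - x ^ 2) * chU (n - 1) x =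
      (chT (n - 1) x - chT (n + 1) x) / (2 * √(1 - x ^ 2)) := by
    intro x hx
    have hw : 0 < √(1 - x ^ 2) := Real.sqrt_pos.2 (one_sub_sq_pos hx)
    rw [← two_mul_one_sub_sq_mul_chU, eq_div_iff (by positivity)]
    linear_combination 2 * chU (n - 1) x * Real.sq_sqrt (one_sub_sq_pos hx).le
  have hw : 0 < √(1 - τ ^ 2) := Real.sqrt_pos.2 (one_sub_sq_pos h)
  have hsq := Real.sq_sqrt (one_sub_sq_pos h).le
  have hd := ((hasDerivAt_chT (n - 1) τ).sub (hasDerivAt_chT (n + 1) τ)).div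
    ((hasDerivAt_weight h).const_mul 2) (by positivity)
  refine (hd.congr_deriv ?_).congr_of_eventuallyEq ?_
  · rw [div_eq_div_iff (by positivity) hw.ne']
    have h1 := two_mul_one_sub_sq_mul_chU n τ
    have h2 := two_mul_chT n τ
    have h3 := chU_add_two (n - 2) τ
    rw [show n - 2 + 2 = n by ring, show n - 2 + 1 = n - 1 by ring] at h3
    rw [show n - 1 - 1 = n - 2 by ring, show n + 1 - 1 = n by ring]
    push_cast
    simp only [Pi.sub_apply]
    rw [← h1]
    field_simp
    rw [hsq]
    linear_combination (1 - τ ^ 2) * ((n : ℝ) * h2 - h3)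
  · filter_upwards [Ioo_mem_nhds h.1 h.2] with x hx
    exact e x hx

theorem integrableOn_chT_div_weight (n : ℤ) :
    IntegrableOn (fun τ => chT n τ / √(1 - τ ^ 2)) (Ioo (-1) 1) :=
  (integrableOn_weight_of_continuous (continuous_chT n)).congr_fun
    (fun τ _ => by simp only [smul_eq_mul]; rw [inv_mul_eq_div]) measurableSet_Ioo

theorem integral_chT_div_weight_zero :
    ∫ τ in Ioo (-1) 1, chT 0 τ / √(1 - τ ^ 2) = π := by
  have h := setIntegral_weight (chT 0)
  simp only [smul_eq_mul, inv_mul_eq_div] at h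
  rw [h]
  simp [chT_zero, Real.pi_pos.le]

theorem integral_cos_int_mul {n : ℤ} (hn : n ≠ 0) : ∫ φ in Ioo 0 π, Real.cos (n * φ) = 0 := by
  have hn' : (n : ℝ) ≠ 0 := by exact_mod_cast hn
  rw [← integral_Ioc_eq_integral_Ioo, ← intervalIntegral.integral_of_le Real.pi_pos.le,
    intervalIntegral.integral_comp_mul_left (fun x => Real.cos x) hn', integral_cos]
  simp [Real.sin_int_mul_pi]

theorem integral_chT_div_weight_of_ne {n : ℤ} (hn : n ≠ 0) :
    ∫ τ in Ioo (-1) 1, chT n τ / √(1 - τ ^ 2) = 0 := by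
  have h := setIntegral_weight (chT n)
  simp only [smul_eq_mul, inv_mul_eq_div] at h
  rw [h]
  simp only [chT_cos]
  exact integral_cos_int_mul hn

/-! ### The finite Hilbert transform. -/

/-- The truncated Cauchy integrals of `T_n / w`. -/
noncomputable def truncCauchy (n : ℤ) (t ε : ℝ) : ℝ :=
  ∫ τ in truncSet t ε, chT n τ / √(1 - τ ^ 2) / (τ - t)

theorem one_sub_mul_add_pos {t τ : ℝ} (ht : t ∈ Ioo (-1 : ℝ) 1) (hτ : τ ∈ Icc (-1 : ℝ) 1) :
    0 < 1 - t * τ + √(1 - t ^ 2) * √(1 - τ ^ 2) := by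
  have h1 : 0 ≤ √(1 - t ^ 2) * √(1 - τ ^ 2) := by positivity
  have h2 : t * τ < 1 := by
    rcases le_or_gt 0 t with h | h
    · nlinarith [ht.2, hτ.2]
    · nlinarith [ht.1, hτ.1]
  linarith

/-- One formula serves on both sides of `t`, because `Real.log` is the logarithm of the absolute
value. -/
theorem hasDerivAt_cauchyAntideriv {t τ : ℝ} (ht : t ∈ Ioo (-1 : ℝ) 1) (hτ : τ ∈ Ioo (-1 : ℝ) 1)
    (hne : τ ≠ t) :
    HasDerivAt (fun τ => -(√(1 - t ^ 2))⁻¹ *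
      (Real.log (1 - t * τ + √(1 - t ^ 2) * √(1 - τ ^ 2)) - Real.log (τ - t)))
      (1 / √(1 - τ ^ 2) / (τ - t)) τ := by
  have hN := one_sub_mul_add_pos ht ⟨hτ.1.le, hτ.2.le⟩
  have hw : 0 < √(1 - τ ^ 2) := Real.sqrt_pos.2 (one_sub_sq_pos hτ)
  have hwt : 0 < √(1 - t ^ 2) := Real.sqrt_pos.2 (one_sub_sq_pos ht)
  have hsq := Real.sq_sqrt (one_sub_sq_pos hτ).le
  have hsqt := Real.sq_sqrt (one_sub_sq_pos ht).le
  have hd : τ - t ≠ 0 := sub_ne_zero.2 hne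
  have d1 : HasDerivAt (fun τ => 1 - t * τ + √(1 - t ^ 2) * √(1 - τ ^ 2))
      (-t + √(1 - t ^ 2) * (-τ / √(1 - τ ^ 2))) τ := by
    refine HasDerivAt.add ?_ ((hasDerivAt_weight hτ).const_mul _)
    simpa using ((hasDerivAt_id τ).const_mul t).const_sub 1
  have d2 : HasDerivAt (fun τ => τ - t) 1 τ := (hasDerivAt_id τ).sub_const t
  refine (((d1.log hN.ne').sub (d2.log hd)).const_mul _).congr_deriv ?_
  generalize √(1 - τ ^ 2) = w at *
  generalize √(1 - t ^ 2) = v at *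
  have hN' := hN.ne'
  rw [div_div, eq_div_iff (mul_ne_zero hw.ne' hd)]
  field_simp
  linear_combination -w * hsqt + v * hsq

/-- The antiderivative vanishes at `±1`, and the two terms `log ε` cancel by symmetry of the removed
interval. What is left is the increment of a function continuous at `t`. -/
theorem tendsto_truncCauchy_zero {t : ℝ} (ht : t ∈ Ioo (-1 : ℝ) 1) :
    Tendsto (truncCauchy 0 t) (𝓝[>] 0) (𝓝 0) := by
  set N : ℝ → ℝ := fun τ => 1 - t * τ + √(1 - t ^ 2) * √(1 - τ ^ 2) with hN
  have hNc : Continuous N := by fun_prop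
  have hlim : Tendsto (fun ε => (√(1 - t ^ 2))⁻¹ * (Real.log (N (t + ε)) - Real.log (N (t - ε))))
      (𝓝[>] 0) (𝓝 0) := by
    have hNt : N t ≠ 0 := (one_sub_mul_add_pos ht ⟨ht.1.le, ht.2.le⟩).ne'
    have h : ContinuousAt (fun ε => (√(1 - t ^ 2))⁻¹ * (Real.log (N (t + ε)) - Real.log (N (t - ε))))
        0 := by
      refine continuousAt_const.mul (ContinuousAt.sub ?_ ?_)
      · exact (hNc.comp (by fun_prop)).continuousAt.log (by simpa using hNt)
      · exact (hNc.comp (by fun_prop)).continuousAt.log (by simpa using hNt)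
    have := h.tendsto
    simp only [add_zero, sub_zero, sub_self, mul_zero] at this
    exact this.mono_left nhdsWithin_le_nhds
  refine hlim.congr' ?_
  filter_upwards [eventually_small ht] with ε hε
  have hi : IntegrableOn (fun τ => 1 / √(1 - τ ^ 2) / (τ - t)) (truncSet t ε) := by
    have := integrableOn_truncSet_div (integrableOn_chT_div_weight 0) (t := t) hε.1
    simpa only [chT_zero] using this
  rw [truncCauchy]
  simp only [chT_zero]
  rw [integral_truncSet_eq (G := fun τ => -(√(1 - t ^ 2))⁻¹ * (Real.log (N τ) - Real.log (τ - t)))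
    hε.1 hε.2.1 hε.2.2 ?_ (fun τ hτ hne => hasDerivAt_cauchyAntideriv ht hτ hne) hi]
  · have h1 : N 1 = 1 - t := by simp [hN]
    have h2 : N (-1) = -(-1 - t) := by simp [hN]; ring
    rw [h1, h2, Real.log_neg_eq_log, show t - ε - t = -ε by ring, show t + ε - t = ε by ring,
      Real.log_neg_eq_log]
    ring
  · refine ContinuousOn.mul continuousOn_const (ContinuousOn.sub ?_ ?_)
    · exact hNc.continuousOn.log fun τ hτ => (one_sub_mul_add_pos ht hτ.1).ne'
    · exact ContinuousOn.log (by fun_prop) fun τ hτ => sub_ne_zero.2 hτ.2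

/-- In the recurrence for `T_n` one writes `τ = t + (τ - t)`; the second summand cancels the
denominator and leaves a regular integral. -/
theorem truncCauchy_add_two {n : ℤ} {t ε : ℝ} (hε : 0 < ε) :
    truncCauchy (n + 2) t ε = 2 * (∫ τ in truncSet t ε, chT (n + 1) τ / √(1 - τ ^ 2)) +
      2 * t * truncCauchy (n + 1) t ε - truncCauchy n t ε := by
  have h1 := (integrableOn_chT_div_weight (n + 1)).mono_set (truncSet_subset t ε)
  have h2 := integrableOn_truncSet_div (integrableOn_chT_div_weight (n + 1)) (t := t) hε
  have h3 := integrableOn_truncSet_div (integrableOn_chT_div_weight n) (t := t) hε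
  have h12 : IntegrableOn (fun τ => 2 * (chT (n + 1) τ / √(1 - τ ^ 2)) +
      2 * t * (chT (n + 1) τ / √(1 - τ ^ 2) / (τ - t))) (truncSet t ε) :=
    (h1.const_mul 2).add (h2.const_mul (2 * t))
  unfold truncCauchy
  rw [← integral_const_mul, ← integral_const_mul, ← integral_add (h1.const_mul _) (h2.const_mul _),
    ← integral_sub h12 h3]
  refine setIntegral_congr_fun (measurableSet_truncSet t ε) fun τ hτ => ?_
  have hd : τ - t ≠ 0 := fun h => by
    have := hτ.2
    rw [abs_sub_comm, h, abs_zero] at this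
    linarith
  simp only [chT_add_two]
  field_simp
  ring

/-- The finite Hilbert transform of `T_n / w`. -/
theorem tendsto_truncCauchy (n : ℕ) {t : ℝ} (ht : t ∈ Ioo (-1 : ℝ) 1) :
    Tendsto (truncCauchy n t) (𝓝[>] 0) (𝓝 (π * chU (n - 1) t)) := by
  induction n using Nat.twoStepInduction with
  | zero => simpa [chU_neg_one] using tendsto_truncCauchy_zero ht
  | one =>
    have h1 := tendsto_integral_truncSet (integrableOn_chT_div_weight 0) t
    rw [integral_chT_div_weight_zero] at h1
    have h2 := h1.add ((tendsto_truncCauchy_zero ht).const_mul t)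
    simp only [mul_zero, add_zero] at h2
    rw [show ((1 : ℕ) : ℤ) - 1 = 0 by norm_num, chU_zero, mul_one]
    refine h2.congr' ?_
    filter_upwards [self_mem_nhdsWithin] with ε hε
    have i1 := (integrableOn_chT_div_weight 0).mono_set (truncSet_subset t ε)
    have i2 := integrableOn_truncSet_div (integrableOn_chT_div_weight 0) (t := t) hε
    unfold truncCauchy
    rw [← integral_const_mul, ← integral_add i1 (i2.const_mul _)]
    refine setIntegral_congr_fun (measurableSet_truncSet t ε) fun τ hτ => ?_
    have hd : τ - t ≠ 0 := fun h => by
      have := hτ.2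
      rw [abs_sub_comm, h, abs_zero] at this
      exact lt_asymm hε this
    simp only [chT_zero, Nat.cast_one, chT_one]
    field_simp
    ring
  | more n ih1 ih2 =>
    have h1 := tendsto_integral_truncSet (integrableOn_chT_div_weight (n + 1)) t
    rw [integral_chT_div_weight_of_ne (by omega)] at h1
    have h2 := ((h1.const_mul 2).add (ih2.const_mul (2 * t))).sub ih1
    have e : (2 : ℝ) * 0 + 2 * t * (π * chU (((n + 1 : ℕ) : ℤ) - 1) t) - π * chU (n - 1) t =
        π * chU (((n + 2 : ℕ) : ℤ) - 1) t := by
      have := chU_add_two ((n : ℤ) - 1) t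
      rw [show (n : ℤ) - 1 + 2 = ((n + 2 : ℕ) : ℤ) - 1 by push_cast; ring,
        show (n : ℤ) - 1 + 1 = ((n + 1 : ℕ) : ℤ) - 1 by push_cast; ring] at this
      rw [this]
      ring
    rw [e] at h2
    refine h2.congr' ?_
    filter_upwards [self_mem_nhdsWithin] with ε hε
    push_cast
    exact (truncCauchy_add_two hε).symm

/-! ### The logarithmic potential and the finite part, by integration by parts. -/

theorem HasDerivAt.tendsto_slope_right {F : ℝ → ℝ} {F' t : ℝ} (h : HasDerivAt F F' t) :
    Tendsto (fun ε => (F (t + ε) - F t) / ε) (𝓝[>] 0) (𝓝 F') := by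
  have := (hasDerivAt_iff_tendsto_slope_zero.1 h).mono_left
    (nhdsWithin_mono 0 (fun x hx => (mem_Ioi.1 hx).ne' : Ioi (0 : ℝ) ⊆ {0}ᶜ))
  simpa [div_eq_inv_mul] using this

theorem HasDerivAt.tendsto_slope_left {F : ℝ → ℝ} {F' t : ℝ} (h : HasDerivAt F F' t) :
    Tendsto (fun ε => (F (t - ε) - F t) / ε) (𝓝[>] 0) (𝓝 (-F')) := by
  have h1 : HasDerivAt (fun x => F (2 * t - x)) (-F') t := by
    have h2 : HasDerivAt F F' (2 * t - t) := by rwa [show 2 * t - t = t by ring]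
    simpa using h2.comp_const_sub (2 * t) t
  have := h1.tendsto_slope_right
  refine this.congr fun ε => ?_
  rw [show 2 * t - (t + ε) = t - ε by ring, show 2 * t - t = t by ring]

/-- These are the boundary terms at `t ± ε` for the logarithmic kernel: the difference is `O(ε)`,
and `ε log ε` tends to zero. -/
theorem HasDerivAt.tendsto_sub_mul_log {F : ℝ → ℝ} {F' t : ℝ} (h : HasDerivAt F F' t) :
    Tendsto (fun ε => (F (t - ε) - F (t + ε)) * Real.log ε) (𝓝[>] 0) (𝓝 0) := by
  have h0 : Tendsto (fun x : ℝ => Real.log x * x) (𝓝[>] 0) (𝓝 0) := by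
    simpa using tendsto_log_mul_rpow_nhdsGT_zero one_pos
  have h1 := (h.tendsto_slope_left.sub h.tendsto_slope_right).mul h0
  rw [mul_zero] at h1
  refine h1.congr' ?_
  filter_upwards [self_mem_nhdsWithin] with ε hε
  have : ε ≠ 0 := ne_of_gt hε
  field_simp
  ring

/-- These are the boundary terms for the kernel `1/(τ-t)`: the first order parts at `t - ε` and `t +
ε` cancel, so `2 F(t) / ε` is the whole divergence. -/
theorem HasDerivAt.tendsto_add_div_sub {F : ℝ → ℝ} {F' t : ℝ} (h : HasDerivAt F F' t) :
    Tendsto (fun ε => (F (t - ε) + F (t + ε)) / ε - 2 * F t / ε) (𝓝[>] 0) (𝓝 0) := by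
  have h1 := h.tendsto_slope_left.add h.tendsto_slope_right
  rw [neg_add_cancel] at h1
  refine h1.congr fun ε => ?_
  ring

theorem integrableOn_log_mul_of_bdd {f : ℝ → ℝ} (hf : Continuous f) {C : ℝ}
    (hC : ∀ τ ∈ Ioo (-1 : ℝ) 1, |f τ| ≤ C) (t : ℝ) :
    IntegrableOn (fun τ => Real.log |t - τ| * (f τ / √(1 - τ ^ 2))) (Ioo (-1) 1) := by
  refine (Integrable.bdd_mul (integrableOn_weight_log t) (f := f) (c := C)
    hf.aestronglyMeasurable ?_).congr ?_
  · filter_upwards [ae_restrict_mem measurableSet_Ioo] with τ hτ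
    exact hC τ hτ
  · refine Eventually.of_forall fun τ => ?_
    simp only [smul_eq_mul]
    ring

theorem integrableOn_log_mul_chT (n : ℤ) (t : ℝ) :
    IntegrableOn (fun τ => Real.log |t - τ| * (chT n τ / √(1 - τ ^ 2))) (Ioo (-1) 1) :=
  integrableOn_log_mul_of_bdd (continuous_chT n) (fun _ h => abs_chT_le n h) t

/-- By parts on the truncated segment. -/
theorem integral_truncSet_by_parts {F v K K' : ℝ → ℝ} {t ε : ℝ}
    (hε : 0 < ε) (h1 : ε < 1 - t) (h2 : ε < 1 + t) (hF : Continuous F)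
    (hFv : ∀ τ ∈ Ioo (-1 : ℝ) 1, HasDerivAt F (v τ) τ) (hl : F (-1) = 0) (hr : F 1 = 0)
    (hK : ∀ τ, τ ≠ t → HasDerivAt K (K' τ) τ)
    (hi1 : IntegrableOn (fun τ => K τ * v τ) (truncSet t ε))
    (hi2 : IntegrableOn (fun τ => K' τ * F τ) (truncSet t ε)) :
    ∫ τ in truncSet t ε, K' τ * F τ =
      K (t - ε) * F (t - ε) - K (t + ε) * F (t + ε) - ∫ τ in truncSet t ε, K τ * v τ := by
  rw [eq_sub_iff_add_eq, ← integral_add hi2 hi1,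
    integral_truncSet_eq (G := fun τ => K τ * F τ) hε h1 h2
      (ContinuousOn.mul (fun τ hτ => (hK τ hτ.2).continuousAt.continuousWithinAt) hF.continuousOn)
      (fun τ hτ hne => (hK τ hne).mul (hFv τ hτ)) (hi2.add hi1), hl, hr]
  ring

theorem ne_of_mem_truncSet {t ε τ : ℝ} (hε : 0 < ε) (h : τ ∈ truncSet t ε) : τ - t ≠ 0 := fun h0 => by
  have := h.2
  rw [abs_sub_comm, h0, abs_zero] at this
  linarith

/-- The logarithmic potential of `T_n / w`. -/
theorem integral_log_mul_chT {n : ℕ} (hn : n ≠ 0) {t : ℝ} (ht : t ∈ Ioo (-1 : ℝ) 1) :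
    ∫ τ in Ioo (-1) 1, Real.log |t - τ| * (chT n τ / √(1 - τ ^ 2)) = -(π / n) * chT n t := by
  have hn' : (n : ℝ) ≠ 0 := by exact_mod_cast hn
  -- `F` is an antiderivative of `-n T_n / w` that vanishes at both ends, so only the boundary terms
  -- at `t ± ε` survive.
  set F : ℝ → ℝ := fun τ => √(1 - τ ^ 2) * chU ((n : ℤ) - 1) τ with hF
  have hFv : ∀ τ ∈ Ioo (-1 : ℝ) 1, HasDerivAt F (-n * chT n τ / √(1 - τ ^ 2)) τ := fun τ hτ => by
    simpa using hasDerivAt_weight_mul_chU (n : ℤ) hτ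
  have hlim1 := tendsto_integral_truncSet (integrableOn_log_mul_chT n t) t
  refine tendsto_nhds_unique hlim1 ?_
  obtain ⟨m, rfl⟩ : ∃ m, n = m + 1 := ⟨n - 1, by omega⟩
  have hlim2 := ((((tendsto_truncCauchy m ht).sub (tendsto_truncCauchy (m + 2) ht)).const_mul
    (1 / 2)).sub (hFv t ht).tendsto_sub_mul_log).const_mul (1 / ((m + 1 : ℕ) : ℝ))
  have e : 1 / ((m + 1 : ℕ) : ℝ) * (1 / 2 * (π * chU ((m : ℤ) - 1) t -
      π * chU (((m + 2 : ℕ) : ℤ) - 1) t) - 0) = -(π / (m + 1 : ℕ)) * chT (m + 1 : ℕ) t := by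
    have := two_mul_chT ((m + 1 : ℕ) : ℤ) t
    rw [show ((m + 1 : ℕ) : ℤ) - 2 = (m : ℤ) - 1 by push_cast; ring] at this
    rw [show ((m + 2 : ℕ) : ℤ) - 1 = ((m + 1 : ℕ) : ℤ) by push_cast; ring, sub_zero]
    field_simp
    linear_combination this
  rw [e] at hlim2
  refine hlim2.congr' ?_
  filter_upwards [eventually_small ht] with ε hε
  have i0 := fun k : ℤ => integrableOn_truncSet_div (integrableOn_chT_div_weight k) (t := t) hε.1
  -- By `w U_{n-1} = (T_{n-1} - T_{n+1}) / (2w)` the integral left after integration by parts is a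
  -- difference of two known Cauchy integrals.
  have eF : ∀ τ ∈ truncSet t ε, 1 / 2 * (chT m τ / √(1 - τ ^ 2) / (τ - t) -
      chT (m + 2 : ℕ) τ / √(1 - τ ^ 2) / (τ - t)) = (τ - t)⁻¹ * F τ := by
    intro τ hτ
    have hd := ne_of_mem_truncSet hε.1 hτ
    have hw : 0 < √(1 - τ ^ 2) := Real.sqrt_pos.2 (one_sub_sq_pos hτ.1)
    have hsq := Real.sq_sqrt (one_sub_sq_pos hτ.1).le
    have h1 := two_mul_one_sub_sq_mul_chU ((m + 1 : ℕ) : ℤ) τ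
    rw [show ((m + 1 : ℕ) : ℤ) - 1 = (m : ℤ) by push_cast; ring,
      show ((m + 1 : ℕ) : ℤ) + 1 = ((m + 2 : ℕ) : ℤ) by push_cast; ring, ← hsq] at h1
    rw [hF, show ((m + 1 : ℕ) : ℤ) - 1 = (m : ℤ) by push_cast; ring]
    field_simp
    linear_combination -h1
  have i2 : IntegrableOn (fun τ => (τ - t)⁻¹ * F τ) (truncSet t ε) :=
    IntegrableOn.congr_fun (((i0 m).sub (i0 (m + 2 : ℕ))).const_mul (1 / 2)) eF
      (measurableSet_truncSet t ε)
  have hp := integral_truncSet_by_parts (F := F) (K := fun τ => Real.log (τ - t))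
    (K' := fun τ => (τ - t)⁻¹) hε.1 hε.2.1 hε.2.2 (by fun_prop) hFv (by simp [hF]) (by simp [hF])
    (fun τ hτ => by
      simpa using ((hasDerivAt_id τ).sub_const t).log (sub_ne_zero.2 hτ))
    (IntegrableOn.congr_fun (((integrableOn_log_mul_chT (m + 1 : ℕ) t).mono_set
      (truncSet_subset t ε)).const_mul (-((m + 1 : ℕ) : ℝ))) (fun τ _ => by
        rw [abs_sub_comm, Real.log_abs]
        ring) (measurableSet_truncSet t ε)) i2
  have e1 : ∫ τ in truncSet t ε, (τ - t)⁻¹ * F τ =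
      1 / 2 * (truncCauchy m t ε - truncCauchy (m + 2 : ℕ) t ε) := by
    rw [truncCauchy, truncCauchy, ← integral_sub (i0 _) (i0 _), ← integral_const_mul]
    exact (setIntegral_congr_fun (measurableSet_truncSet t ε) eF).symm
  have e2 : ∫ τ in truncSet t ε, Real.log (τ - t) * (-((m + 1 : ℕ) : ℝ) * chT (m + 1 : ℕ) τ /
      √(1 - τ ^ 2)) = -((m + 1 : ℕ) : ℝ) *
      ∫ τ in truncSet t ε, Real.log |t - τ| * (chT (m + 1 : ℕ) τ / √(1 - τ ^ 2)) := by
    rw [← integral_const_mul]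
    refine setIntegral_congr_fun (measurableSet_truncSet t ε) fun τ _ => ?_
    rw [abs_sub_comm, Real.log_abs]
    ring
  rw [e1, e2, show t - ε - t = -ε by ring, show t + ε - t = ε by ring, Real.log_neg_eq_log] at hp
  rw [hp]
  field_simp
  ring

/-- The logarithmic potential of `T_n / w` has eigenvalue `d_n`. -/
theorem integral_logKernel_mul_chT (n : ℕ) {t : ℝ} (ht : t ∈ Ioo (-1 : ℝ) 1) :
    ∫ τ in Ioo (-1) 1, -1 / (2 * π) * Real.log |t - τ| * (chT n τ / √(1 - τ ^ 2)) =
      dEig n * chT n t := by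
  have hpi := Real.pi_pos.ne'
  simp only [mul_assoc]
  rw [integral_const_mul]
  rcases n with _ | n
  · have := integral_weight_log ht
    simp only [smul_eq_mul] at this
    have e : ∀ τ : ℝ, Real.log |t - τ| * (chT (0 : ℕ) τ / √(1 - τ ^ 2)) =
        (√(1 - τ ^ 2))⁻¹ * Real.log |t - τ| := fun τ => by
      rw [Nat.cast_zero, chT_zero]; ring
    simp only [e, this]
    rw [Nat.cast_zero, chT_zero, dEig, if_pos rfl]
    field_simp
  · rw [integral_log_mul_chT (Nat.succ_ne_zero n) ht, dEig_succ]
    push_cast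
    field_simp

/-- The polynomial `V_{2,0} T_n`. -/
noncomputable def chQ (n : ℕ) (t : ℝ) : ℝ := eEig n * chT n t -
  ∑ j ∈ (Finset.range n).filter (fun j => j % 2 = n % 2), (if j = 0 then 1 / 2 else 1) * chT j t

/-- The identity `2 T_j = U_j - U_{j-2}` telescopes in steps of two. At `j = 0` the factor `1/2`
fits `T_0 = U_0`. -/
theorem sum_chT_eq_chU (n : ℕ) (t : ℝ) :
    ∑ j ∈ (Finset.range (n + 1)).filter (fun j => j % 2 = (n + 1) % 2),
      (if j = 0 then 1 / 2 else 1) * chT j t = 1 / 2 * chU ((n : ℤ) - 1) t := by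
  induction n using Nat.twoStepInduction with
  | zero =>
    rw [show (Finset.range (0 + 1)).filter (fun j => j % 2 = (0 + 1) % 2) = ∅ by decide]
    simp [chU_neg_one]
  | one =>
    rw [show (Finset.range (1 + 1)).filter (fun j => j % 2 = (1 + 1) % 2) = {0} by decide]
    simp [chU_zero, chT_zero]
  | more n ih1 _ =>
    have : (Finset.range (n + 2 + 1)).filter (fun j => j % 2 = (n + 2 + 1) % 2) =
        insert (n + 1) ((Finset.range (n + 1)).filter (fun j => j % 2 = (n + 1) % 2)) := by
      ext j
      simp only [Finset.mem_filter, Finset.mem_range, Finset.mem_insert]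
      omega
    rw [this, Finset.sum_insert (by simp), ih1, if_neg (by omega)]
    have h := two_mul_chT ((n + 1 : ℕ) : ℤ) t
    rw [show ((n + 1 : ℕ) : ℤ) - 2 = (n : ℤ) - 1 by push_cast; ring] at h
    rw [show ((n + 2 : ℕ) : ℤ) - 1 = ((n + 1 : ℕ) : ℤ) by push_cast; ring]
    linarith

theorem chQ_zero (t : ℝ) : chQ 0 t = -(1 / 2) := by
  simp [chQ, eEig, chT_zero]; norm_num

theorem chQ_succ (n : ℕ) (t : ℝ) : chQ (n + 1) t =
    -(1 / 4) * ((n + 2) * chU (n + 1) t - n * chU ((n : ℤ) - 1) t) := by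
  have h := two_mul_chT ((n + 1 : ℕ) : ℤ) t
  rw [show ((n + 1 : ℕ) : ℤ) - 2 = (n : ℤ) - 1 by push_cast; ring] at h
  rw [chQ, sum_chT_eq_chU, eEig]
  push_cast at h ⊢
  linear_combination (-((n : ℝ) + 2) / 4) * h

/-- The finite part of the integral of `w T_n / (τ - t)²`. -/
theorem tendsto_finitePart_chT (n : ℕ) {t : ℝ} (ht : t ∈ Ioo (-1 : ℝ) 1) :
    Tendsto (fun ε => (∫ τ in truncSet t ε, ((τ - t) ^ 2)⁻¹ * (√(1 - τ ^ 2) * chT n τ)) -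
      2 * (√(1 - t ^ 2) * chT n t) / ε) (𝓝[>] 0) (𝓝 (2 * π * chQ n t)) := by
  set F : ℝ → ℝ := fun τ => √(1 - τ ^ 2) * chT n τ with hF
  set v : ℝ → ℝ := fun τ =>
    -(1 / 2) * ((n + 1) * chT (n + 1) τ - (n - 1) * chT (n - 1) τ) / √(1 - τ ^ 2) with hv
  have hFv : ∀ τ ∈ Ioo (-1 : ℝ) 1, HasDerivAt F (v τ) τ := fun τ hτ =>
    (hasDerivAt_weight_mul_chT (n : ℤ) hτ).congr_deriv (by simp [hv])
  -- Integration by parts replaces the kernel by a Cauchy kernel acting on `(w T_n)'`, a combination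
  -- of `T_{n+1} / w` and `T_{n-1} / w`.
  have hc : Tendsto (fun ε => -(1 / 2) * (((n : ℝ) + 1) * truncCauchy (n + 1) t ε -
      (n - 1) * truncCauchy (n - 1) t ε)) (𝓝[>] 0) (𝓝 (2 * π * chQ n t)) := by
    have h1 := (tendsto_truncCauchy (n + 1) ht).const_mul ((n : ℝ) + 1)
    -- At `n = 0` the index `n - 1` is negative, and `T_{-1} = T_1` is used.
    rcases n with _ | n
    · have h2 := (h1.add (tendsto_truncCauchy 1 ht)).const_mul (-(1 / 2))
      simp only [Nat.cast_zero, zero_add, one_mul, Nat.cast_one, sub_self, chU_zero, zero_sub,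
        mul_one] at h2 ⊢
      rw [chQ_zero]
      rw [show 2 * π * -(1 / 2) = -(1 / 2) * (π + π) by ring]
      refine h2.congr fun ε => ?_
      have : truncCauchy (-1) t ε = truncCauchy 1 t ε := by simp only [truncCauchy, chT_neg]
      rw [this]
      ring
    · have h2 := (h1.sub ((tendsto_truncCauchy n ht).const_mul (n : ℝ))).const_mul (-(1 / 2))
      rw [chQ_succ]
      have e : -(1 / 2) * ((((n + 1 : ℕ) : ℝ) + 1) * (π * chU (((n + 1 + 1 : ℕ) : ℤ) - 1) t) -
          n * (π * chU ((n : ℤ) - 1) t)) =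
          2 * π * (-(1 / 4) * ((n + 2) * chU (n + 1) t - n * chU ((n : ℤ) - 1) t)) := by
        rw [show ((n + 1 + 1 : ℕ) : ℤ) - 1 = (n : ℤ) + 1 by push_cast; ring]
        push_cast
        ring
      rw [e] at h2
      refine h2.congr fun ε => ?_
      rw [show ((n + 1 : ℕ) : ℤ) - 1 = (n : ℤ) by push_cast; ring]
      push_cast
      ring
  have hlim := hc.add (hFv t ht).tendsto_add_div_sub
  rw [add_zero] at hlim
  refine hlim.congr' ?_
  filter_upwards [eventually_small ht] with ε hε
  have i0 := fun k : ℤ => integrableOn_truncSet_div (integrableOn_chT_div_weight k) (t := t) hε.1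
  have ev : ∀ τ ∈ truncSet t ε, (1 / 2) * (((n : ℝ) + 1) * (chT (n + 1) τ / √(1 - τ ^ 2) / (τ - t)) -
      (n - 1) * (chT (n - 1) τ / √(1 - τ ^ 2) / (τ - t))) = -(τ - t)⁻¹ * v τ := by
    intro τ hτ
    have hd := ne_of_mem_truncSet hε.1 hτ
    have hw : 0 < √(1 - τ ^ 2) := Real.sqrt_pos.2 (one_sub_sq_pos hτ.1)
    rw [hv]
    field_simp
  have i1 : IntegrableOn (fun τ => -(τ - t)⁻¹ * v τ) (truncSet t ε) :=
    IntegrableOn.congr_fun ((((i0 (n + 1)).const_mul ((n : ℝ) + 1)).sub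
      ((i0 (n - 1)).const_mul ((n : ℝ) - 1))).const_mul (1 / 2)) ev (measurableSet_truncSet t ε)
  have i2 : IntegrableOn (fun τ => ((τ - t) ^ 2)⁻¹ * F τ) (truncSet t ε) := by
    have hFc : Continuous F := by fun_prop
    have hFi : IntegrableOn F (Ioo (-1) 1) := hFc.integrableOn_Icc.mono_set Ioo_subset_Icc_self
    refine integrableOn_truncSet_smul hFi (by fun_prop) (C := (ε ^ 2)⁻¹) fun τ hτ => ?_
    rw [abs_inv, abs_pow, abs_sub_comm]
    have h1 := hτ.2
    have h0 := hε.1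
    gcongr
  have hp := integral_truncSet_by_parts (F := F) (K := fun τ => -(τ - t)⁻¹)
    (K' := fun τ => ((τ - t) ^ 2)⁻¹) hε.1 hε.2.1 hε.2.2 (by fun_prop) hFv (by simp [hF])
    (by simp [hF]) (fun τ hτ => by
      have hd : τ - t ≠ 0 := sub_ne_zero.2 hτ
      have := (((hasDerivAt_id τ).sub_const t).inv hd).neg
      refine this.congr_deriv ?_
      simp [neg_div]) i1 i2
  have e1 : ∫ τ in truncSet t ε, -(τ - t)⁻¹ * v τ = (1 / 2) * (((n : ℝ) + 1) *
      truncCauchy (n + 1) t ε - (n - 1) * truncCauchy (n - 1) t ε) := by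
    rw [truncCauchy, truncCauchy, ← integral_const_mul, ← integral_const_mul,
      ← integral_sub ((i0 _).const_mul _) ((i0 _).const_mul _), ← integral_const_mul]
    exact (setIntegral_congr_fun (measurableSet_truncSet t ε) ev).symm
  have h0 := hε.1.ne'
  rw [hp, e1, show t - ε - t = -ε by ring, show t + ε - t = ε by ring]
  field_simp
  ring

/-! ### Functions as elements of `W^s`: linearity, multiplication by the variable, series. -/

theorem chebTFun_eq (n : ℕ) (t : ℝ) : chebTFun n t = (chT n t : ℂ) := rfl

theorem chebWeight_eq (t : ℝ) : chebWeight t = (√(1 - t ^ 2) : ℂ) := rfl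

theorem continuous_chebTFun (n : ℕ) : Continuous (chebTFun n) :=
  Complex.continuous_ofReal.comp (continuous_chT n)

theorem continuous_chebWeight : Continuous chebWeight :=
  Complex.continuous_ofReal.comp (by fun_prop)

theorem chebWeight_ne_zero {t : ℝ} (ht : t ∈ Ioo (-1 : ℝ) 1) : chebWeight t ≠ 0 := by
  rw [chebWeight_eq]
  exact_mod_cast (Real.sqrt_pos.2 (one_sub_sq_pos ht)).ne'

theorem chebWeight_sq {t : ℝ} (ht : t ∈ Ioo (-1 : ℝ) 1) :
    chebWeight t ^ 2 = 1 - (t : ℂ) ^ 2 := by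
  rw [chebWeight_eq, ← Complex.ofReal_pow, Real.sq_sqrt (one_sub_sq_pos ht).le]
  push_cast
  rfl

theorem norm_chebTFun_le (n : ℕ) {t : ℝ} (ht : t ∈ Ioo (-1 : ℝ) 1) : ‖chebTFun n t‖ ≤ 1 := by
  rw [chebTFun_eq, Complex.norm_real]
  exact abs_chT_le n ht

theorem mul_chebTFun_zero (t : ℝ) : (t : ℂ) * chebTFun 0 t = chebTFun 1 t := by
  simp [chebTFun_eq, chT_zero, chT_one]

theorem mul_chebTFun_succ (n : ℕ) (t : ℝ) :
    (t : ℂ) * chebTFun (n + 1) t = 1 / 2 * chebTFun (n + 2) t + 1 / 2 * chebTFun n t := by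
  have := congrArg (fun x : ℝ => (x : ℂ)) (chT_add_two n t)
  simp only [chebTFun_eq]
  push_cast at this ⊢
  rw [this]
  ring

/-- The integral of `f T_n / w`. -/
noncomputable def chebInt (f : ℝ → ℂ) (n : ℕ) : ℂ :=
  ∫ t in Ioo (-1) 1, chebTFun n t * (f t / chebWeight t)

theorem represents_iff {s : ℝ} {u : ChebW s} {f : ℝ → ℂ} :
    Represents u f ↔ IntegrableOn (fun t => f t / chebWeight t) (Ioo (-1) 1) ∧
      ∀ n, u.coeff n = ((if n = 0 then 1 else 2 : ℝ) / π : ℝ) * chebInt f n := by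
  have : ∀ n, ∫ t in (-1 : ℝ)..1, f t * chebTFun n t / chebWeight t = chebInt f n := fun n => by
    rw [integral_neg_one_one, chebInt]
    congr 1
    ext t
    ring
  unfold Represents
  rw [intervalIntegrable_iff_integrableOn_Ioo_neg_one_one]
  simp only [this]

theorem integrableOn_chebTFun_mul {f : ℝ → ℂ} (hf : IntegrableOn f (Ioo (-1) 1)) (n : ℕ) :
    IntegrableOn (fun t => chebTFun n t * f t) (Ioo (-1) 1) := by
  refine Integrable.bdd_mul (c := 1) hf (continuous_chebTFun n).aestronglyMeasurable ?_
  filter_upwards [ae_restrict_mem measurableSet_Ioo] with t ht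
  exact norm_chebTFun_le n ht

theorem Represents.unique {s : ℝ} {u v : ChebW s} {f g : ℝ → ℂ} (hu : Represents u f)
    (hv : Represents v g) (h : ∀ t ∈ Ioo (-1 : ℝ) 1, f t = g t) : u = v := by
  rw [represents_iff] at hu hv
  refine ChebW.ext_coeff fun n => ?_
  rw [hu.2, hv.2]
  congr 1
  refine setIntegral_congr_fun measurableSet_Ioo fun t ht => ?_
  simp only [h t ht]

theorem Represents.congr {s : ℝ} {u : ChebW s} {f g : ℝ → ℂ} (hu : Represents u f)
    (h : ∀ t ∈ Ioo (-1 : ℝ) 1, f t = g t) : Represents u g := by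
  rw [represents_iff] at hu ⊢
  refine ⟨hu.1.congr_fun (fun t ht => by simp only [h t ht]) measurableSet_Ioo, fun n => ?_⟩
  rw [hu.2]
  congr 1
  refine setIntegral_congr_fun measurableSet_Ioo fun t ht => ?_
  simp only [h t ht]

theorem Represents.add {s : ℝ} {u v : ChebW s} {f g : ℝ → ℂ} (hu : Represents u f)
    (hv : Represents v g) : Represents (u + v) (fun t => f t + g t) := by
  rw [represents_iff] at *
  simp only [add_div]
  refine ⟨hu.1.add hv.1, fun n => ?_⟩
  rw [ChebW.coeff_add, hu.2, hv.2, ← mul_add, chebInt, chebInt, chebInt,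
    ← integral_add (integrableOn_chebTFun_mul hu.1 n) (integrableOn_chebTFun_mul hv.1 n)]
  simp only [add_div, mul_add]

theorem Represents.smul {s : ℝ} {u : ChebW s} {f : ℝ → ℂ} (hu : Represents u f) (c : ℂ) :
    Represents (c • u) (fun t => c * f t) := by
  rw [represents_iff] at *
  simp only [mul_div_assoc]
  refine ⟨hu.1.const_mul c, fun n => ?_⟩
  rw [ChebW.coeff_smul, hu.2, mul_left_comm, chebInt, chebInt, ← integral_const_mul]
  congr 2
  ext t
  ring

theorem Represents.sub {s : ℝ} {u v : ChebW s} {f g : ℝ → ℂ} (hu : Represents u f)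
    (hv : Represents v g) : Represents (u - v) (fun t => f t - g t) := by
  have := hu.add (hv.smul (-1))
  rw [neg_one_smul, ← sub_eq_add_neg] at this
  exact this.congr fun t _ => by ring

theorem Represents.zero {s : ℝ} : Represents (0 : ChebW s) (fun _ => 0) := by
  rw [represents_iff]
  simp [chebInt]

theorem Represents.sum {s : ℝ} {ι : Type*} {F : Finset ι} {u : ι → ChebW s} {f : ι → ℝ → ℂ}
    (h : ∀ i ∈ F, Represents (u i) (f i)) : Represents (∑ i ∈ F, u i) (fun t => ∑ i ∈ F, f i t) := by
  classical
  induction F using Finset.induction_on with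
  | empty => simpa using Represents.zero
  | insert i F hi ih =>
    simp only [Finset.sum_insert hi]
    exact (h i (by simp)).add (ih fun j hj => h j (by simp [hj]))

theorem integrableOn_chebTFun_div (n : ℕ) :
    IntegrableOn (fun t => chebTFun n t / chebWeight t) (Ioo (-1) 1) := by
  have := (integrableOn_chT_div_weight n).ofReal (𝕜 := ℂ)
  refine Integrable.congr this (Eventually.of_forall fun t => ?_)
  beta_reduce
  rw [chebTFun_eq, chebWeight_eq, ← Complex.ofReal_div]
  rfl

theorem chebInt_chebTFun (n m : ℕ) :
    chebInt (chebTFun n) m = (if m = n then (if m = 0 then π else π / 2) else 0 : ℝ) := by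
  have h : chebInt (chebTFun n) m =
      ((∫ t in Ioo (-1) 1, 1 / 2 * (chT (m + n) t / √(1 - t ^ 2)) +
        1 / 2 * (chT (m - n) t / √(1 - t ^ 2)) : ℝ) : ℂ) := by
    rw [chebInt, ← integral_complex_ofReal]
    congr 1
    ext t
    have := congrArg (Polynomial.eval t) (Polynomial.Chebyshev.T_mul_T ℝ (m : ℤ) (n : ℤ))
    have h2 : 2 * chT m t * chT n t = chT (m + n) t + chT (m - n) t := by simpa [chT] using this
    rw [chebTFun_eq, chebTFun_eq, chebWeight_eq]
    have h3 : chT m t * (chT n t / √(1 - t ^ 2)) = 1 / 2 * (chT (m + n) t / √(1 - t ^ 2)) +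
        1 / 2 * (chT (m - n) t / √(1 - t ^ 2)) := by
      linear_combination (1 / 2 / √(1 - t ^ 2)) * h2
    rw [← h3]
    push_cast
    rfl
  rw [h, integral_add ((integrableOn_chT_div_weight _).const_mul _)
    ((integrableOn_chT_div_weight _).const_mul _), integral_const_mul, integral_const_mul]
  congr 1
  split_ifs with h1 h2
  · subst h1; subst h2
    simp only [Nat.cast_zero, add_zero, sub_zero, integral_chT_div_weight_zero]
    ring
  · subst h1
    rw [sub_self, integral_chT_div_weight_zero, integral_chT_div_weight_of_ne (by omega)]
    ring
  · rw [integral_chT_div_weight_of_ne (by omega), integral_chT_div_weight_of_ne (by omega)]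
    ring

theorem represents_chebT (s : ℝ) (n : ℕ) : Represents (ChebW.chebT s n) (chebTFun n) := by
  rw [represents_iff]
  refine ⟨integrableOn_chebTFun_div n, fun m => ?_⟩
  rw [chebInt_chebTFun, ChebW.coeff_chebT, ← Complex.ofReal_mul]
  have := Real.pi_pos.ne'
  split_ifs <;> simp [this]

theorem chebInt_mul_id_zero (f : ℝ → ℂ) :
    chebInt (fun t => t * f t) 0 = chebInt f 1 := by
  rw [chebInt, chebInt]
  congr 1
  ext t
  rw [← mul_chebTFun_zero]
  ring

theorem chebInt_mul_id_succ {f : ℝ → ℂ}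
    (hf : IntegrableOn (fun t => f t / chebWeight t) (Ioo (-1) 1)) (n : ℕ) :
    chebInt (fun t => t * f t) (n + 1) = 1 / 2 * chebInt f (n + 2) + 1 / 2 * chebInt f n := by
  rw [chebInt, chebInt, chebInt, ← integral_const_mul, ← integral_const_mul,
    ← integral_add ((integrableOn_chebTFun_mul hf _).const_mul _)
      ((integrableOn_chebTFun_mul hf _).const_mul _)]
  congr 1
  ext t
  linear_combination (f t / chebWeight t) * mul_chebTFun_succ n t

/-- Multiplying `f` by `t` may be moved onto `T_n`, where the three term recurrence applies. The
case distinctions at low index come from the normalization `2 - δ_{0n}` of the coefficients. -/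
theorem Represents.mulX {s : ℝ} {u : ChebW s} {f : ℝ → ℂ} (hu : Represents u f) :
    Represents (ChebW.mulX s u) (fun t => t * f t) := by
  rw [represents_iff] at *
  refine ⟨?_, fun n => ?_⟩
  · refine (integrableOn_chebTFun_mul hu.1 1).congr_fun (fun t _ => ?_) measurableSet_Ioo
    simp only [chebTFun_eq, Nat.cast_one, chT_one]
    ring
  · rcases n with _ | n
    · rw [ChebW.coeff_mulX_zero, chebInt_mul_id_zero, hu.2]
      simp only [one_ne_zero, if_false, if_true]
      push_cast
      ring
    · rw [ChebW.coeff_mulX_succ, chebInt_mul_id_succ hu.1, hu.2, hu.2]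
      rcases n with _ | n
      · simp
        ring
      · simp only [Nat.succ_ne_zero, if_false, show n + 1 + 2 ≠ 0 by omega]
        push_cast
        ring

theorem integral_norm_div_weight_le {f : ℝ → ℂ} {C : ℝ} (hf : ∀ t ∈ Ioo (-1 : ℝ) 1, ‖f t‖ ≤ C) :
    ∫ t in Ioo (-1) 1, ‖f t / chebWeight t‖ ≤ C * π := by
  have h0 : ∫ t in Ioo (-1) 1, C * (chT 0 t / √(1 - t ^ 2)) = C * π := by
    rw [integral_const_mul, integral_chT_div_weight_zero]
  rw [← h0]
  refine integral_mono_of_nonneg (Eventually.of_forall fun t => norm_nonneg _)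
    ((integrableOn_chT_div_weight 0).const_mul C) ?_
  filter_upwards [ae_restrict_mem measurableSet_Ioo] with t ht
  rw [norm_div, chebWeight_eq, Complex.norm_real, Real.norm_of_nonneg (Real.sqrt_nonneg _), chT_zero,
    mul_one_div]
  gcongr
  exact hf t ht

/-- Uniformly convergent series of functions represent convergent series in `W^s`. -/
theorem Represents.hasSum {s : ℝ} {u : ℕ → ChebW s} {f : ℕ → ℝ → ℂ} {C : ℕ → ℝ}
    (h : ∀ p, Represents (u p) (f p)) (hb : ∀ p, ∀ t ∈ Ioo (-1 : ℝ) 1, ‖f p t‖ ≤ C p)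
    (hC : Summable C) {U : ChebW s} (hU : HasSum u U) : Represents U (fun t => ∑' p, f p t) := by
  have h' := fun p => represents_iff.1 (h p)
  rw [represents_iff]
  have hmeas : AEStronglyMeasurable (fun t => (∑' p, f p t) / chebWeight t)
      (volume.restrict (Ioo (-1) 1)) := by
    refine aestronglyMeasurable_of_tendsto_ae atTop
      (f := fun N t => ∑ p ∈ Finset.range N, f p t / chebWeight t) (fun N => ?_) ?_
    · exact Finset.aestronglyMeasurable_fun_sum _ fun p _ => (h' p).1.aestronglyMeasurable
    · filter_upwards [ae_restrict_mem measurableSet_Ioo] with t ht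
      have hs : Summable fun p => f p t :=
        Summable.of_norm (Summable.of_nonneg_of_le (fun _ => norm_nonneg _) (fun p => hb p t ht) hC)
      exact (hs.hasSum.div_const _).tendsto_sum_nat
  refine ⟨?_, fun n => ?_⟩
  · refine Integrable.mono' ((integrableOn_chT_div_weight 0).const_mul (∑' p, C p)) hmeas ?_
    filter_upwards [ae_restrict_mem measurableSet_Ioo] with t ht
    have hs : Summable fun p => ‖f p t‖ :=
      Summable.of_nonneg_of_le (fun _ => norm_nonneg _) (fun p => hb p t ht) hC
    rw [norm_div, chebWeight_eq, Complex.norm_real, Real.norm_of_nonneg (Real.sqrt_nonneg _),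
      chT_zero, mul_one_div]
    gcongr
    exact (norm_tsum_le_tsum_norm hs).trans (hs.tsum_le_tsum (fun p => hb p t ht) hC)
  · have h1 : HasSum (fun p => chebInt (f p) n)
        (∫ t in Ioo (-1) 1, ∑' p, chebTFun n t * (f p t / chebWeight t)) := by
      refine hasSum_integral_of_summable_integral_norm
        (fun p => integrableOn_chebTFun_mul (h' p).1 n) ?_
      refine Summable.of_nonneg_of_le (fun p => integral_nonneg fun t => norm_nonneg _) (fun p => ?_)
        (hC.mul_right π)
      refine le_trans (le_of_eq ?_) (integral_norm_div_weight_le (f := fun t => chebTFun n t * f p t)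
        (C := C p) fun t ht => ?_)
      · simp only [mul_div_assoc]
      · rw [norm_mul]
        have := norm_chebTFun_le n ht
        nlinarith [hb p t ht, norm_nonneg (f p t)]
    have h2 : ∫ t in Ioo (-1) 1, ∑' p, chebTFun n t * (f p t / chebWeight t) =
        chebInt (fun t => ∑' p, f p t) n := by
      rw [chebInt]
      congr 1
      ext t
      rw [tsum_mul_left, tsum_div_const]
    rw [h2] at h1
    have h3 := h1.mul_left (((if n = 0 then 1 else 2 : ℝ) / π : ℝ) : ℂ)
    have h4 : HasSum (fun p => (u p).coeff n) (U.coeff n) := hU.mapL (ChebW.coeffCLM s n)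
    exact h4.unique (by simpa only [(h' _).2] using h3)

/-! ### The integral operators determine the bounded operators. -/

section Uniqueness

theorem IsLogPotential.eqOn {v g g' : ℝ → ℂ} (h : IsLogPotential v g) (h' : IsLogPotential v g') :
    ∀ t ∈ Ioo (-1 : ℝ) 1, g t = g' t := fun t ht => by rw [(h t ht).2, (h' t ht).2]

theorem IsV1.eqOn {k : ℝ} {u g g' : ℝ → ℂ} (h : IsV1 k u g) (h' : IsV1 k u g') :
    ∀ t ∈ Ioo (-1 : ℝ) 1, g t = g' t := fun t ht => by rw [(h t ht).2, (h' t ht).2]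

theorem IsV1Principal.eqOn {u g g' : ℝ → ℂ} (h : IsV1Principal u g) (h' : IsV1Principal u g') :
    ∀ t ∈ Ioo (-1 : ℝ) 1, g t = g' t := IsLogPotential.eqOn h h'

/-- The difference of two admissible divergent parts is a multiple of `1/ε` with a finite limit;
multiplying by `ε` shows that the multiple is zero. -/
theorem IsFinitePart.unique {F : ℝ → ℂ} {c c' : ℂ} (h : IsFinitePart F c) (h' : IsFinitePart F c') :
    c = c' := by
  obtain ⟨a, ha⟩ := h
  obtain ⟨a', ha'⟩ := h'
  have h1 : Tendsto (fun ε : ℝ => (a' - a) / (ε : ℂ)) (𝓝[>] 0) (𝓝 (c - c')) :=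
    (ha.sub ha').congr fun ε => by ring
  have h2 : Tendsto (fun ε : ℝ => (ε : ℂ)) (𝓝[>] 0) (𝓝 0) := by
    have : Tendsto (fun ε : ℝ => (ε : ℂ)) (𝓝 0) (𝓝 ((0 : ℝ) : ℂ)) :=
      Complex.continuous_ofReal.tendsto 0
    exact this.mono_left nhdsWithin_le_nhds
  have h3 := h1.mul h2
  rw [mul_zero] at h3
  have h4 : Tendsto (fun _ : ℝ => a' - a) (𝓝[>] 0) (𝓝 0) := by
    refine h3.congr' ?_
    filter_upwards [self_mem_nhdsWithin] with ε hε
    have : (ε : ℂ) ≠ 0 := by exact_mod_cast ne_of_gt hε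
    field_simp
  have h5 : a' - a = 0 := tendsto_nhds_unique tendsto_const_nhds h4
  rw [h5] at h1
  simp only [zero_div] at h1
  exact sub_eq_zero.1 (tendsto_nhds_unique h1 tendsto_const_nhds)

theorem IsV2.eqOn {k : ℝ} {u g g' : ℝ → ℂ} (h : IsV2 k u g) (h' : IsV2 k u g') :
    ∀ t ∈ Ioo (-1 : ℝ) 1, g t = g' t := fun t ht => (h t ht).2.unique (h' t ht).2

theorem IsV2Principal.eqOn {u g g' : ℝ → ℂ} (h : IsV2Principal u g) (h' : IsV2Principal u g') :
    ∀ t ∈ Ioo (-1 : ℝ) 1, g t = g' t := by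
  obtain ⟨v, p, hv, hp, hg⟩ := h
  obtain ⟨v', p', hv', hp', hg'⟩ := h'
  have hvv : ∀ τ ∈ Ioo (-1 : ℝ) 1, v τ = v' τ := fun τ hτ => (hv τ hτ).unique (hv' τ hτ)
  have hpp : ∀ t ∈ Ioo (-1 : ℝ) 1, p t = p' t := fun t ht => by
    rw [(hp t ht).2, (hp' t ht).2, integral_neg_one_one, integral_neg_one_one]
    refine setIntegral_congr_fun measurableSet_Ioo fun τ hτ => ?_
    simp only [hvv τ hτ]
  intro t ht
  refine (hg t ht).unique ((hg' t ht).congr_of_eventuallyEq ?_)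
  filter_upwards [Ioo_mem_nhds ht.1 ht.2] with x hx
  exact hpp x hx

/-- A bounded operator is determined by the integral operator that it realizes. -/
theorem Realizes.unique {s r : ℝ} {A B : ChebW s →L[ℂ] ChebW r} {R : (ℝ → ℂ) → (ℝ → ℂ) → Prop}
    (hR : ∀ u g g', R u g → R u g' → ∀ t ∈ Ioo (-1 : ℝ) 1, g t = g' t)
    (hA : Realizes A R) (hB : Realizes B R) : A = B := by
  refine ChebW.clm_ext fun n => ?_
  obtain ⟨g, h1, h2⟩ := hA n
  obtain ⟨g', h1', h2'⟩ := hB n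
  exact h2.unique h2' (hR _ _ _ h1 h1')

end Uniqueness

/-! ### The model operators realize the principal parts. -/

section Principal

theorem integrableOn_logKernel_chT (n : ℤ) (t : ℝ) :
    IntegrableOn (fun τ => ((-1 / (2 * π) * Real.log |t - τ| : ℝ) : ℂ) *
      ((chT n τ / √(1 - τ ^ 2) : ℝ) : ℂ)) (Ioo (-1) 1) := by
  have := ((integrableOn_log_mul_chT n t).const_mul (-1 / (2 * π))).ofReal (𝕜 := ℂ)
  refine this.congr (Eventually.of_forall fun τ => ?_)
  beta_reduce
  rw [← Complex.ofReal_mul, mul_assoc]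
  rfl

theorem integral_logKernel_chT (n : ℕ) {t : ℝ} (ht : t ∈ Ioo (-1 : ℝ) 1) :
    ∫ τ in Ioo (-1) 1, ((-1 / (2 * π) * Real.log |t - τ| : ℝ) : ℂ) *
      ((chT n τ / √(1 - τ ^ 2) : ℝ) : ℂ) = ((dEig n * chT n t : ℝ) : ℂ) := by
  rw [← integral_logKernel_mul_chT n ht, ← integral_complex_ofReal]
  congr 1
  ext τ
  push_cast
  rfl

theorem isV1Principal_chebTFun (n : ℕ) :
    IsV1Principal (chebTFun n) (fun t => (dEig n : ℂ) * chebTFun n t) := by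
  intro t ht
  have e : ∀ τ, chebTFun n τ / chebWeight τ = ((chT n τ / √(1 - τ ^ 2) : ℝ) : ℂ) := fun τ => by
    rw [chebTFun_eq, chebWeight_eq]; push_cast; rfl
  simp only [e]
  rw [intervalIntegrable_iff_integrableOn_Ioo_neg_one_one, integral_neg_one_one,
    integral_logKernel_chT n ht]
  refine ⟨integrableOn_logKernel_chT n t, ?_⟩
  rw [chebTFun_eq]
  push_cast
  rfl

theorem realizes_logOp (s : ℝ) : Realizes (ChebW.logOp s) IsV1Principal := fun n =>
  ⟨_, isV1Principal_chebTFun n, by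
    rw [ChebW.logOp_chebT]
    exact (represents_chebT _ n).smul _⟩

theorem represents_hyperOp_chebT {s : ℝ} (hs : -1 / 2 < s) (n : ℕ) :
    Represents (ChebW.hyperOp s hs (ChebW.chebT (s + 1) n)) (fun t => (chQ n t : ℂ)) := by
  rw [ChebW.hyperOp_chebT]
  refine (((represents_chebT s n).smul (eEig n : ℂ)).sub (Represents.sum fun j _ =>
    (represents_chebT s j).smul (if j = 0 then 1 / 2 else 1 : ℂ))).congr fun t _ => ?_
  rw [chQ]
  push_cast
  congr 1
  refine Finset.sum_congr rfl fun j _ => ?_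
  split_ifs <;> simp [chebTFun_eq]

/-- The antiderivative of `V_{2,0} T_n`. -/
noncomputable def chP (n : ℕ) (t : ℝ) : ℝ :=
  if n = 0 then -(1 / 2) * chT 1 t else
    -(1 / 2) * ((n + 1) * (dEig (n + 1) * chT (n + 1) t) -
      (n - 1) * (dEig (n - 1) * chT ((n - 1 : ℕ) : ℤ) t))

/-- Differentiation gives `T_n' = n U_{n-1}`, and `n d_n = 1/2` for `n > 0` removes the eigenvalues
of the logarithmic potential. -/
theorem hasDerivAt_chP (n : ℕ) (t : ℝ) : HasDerivAt (chP n) (chQ n t) t := by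
  rcases n with _ | n
  · have := (hasDerivAt_chT 1 t).const_mul (-(1 / 2))
    rw [chQ_zero]
    have e : chP 0 = fun t => -(1 / 2) * chT 1 t := by ext; simp [chP]
    rw [e]
    exact this.congr_deriv (by simp [chU_zero])
  · have e : chP (n + 1) = fun t => -(1 / 2) * ((n + 2) * (dEig (n + 2) * chT ((n + 2 : ℕ) : ℤ) t) -
      n * (dEig n * chT n t)) := by
      ext x; simp only [chP, Nat.succ_ne_zero, if_false, Nat.add_sub_cancel]; push_cast; ring_nf
    rw [e]
    have h1 := ((hasDerivAt_chT ((n + 2 : ℕ) : ℤ) t).const_mul (dEig (n + 2))).const_mul ((n : ℝ) + 2)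
    have h2 := ((hasDerivAt_chT (n : ℤ) t).const_mul (dEig n)).const_mul (n : ℝ)
    refine ((h1.sub h2).const_mul (-(1 / 2))).congr_deriv ?_
    rw [chQ_succ, show ((n + 2 : ℕ) : ℤ) - 1 = (n : ℤ) + 1 by push_cast; ring]
    have e1 : dEig (n + 2) * ((n : ℝ) + 2) = 1 / 2 := by
      rw [dEig_succ (n + 1)]; push_cast; field_simp; ring
    have e2 : (n : ℝ) * (dEig n * n) = n * (1 / 2) := by
      rcases n with _ | m
      · simp
      · rw [dEig_succ]; push_cast; field_simp
    push_cast
    linear_combination (-(1 / 2) * (n + 2) * chU (n + 1) t) * e1 + (1 / 2) * chU (n - 1) t * e2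

/-- The function `(w T_n)'` is a combination of `T_{n+1} / w` and `T_{n-1} / w`, so its logarithmic
potential is read off from the eigenvalues `d_{n±1}`. -/
theorem isV2Principal_chebTFun (n : ℕ) :
    IsV2Principal (chebTFun n) (fun t => (chQ n t : ℂ)) := by
  refine ⟨fun τ => ((-(1 / 2) * ((n + 1) * chT (n + 1) τ - (n - 1) * chT (n - 1) τ) /
    √(1 - τ ^ 2) : ℝ) : ℂ), fun t => (chP n t : ℂ), fun τ hτ => ?_, fun t ht => ?_, fun t _ => ?_⟩
  · have := (hasDerivAt_weight_mul_chT n hτ).ofReal_comp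
    simp only [Int.cast_natCast] at this
    refine this.congr_of_eventuallyEq (Eventually.of_forall fun x => ?_)
    simp only [chebTFun_eq, chebWeight_eq]
    push_cast
    rfl
  · rw [intervalIntegrable_iff_integrableOn_Ioo_neg_one_one, integral_neg_one_one]
    have e : ∀ τ, ((-1 / (2 * π) * Real.log |t - τ| : ℝ) : ℂ) *
        ((-(1 / 2) * ((n + 1) * chT (n + 1) τ - (n - 1) * chT (n - 1) τ) / √(1 - τ ^ 2) : ℝ) : ℂ) =
        (-(1 / 2) * ((n : ℂ) + 1)) * (((-1 / (2 * π) * Real.log |t - τ| : ℝ) : ℂ) *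
          ((chT (n + 1) τ / √(1 - τ ^ 2) : ℝ) : ℂ)) +
        (1 / 2 * ((n : ℂ) - 1)) * (((-1 / (2 * π) * Real.log |t - τ| : ℝ) : ℂ) *
          ((chT (n - 1) τ / √(1 - τ ^ 2) : ℝ) : ℂ)) := fun τ => by
      push_cast
      ring
    have i1 := (integrableOn_logKernel_chT (n + 1) t).const_mul (-(1 / 2) * ((n : ℂ) + 1))
    have i2 := (integrableOn_logKernel_chT (n - 1) t).const_mul (1 / 2 * ((n : ℂ) - 1))
    simp only [e]
    refine ⟨i1.add i2, ?_⟩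
    rw [integral_add i1 i2, integral_const_mul, integral_const_mul]
    have f1 := integral_logKernel_chT (n + 1) ht
    rw [show ((n + 1 : ℕ) : ℤ) = (n : ℤ) + 1 by push_cast; ring] at f1
    rw [f1]
    -- For `n = 0` the two terms coincide through `T_{-1} = T_1`; with `d_1 = 1/2` they combine to
    -- `-T_1 / 2`.
    rcases n with _ | n
    · have f2 := integral_logKernel_chT 1 ht
      simp only [Nat.cast_one] at f2
      simp only [Nat.cast_zero, zero_sub, chT_neg, f2, zero_add, chP, if_true]
      rw [dEig_succ 0]
      push_cast
      ring
    · have f2 := integral_logKernel_chT n ht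
      rw [show ((n + 1 : ℕ) : ℤ) - 1 = (n : ℤ) by push_cast; ring, f2, chP,
        if_neg (Nat.succ_ne_zero n)]
      simp only [Nat.add_sub_cancel]
      push_cast
      ring
  · exact (hasDerivAt_chP n t).ofReal_comp

theorem realizes_hyperOp {s : ℝ} (hs : -1 / 2 < s) :
    Realizes (ChebW.hyperOp s hs) IsV2Principal := fun n =>
  ⟨_, isV2Principal_chebTFun n, represents_hyperOp_chebT hs n⟩

end Principal

/-! ### Entire power series and the structure of the Helmholtz kernels. -/

/-- The coefficients of an entire power series. -/
def RapidDecay (c : ℕ → ℂ) : Prop := ∀ R : ℝ, 0 ≤ R → Summable fun p => ‖c p‖ * R ^ p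

/-- The sum of a power series at a real point. -/
noncomputable def powSum (c : ℕ → ℂ) (q : ℝ) : ℂ := ∑' p, c p * (q : ℂ) ^ p

/-- The coefficients of the derivative of a power series. -/
def derivCoeff (c : ℕ → ℂ) (p : ℕ) : ℂ := (p + 1) * c (p + 1)

namespace RapidDecay

variable {c d : ℕ → ℂ}

theorem of_norm_le (hd : RapidDecay d) (h : ∀ p, ‖c p‖ ≤ ‖d p‖) : RapidDecay c := fun R hR =>
  (hd R hR).of_nonneg_of_le (fun p => by positivity) fun p => by gcongr; exact h p

theorem add (hc : RapidDecay c) (hd : RapidDecay d) : RapidDecay (fun p => c p + d p) :=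
  fun R hR => ((hc R hR).add (hd R hR)).of_nonneg_of_le (fun p => by positivity) fun p => by
    rw [← add_mul]
    gcongr
    exact norm_add_le _ _

theorem const_mul (hc : RapidDecay c) (a : ℂ) : RapidDecay (fun p => a * c p) := fun R hR =>
  ((hc R hR).mul_left ‖a‖).congr fun p => by rw [norm_mul, mul_assoc]

theorem two_pow_mul (hc : RapidDecay c) : RapidDecay (fun p => 2 ^ p * c p) := fun R hR =>
  (hc (2 * R) (by positivity)).congr fun p => by
    rw [norm_mul, norm_pow, Complex.norm_ofNat, mul_pow]; ring

theorem shift (hc : RapidDecay c) : RapidDecay (fun p => c (p + 1)) := fun R hR => by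
  have h := (summable_nat_add_iff 1).2 (hc (R + 1) (by positivity))
  refine h.of_nonneg_of_le (fun p => by positivity) fun p => ?_
  gcongr
  calc R ^ p ≤ (R + 1) ^ p := by gcongr; linarith
    _ ≤ (R + 1) ^ (p + 1) := pow_le_pow_right₀ (by linarith) (by omega)

theorem derivCoeff (hc : RapidDecay c) : RapidDecay (derivCoeff c) := by
  -- The factor `p + 1` is absorbed in `2 ^ (p + 1)`, that is, in a larger radius.
  refine hc.two_pow_mul.shift.of_norm_le fun p => ?_
  rw [_root_.derivCoeff, norm_mul, norm_mul, norm_pow, Complex.norm_ofNat]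
  gcongr
  have : ((p : ℂ) + 1) = ((p + 1 : ℕ) : ℂ) := by push_cast; rfl
  rw [this, Complex.norm_natCast]
  exact_mod_cast (Nat.lt_two_pow_self (n := p + 1)).le

theorem summable_mul_pow (hc : RapidDecay c) (q : ℝ) : Summable fun p => c p * (q : ℂ) ^ p :=
  Summable.of_norm ((hc |q| (abs_nonneg q)).congr fun p => by simp)

theorem hasDerivAt_powSum (hc : RapidDecay c) (q : ℝ) :
    HasDerivAt (powSum c) (powSum (_root_.derivCoeff c) q) q := by
  have hq : q ∈ Ioo (-(|q| + 1)) (|q| + 1) :=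
    ⟨by linarith [neg_abs_le q], by linarith [le_abs_self q]⟩
  have h0 : (0 : ℝ) ∈ Ioo (-(|q| + 1)) (|q| + 1) :=
    ⟨by linarith [abs_nonneg q], by linarith [abs_nonneg q]⟩
  have hd := hasDerivAt_tsum_of_isPreconnected
    (u := fun p => ‖_root_.derivCoeff c p‖ * (|q| + 1) ^ p)
    (g := fun p (x : ℝ) => c (p + 1) * (x : ℂ) ^ (p + 1))
    (g' := fun p (x : ℝ) => _root_.derivCoeff c p * (x : ℂ) ^ p)
    (hc.derivCoeff (|q| + 1) (by positivity)) isOpen_Ioo isPreconnected_Ioo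
    (fun p x _ => ?_) (fun p x hx => ?_) h0 (by simp [summable_zero]) hq
  · have e : powSum c = fun x : ℝ => c 0 + ∑' p, c (p + 1) * (x : ℂ) ^ (p + 1) := by
      ext x
      rw [powSum, (hc.summable_mul_pow x).tsum_eq_zero_add, pow_zero, mul_one]
    rw [e]
    exact hd.const_add _
  · have := (((Complex.ofRealCLM.hasDerivAt (x := x)).pow (p + 1)).const_mul (c (p + 1)))
    refine this.congr_deriv ?_
    simp [_root_.derivCoeff]
    ring
  · rw [norm_mul, norm_pow, Complex.norm_real, Real.norm_eq_abs]
    gcongr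
    exact abs_le.2 ⟨hx.1.le, hx.2.le⟩

theorem continuous_powSum (hc : RapidDecay c) : Continuous (powSum c) :=
  continuous_iff_continuousAt.2 fun q => (hc.hasDerivAt_powSum q).continuousAt

end RapidDecay

/-- The second normal derivative, on the line, of a radial function in the plane. -/
theorem lineDeriv_lineDeriv_segNormal {G G' : ℝ → ℂ} (hG : ∀ q > 0, HasDerivAt G (G' q) q)
    (hc : ∀ q > 0, ContinuousAt G' q)
    {f : EuclideanSpace ℝ (Fin 2) → EuclideanSpace ℝ (Fin 2) → ℂ}
    (hf : ∀ x y, x ≠ y → f x y = G (dist x y ^ 2)) {t τ : ℝ} (h : t ≠ τ) :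
    lineDeriv ℝ (fun x => lineDeriv ℝ (fun y => f x y) (segPoint τ) segNormal)
      (segPoint t) segNormal = -2 * G' ((t - τ) ^ 2) := by
  have hpos : 0 < (t - τ) ^ 2 := by have := sub_ne_zero.2 h; positivity
  have hd : ∀ b c : ℝ, dist (segPoint t + b • segNormal) (segPoint τ + c • segNormal) ^ 2 =
      (t - τ) ^ 2 + (b - c) ^ 2 := fun b c => by
    rw [EuclideanSpace.dist_sq_eq]
    simp [segPoint, segNormal, Real.dist_eq, sq_abs]
  have hne : ∀ b c : ℝ, segPoint t + b • segNormal ≠ segPoint τ + c • segNormal := fun b c hbc => by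
    have := hd b c
    rw [hbc, dist_self] at this
    nlinarith [sq_nonneg (b - c)]
  have hin : ∀ b : ℝ, lineDeriv ℝ (fun y => f (segPoint t + b • segNormal) y) (segPoint τ) segNormal =
      b * (-2 * G' ((t - τ) ^ 2 + b ^ 2)) := fun b => by
    have e : (fun c : ℝ => f (segPoint t + b • segNormal) (segPoint τ + c • segNormal)) =
        fun c : ℝ => G ((t - τ) ^ 2 + (b - c) ^ 2) := by
      ext c
      rw [hf _ _ (hne b c), hd]
    have h1 : HasDerivAt (fun c : ℝ => (t - τ) ^ 2 + (b - c) ^ 2) (-2 * b) 0 := by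
      have := ((((hasDerivAt_id (0 : ℝ)).const_sub b).pow 2).const_add ((t - τ) ^ 2))
      refine this.congr_deriv ?_
      simp
    have h2 : HasDerivAt G (G' ((t - τ) ^ 2 + b ^ 2)) ((t - τ) ^ 2 + (b - 0) ^ 2) := by
      rw [sub_zero]
      exact hG _ (by positivity)
    have h3 : HasDerivAt (fun c : ℝ => G ((t - τ) ^ 2 + (b - c) ^ 2)) _ 0 := h2.scomp 0 h1
    rw [lineDeriv, e, h3.deriv]
    simp
    ring
  rw [lineDeriv]
  simp only [hin]
  -- The inner derivative has the form `b h(b)`, whose derivative at `b = 0` is `h(0)` by continuity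
  -- of `h` alone; no second derivative of `G` is needed.
  refine HasDerivAt.deriv ?_
  rw [hasDerivAt_iff_tendsto_slope_zero]
  have h3 : ContinuousAt (fun b : ℝ => -2 * G' ((t - τ) ^ 2 + b ^ 2)) 0 := by
    refine ContinuousAt.const_mul (ContinuousAt.comp (f := fun b : ℝ => (t - τ) ^ 2 + b ^ 2) ?_
      (by fun_prop)) _
    refine hc _ ?_
    positivity
  have h4 := h3.tendsto.mono_left (nhdsWithin_le_nhds (s := {0}ᶜ))
  simp only [ne_eq, OfNat.ofNat_ne_zero, not_false_eq_true, zero_pow, add_zero] at h4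
  refine h4.congr' ?_
  filter_upwards [self_mem_nhdsWithin] with b hb
  have : (b : ℂ) ≠ 0 := by exact_mod_cast hb
  simp
  field_simp

/-- The coefficients of `J₀(kr)` as a power series in `r²`. -/
noncomputable def besselCoeff (k : ℝ) (p : ℕ) : ℂ :=
  (((-1) ^ p * (k / 2) ^ (2 * p) / (p.factorial : ℝ) ^ 2 : ℝ) : ℂ)

/-- The coefficients, as a power series in `r²`, of the regular part of the fundamental solution. -/
noncomputable def regCoeff (k : ℝ) (p : ℕ) : ℂ :=
  (Complex.I / 4 - 1 / (2 * π) * (Real.log (k / 2) + Real.eulerMascheroniConstant)) *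
    besselCoeff k p + 1 / (2 * π) * ((harmonic p : ℝ) * besselCoeff k p)

theorem besselCoeff_zero (k : ℝ) : besselCoeff k 0 = 1 := by simp [besselCoeff]

theorem harmonic_nonneg_le (n : ℕ) : 0 ≤ harmonic n ∧ harmonic n ≤ n := by
  induction n with
  | zero => simp
  | succ n ih =>
    rw [harmonic_succ]
    have : ((n + 1 : ℕ) : ℚ)⁻¹ ≤ 1 := inv_le_one_of_one_le₀ (by push_cast; linarith [n.cast_nonneg (α := ℚ)])
    have h2 : 0 ≤ ((n + 1 : ℕ) : ℚ)⁻¹ := by positivity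
    push_cast at this h2 ⊢
    exact ⟨by linarith, by linarith⟩

theorem rapidDecay_besselCoeff (k : ℝ) : RapidDecay (besselCoeff k) := fun R hR => by
  refine (Real.summable_pow_div_factorial ((k / 2) ^ 2 * R)).of_nonneg_of_le
    (fun p => by positivity) fun p => ?_
  rw [besselCoeff, Complex.norm_real, norm_div, norm_mul, norm_pow, norm_neg, norm_one, one_pow,
    one_mul, Real.norm_of_nonneg (by rw [pow_mul]; positivity), Real.norm_of_nonneg (by positivity),
    mul_pow, ← pow_mul, div_mul_eq_mul_div]
  have h1 : (1 : ℝ) ≤ p.factorial := by exact_mod_cast p.factorial_pos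
  have h2 : (p.factorial : ℝ) ≤ (p.factorial : ℝ) ^ 2 := by nlinarith
  have h3 : 0 ≤ (k / 2) ^ (2 * p) := by rw [pow_mul]; positivity
  gcongr

theorem rapidDecay_harmonic_mul_besselCoeff (k : ℝ) :
    RapidDecay (fun p => (harmonic p : ℝ) * besselCoeff k p) := by
  refine (rapidDecay_besselCoeff k).two_pow_mul.of_norm_le fun p => ?_
  rw [norm_mul, norm_mul, norm_pow, Complex.norm_ofNat]
  gcongr
  rw [Complex.norm_real, Real.norm_of_nonneg (by exact_mod_cast (harmonic_nonneg_le p).1)]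
  have h1 : ((harmonic p : ℚ) : ℝ) ≤ p := by exact_mod_cast (harmonic_nonneg_le p).2
  have h2 : (p : ℝ) ≤ 2 ^ p := by exact_mod_cast (Nat.lt_two_pow_self (n := p)).le
  linarith

theorem rapidDecay_regCoeff (k : ℝ) : RapidDecay (regCoeff k) :=
  ((rapidDecay_besselCoeff k).const_mul _).add
    ((rapidDecay_harmonic_mul_besselCoeff k).const_mul _)

theorem besselCoeff_mul_pow (k d : ℝ) (p : ℕ) : besselCoeff k p * ((d ^ 2 : ℝ) : ℂ) ^ p =
    (((-1) ^ p * (k * d / 2) ^ (2 * p) / (p.factorial : ℝ) ^ 2 : ℝ) : ℂ) := by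
  rw [besselCoeff, ← Complex.ofReal_pow, ← Complex.ofReal_mul, ← pow_mul]
  congr 1
  rw [mul_div_right_comm k d, mul_pow (k / 2)]
  ring

theorem besselJ0_mul (k d : ℝ) : (besselJ0 (k * d) : ℂ) = powSum (besselCoeff k) (d ^ 2) := by
  rw [besselJ0, powSum, Complex.ofReal_tsum]
  exact tsum_congr fun p => (besselCoeff_mul_pow k d p).symm

/-- All series are in even powers of the distance, and `log r = (1/2) log r²`, so everything is a
function of the squared distance. This is the variable in which the normal derivatives are taken. -/
theorem helmholtzFund_eq {k : ℝ} (hk : 0 < k) {x y : EuclideanSpace ℝ (Fin 2)} (h : x ≠ y) :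
    helmholtzFund k x y = ((-1 / (4 * π) * Real.log (dist x y ^ 2) : ℝ) : ℂ) *
      powSum (besselCoeff k) (dist x y ^ 2) + powSum (regCoeff k) (dist x y ^ 2) := by
  have hd : 0 < dist x y := dist_pos.2 h
  set d := dist x y with hdd
  have h1 : powSum (fun p => (harmonic p : ℝ) * besselCoeff k p) (d ^ 2) =
      ((∑' m : ℕ, (-1) ^ m * (harmonic m : ℝ) * (k * d / 2) ^ (2 * m) / (m.factorial : ℝ) ^ 2 : ℝ) : ℂ) := by
    rw [powSum, Complex.ofReal_tsum]
    refine tsum_congr fun p => ?_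
    rw [mul_assoc, besselCoeff_mul_pow]
    push_cast
    ring
  have h2 : powSum (regCoeff k) (d ^ 2) =
      (Complex.I / 4 - 1 / (2 * π) * (Real.log (k / 2) + Real.eulerMascheroniConstant)) *
      powSum (besselCoeff k) (d ^ 2) +
      1 / (2 * π) * powSum (fun p => (harmonic p : ℝ) * besselCoeff k p) (d ^ 2) := by
    rw [powSum, powSum, powSum, ← tsum_mul_left, ← tsum_mul_left, ← Summable.tsum_add]
    · exact tsum_congr fun p => by rw [regCoeff]; ring
    · exact ((rapidDecay_besselCoeff k).summable_mul_pow _).mul_left _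
    · exact ((rapidDecay_harmonic_mul_besselCoeff k).summable_mul_pow _).mul_left _
  rw [h2, h1, helmholtzFund, hankelH0, ← hdd, besselY0, mul_div_right_comm k d 2,
    Real.log_mul (by positivity) hd.ne', ← mul_div_right_comm k d 2, Real.log_pow, ← besselJ0_mul]
  have : (π : ℂ) ≠ 0 := by exact_mod_cast Real.pi_pos.ne'
  generalize (∑' m : ℕ, (-1) ^ m * (harmonic m : ℝ) * (k * d / 2) ^ (2 * m) / (m.factorial : ℝ) ^ 2 : ℝ)
    = Z
  push_cast
  field_simp
  linear_combination (4 * (besselJ0 (k * d) : ℂ) * (Real.log (k / 2) + Real.log d +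
    Real.eulerMascheroniConstant) - 4 * Z) * Complex.I_sq

/-- The logarithmic coefficients of the hypersingular kernel. -/
noncomputable def besselCoeff₂ (k : ℝ) (p : ℕ) : ℂ := -2 * derivCoeff (besselCoeff k) p

/-- The regular coefficients of the hypersingular kernel. -/
noncomputable def regCoeff₂ (k : ℝ) (p : ℕ) : ℂ :=
  1 / (2 * π) * besselCoeff k (p + 1) + -2 * derivCoeff (regCoeff k) p

theorem rapidDecay_besselCoeff₂ (k : ℝ) : RapidDecay (besselCoeff₂ k) :=
  (rapidDecay_besselCoeff k).derivCoeff.const_mul _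

theorem rapidDecay_regCoeff₂ (k : ℝ) : RapidDecay (regCoeff₂ k) :=
  ((rapidDecay_besselCoeff k).shift.const_mul _).add ((rapidDecay_regCoeff k).derivCoeff.const_mul _)

theorem RapidDecay.powSum_eq {c : ℕ → ℂ} (hc : RapidDecay c) (q : ℝ) :
    powSum c q = c 0 + q * powSum (fun p => c (p + 1)) q := by
  rw [powSum, (hc.summable_mul_pow q).tsum_eq_zero_add, pow_zero, mul_one, powSum, ← tsum_mul_left]
  congr 1
  exact tsum_congr fun p => by ring

theorem powSum_besselCoeff₂ (k q : ℝ) :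
    powSum (besselCoeff₂ k) q = -2 * powSum (derivCoeff (besselCoeff k)) q := by
  rw [powSum, powSum, ← tsum_mul_left]
  exact tsum_congr fun p => by rw [besselCoeff₂]; ring

theorem powSum_regCoeff₂ (k q : ℝ) :
    powSum (regCoeff₂ k) q = 1 / (2 * π) * powSum (fun p => besselCoeff k (p + 1)) q
      + -2 * powSum (derivCoeff (regCoeff k)) q := by
  rw [powSum, powSum, powSum, ← tsum_mul_left, ← tsum_mul_left, ← Summable.tsum_add]
  · exact tsum_congr fun p => by rw [regCoeff₂]; ring
  · exact ((rapidDecay_besselCoeff k).shift.summable_mul_pow q).mul_left _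
  · exact ((rapidDecay_regCoeff k).derivCoeff.summable_mul_pow q).mul_left _

theorem helmholtzFund_segPoint {k : ℝ} (hk : 0 < k) {t τ : ℝ} (h : t ≠ τ) :
    helmholtzFund k (segPoint t) (segPoint τ) =
      ((-1 / (2 * π) * Real.log |t - τ| : ℝ) : ℂ) * powSum (besselCoeff k) ((t - τ) ^ 2) +
      powSum (regCoeff k) ((t - τ) ^ 2) := by
  have hd : dist (segPoint t) (segPoint τ) ^ 2 = (t - τ) ^ 2 := by
    rw [EuclideanSpace.dist_sq_eq]
    simp [segPoint, Real.dist_eq, sq_abs]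
  have hne : segPoint t ≠ segPoint τ := fun e => by
    rw [e, dist_self] at hd
    have := sub_ne_zero.2 h
    have : 0 < (t - τ) ^ 2 := by positivity
    linarith
  rw [helmholtzFund_eq hk hne, hd, ← sq_abs (t - τ), Real.log_pow]
  congr 3
  push_cast
  ring

/-- For `G(q) = -1/(4π) α(q) log q + β(q)` the kernel is `-2 G'(q)` at `q = (t-τ)²`. The term `α(q)
/ (2πq)` splits as `1/(2πq)` plus an entire series because `α(0) = 1`. -/
theorem hyperKernel_eq {k : ℝ} (hk : 0 < k) {t τ : ℝ} (h : t ≠ τ) :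
    hyperKernel k t τ = ((1 / (2 * π) * ((τ - t) ^ 2)⁻¹ : ℝ) : ℂ) +
      (((-1 / (2 * π) * Real.log |t - τ| : ℝ) : ℂ) * powSum (besselCoeff₂ k) ((t - τ) ^ 2) +
      powSum (regCoeff₂ k) ((t - τ) ^ 2)) := by
  have hα := rapidDecay_besselCoeff k
  have hβ := rapidDecay_regCoeff k
  have hG : ∀ q > (0 : ℝ), HasDerivAt (fun q : ℝ => ((-1 / (4 * π) * Real.log q : ℝ) : ℂ) *
      powSum (besselCoeff k) q + powSum (regCoeff k) q)
      (((-1 / (4 * π) * q⁻¹ : ℝ) : ℂ) * powSum (besselCoeff k) q +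
        ((-1 / (4 * π) * Real.log q : ℝ) : ℂ) * powSum (derivCoeff (besselCoeff k)) q +
        powSum (derivCoeff (regCoeff k)) q) q := fun q hq =>
    ((((Real.hasDerivAt_log hq.ne').const_mul (-1 / (4 * π))).ofReal_comp).mul
      (hα.hasDerivAt_powSum q)).add (hβ.hasDerivAt_powSum q)
  have hc : ∀ q > (0 : ℝ), ContinuousAt (fun q : ℝ =>
      (((-1 / (4 * π) * q⁻¹ : ℝ) : ℂ) * powSum (besselCoeff k) q +
        ((-1 / (4 * π) * Real.log q : ℝ) : ℂ) * powSum (derivCoeff (besselCoeff k)) q +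
        powSum (derivCoeff (regCoeff k)) q)) q := fun q hq => by
    have h1 := (continuousAt_inv₀ hq.ne').const_mul (-1 / (4 * π))
    have h2 := (Real.continuousAt_log hq.ne').const_mul (-1 / (4 * π))
    have hr := fun x => (Complex.continuous_ofReal).continuousAt (x := x)
    exact (((ContinuousAt.comp (hr _) h1).mul hα.continuous_powSum.continuousAt).add
      ((ContinuousAt.comp (hr _) h2).mul hα.derivCoeff.continuous_powSum.continuousAt)).add
      hβ.derivCoeff.continuous_powSum.continuousAt
  have hne : t - τ ≠ 0 := sub_ne_zero.2 h
  rw [hyperKernel, lineDeriv_lineDeriv_segNormal hG hc (fun x y hxy => helmholtzFund_eq hk hxy) h,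
    powSum_besselCoeff₂, powSum_regCoeff₂, hα.powSum_eq, besselCoeff_zero, ← sq_abs (t - τ),
    Real.log_pow, sq_abs, show (τ - t) ^ 2 = (t - τ) ^ 2 by ring]
  have h1 : (π : ℂ) ≠ 0 := by exact_mod_cast Real.pi_pos.ne'
  have h2 : (t : ℂ) - τ ≠ 0 := by exact_mod_cast hne
  push_cast
  field_simp
  ring

/-! ### Calculus of kernels and uniform bounds. -/

/-- The operator `A` is the integral operator with kernel `K` and density `1 / w`. -/
def HasKernel {s r : ℝ} (A : ChebW s →L[ℂ] ChebW r) (K : ℝ → ℝ → ℂ) : Prop :=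
  ∀ n : ℕ, (∀ t ∈ Ioo (-1 : ℝ) 1,
      IntegrableOn (fun τ => K t τ * (chebTFun n τ / chebWeight τ)) (Ioo (-1) 1)) ∧
    Represents (A (ChebW.chebT s n))
      (fun t => ∫ τ in Ioo (-1) 1, K t τ * (chebTFun n τ / chebWeight τ))

namespace HasKernel

variable {s r : ℝ} {A B : ChebW s →L[ℂ] ChebW r} {K L : ℝ → ℝ → ℂ}

theorem congr (hA : HasKernel A K)
    (h : ∀ t ∈ Ioo (-1 : ℝ) 1, ∀ τ ∈ Ioo (-1 : ℝ) 1, t ≠ τ → K t τ = L t τ) : HasKernel A L := by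
  have hae : ∀ n : ℕ, ∀ t ∈ Ioo (-1 : ℝ) 1, (fun τ => K t τ * (chebTFun n τ / chebWeight τ))
      =ᵐ[volume.restrict (Ioo (-1) 1)] fun τ => L t τ * (chebTFun n τ / chebWeight τ) :=
    fun n t ht => by
      filter_upwards [ae_restrict_mem measurableSet_Ioo,
        ae_restrict_of_ae (Measure.ae_ne volume t)] with τ hτ hne
      rw [h t ht τ hτ hne.symm]
  exact fun n => ⟨fun t ht => ((hA n).1 t ht).congr (hae n t ht),
    (hA n).2.congr fun t ht => integral_congr_ae (hae n t ht)⟩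

theorem add (hA : HasKernel A K) (hB : HasKernel B L) :
    HasKernel (A + B) (fun t τ => K t τ + L t τ) := fun n => by
  simp only [add_mul]
  refine ⟨fun t ht => ((hA n).1 t ht).add ((hB n).1 t ht), ?_⟩
  exact ((hA n).2.add (hB n).2).congr fun t ht =>
    (integral_add ((hA n).1 t ht) ((hB n).1 t ht)).symm

theorem smul (hA : HasKernel A K) (c : ℂ) : HasKernel (c • A) (fun t τ => c * K t τ) := fun n => by
  simp only [mul_assoc]
  exact ⟨fun t ht => ((hA n).1 t ht).const_mul c,
    ((hA n).2.smul c).congr fun t _ => (integral_const_mul c _).symm⟩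

theorem sub (hA : HasKernel A K) (hB : HasKernel B L) :
    HasKernel (A - B) (fun t τ => K t τ - L t τ) := by
  have := hA.add (hB.smul (-1))
  rw [neg_one_smul, ← sub_eq_add_neg] at this
  exact this.congr fun t _ τ _ _ => by ring

theorem mulX_comp (hA : HasKernel A K) :
    HasKernel ((ChebW.mulX r).comp A) (fun t τ => t * K t τ) := fun n => by
  simp only [mul_assoc]
  exact ⟨fun t ht => ((hA n).1 t ht).const_mul _,
    (hA n).2.mulX.congr fun t _ => (integral_const_mul _ _).symm⟩

theorem comp_mulX (hA : HasKernel A K) :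
    HasKernel (A.comp (ChebW.mulX s)) (fun t τ => K t τ * τ) := fun n => by
  rcases n with _ | n
  · have e : ∀ t τ : ℝ, K t τ * τ * (chebTFun 0 τ / chebWeight τ) =
        K t τ * (chebTFun 1 τ / chebWeight τ) := fun t τ => by
      rw [← mul_chebTFun_zero]; ring
    simp only [e, ContinuousLinearMap.comp_apply, ChebW.mulX_chebT_zero]
    exact hA 1
  · have e : ∀ t τ : ℝ, K t τ * τ * (chebTFun (n + 1) τ / chebWeight τ) =
        1 / 2 * (K t τ * (chebTFun (n + 2) τ / chebWeight τ)) +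
        1 / 2 * (K t τ * (chebTFun n τ / chebWeight τ)) := fun t τ => by
      linear_combination (K t τ / chebWeight τ) * mul_chebTFun_succ n τ
    simp only [e, ContinuousLinearMap.comp_apply, ChebW.mulX_chebT_succ, map_add, map_smul]
    have h1 := fun t ht => ((hA (n + 2)).1 t ht).const_mul (1 / 2)
    have h2 := fun t ht => ((hA n).1 t ht).const_mul (1 / 2)
    refine ⟨fun t ht => (h1 t ht).add (h2 t ht), ?_⟩
    refine (((hA (n + 2)).2.smul (1 / 2)).add ((hA n).2.smul (1 / 2))).congr fun t ht => ?_
    rw [integral_add (h1 t ht) (h2 t ht), integral_const_mul, integral_const_mul]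

/-- Multiplication by the variable after the operator multiplies the kernel by `t`, before it by
`τ`. This turns the smoothness of kernels on the diagonal into statements about commutators. -/
theorem ad (hA : HasKernel A K) : HasKernel (ChebW.ad s r A) (fun t τ => (t - τ) * K t τ) :=
  (hA.mulX_comp.sub hA.comp_mulX).congr fun t _ τ _ _ => by ring

theorem ad_pow (hA : HasKernel A K) (p : ℕ) :
    HasKernel ((ChebW.ad s r ^ p) A) (fun t τ => (t - τ) ^ p * K t τ) := by
  induction p with
  | zero => simpa using hA
  | succ p ih =>
    rw [pow_succ', mul_apply_eq_comp]
    exact ih.ad.congr fun t _ τ _ _ => by ring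

end HasKernel

theorem hasKernel_logOp (s : ℝ) :
    HasKernel (ChebW.logOp s) (fun t τ => ((-1 / (2 * π) * Real.log |t - τ| : ℝ) : ℂ)) := fun n => by
  have h := isV1Principal_chebTFun n
  refine ⟨fun t ht => ?_, ?_⟩
  · exact intervalIntegrable_iff_integrableOn_Ioo_neg_one_one.1 (h t ht).1
  · rw [ChebW.logOp_chebT]
    refine ((represents_chebT _ n).smul _).congr fun t ht => ?_
    have h' := (h t ht).2
    rw [integral_neg_one_one] at h'
    exact h'

theorem hasKernel_meanOp (s r : ℝ) : HasKernel (ChebW.meanOp s r) (fun _ _ => 1) := fun n => by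
  simp only [one_mul]
  refine ⟨fun _ _ => integrableOn_chebTFun_div n, ?_⟩
  rw [ChebW.meanOp_chebT]
  have h := chebInt_chebTFun n 0
  have e : ∀ t, chebTFun 0 t = 1 := fun t => by simp [chebTFun_eq, chT_zero]
  simp only [chebInt, e, one_mul] at h
  refine ((represents_chebT r 0).smul _).congr fun t _ => ?_
  rw [h, e, mul_one]
  congr 1
  split_ifs <;> first | rfl | omega

/-- The kernel is integrable, uniformly in the parameter. -/
def KernelBound (K : ℝ → ℝ → ℂ) (C : ℝ) : Prop :=
  ∀ n : ℕ, ∀ t ∈ Ioo (-1 : ℝ) 1, ∫ τ in Ioo (-1) 1, ‖K t τ * (chebTFun n τ / chebWeight τ)‖ ≤ C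

theorem kernelBound_one : KernelBound (fun _ _ => 1) π := fun n t _ => by
  simp only [one_mul]
  refine (integral_norm_div_weight_le (C := 1) fun τ hτ => norm_chebTFun_le n hτ).trans ?_
  rw [one_mul]

theorem abs_log_le_two_mul_log_two_sub {x : ℝ} (h0 : 0 ≤ x) (h2 : x ≤ 2) :
    |Real.log x| ≤ 2 * Real.log 2 - Real.log x := by
  have hl : 0 < Real.log 2 := Real.log_pos (by norm_num)
  have h : Real.log x ≤ Real.log 2 := by
    rcases h0.eq_or_lt with rfl | h0
    · simpa using hl.le
    · exact Real.log_le_log h0 h2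
  exact abs_le.2 ⟨by linarith, by linarith⟩

/-- As `|t - τ| ≤ 2`, the absolute value of the logarithm is at most `2 log 2 - log |t - τ|`, and
the integral of the latter against `1 / w` is independent of `t`. -/
theorem exists_kernelBound_log :
    ∃ C, KernelBound (fun t τ => ((-1 / (2 * π) * Real.log |t - τ| : ℝ) : ℂ)) C := by
  refine ⟨1 / (2 * π) * (2 * Real.log 2 * π - -π * Real.log 2), fun n t ht => ?_⟩
  have i1 := (integrableOn_chT_div_weight 0).const_mul (2 * Real.log 2)
  have i2 := integrableOn_weight_log t
  have hI : ∫ τ in Ioo (-1) 1, (2 * Real.log 2 * (chT 0 τ / √(1 - τ ^ 2)) -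
      (√(1 - τ ^ 2))⁻¹ • Real.log |t - τ|) = 2 * Real.log 2 * π - -π * Real.log 2 := by
    rw [integral_sub i1 i2, integral_const_mul, integral_chT_div_weight_zero, integral_weight_log ht]
  rw [← hI, ← integral_const_mul]
  refine integral_mono_of_nonneg (Eventually.of_forall fun t => norm_nonneg _)
    ((i1.sub i2).const_mul _) ?_
  filter_upwards [ae_restrict_mem measurableSet_Ioo] with τ hτ
  rw [norm_mul, norm_div, chebWeight_eq, Complex.norm_real, Complex.norm_real,
    Real.norm_of_nonneg (Real.sqrt_nonneg _), norm_mul, Real.norm_eq_abs, Real.norm_eq_abs, chT_zero,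
    abs_div, abs_neg, abs_one, abs_of_pos (by positivity : (0 : ℝ) < 2 * π), mul_assoc]
  refine mul_le_mul_of_nonneg_left ?_ (by positivity)
  have h1 := abs_log_le_two_mul_log_two_sub (abs_nonneg (t - τ))
    (abs_le.2 ⟨by linarith [ht.1, hτ.2], by linarith [ht.2, hτ.1]⟩)
  have h2 := norm_chebTFun_le n hτ
  have h3 : 0 ≤ (√(1 - τ ^ 2))⁻¹ := by positivity
  calc abs (Real.log |t - τ|) * (‖chebTFun n τ‖ / √(1 - τ ^ 2))
      ≤ abs (Real.log |t - τ|) * (1 / √(1 - τ ^ 2)) := by gcongr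
    _ ≤ (2 * Real.log 2 - Real.log |t - τ|) * (1 / √(1 - τ ^ 2)) := by gcongr
    _ = _ := by simp only [smul_eq_mul]; ring

/-! ### Operator series for kernels multiplied by entire functions of `(t - τ)²`. -/

section Series

open ChebW

variable {s r : ℝ}

/-- The operator whose kernel is that of `A` multiplied by `∑ c_p (t - τ)^{2p}`. -/
noncomputable def kernelSeries (A : ChebW s →L[ℂ] ChebW r) (c : ℕ → ℂ) : ChebW s →L[ℂ] ChebW r :=
  ∑' p, c p • (ad s r ^ (2 * p)) A

/-- The norms of the terms are at most `‖c_p‖ ‖ad‖^{2p} ‖A‖`, summable by the rapid decay of `c` at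
the radius `‖ad‖²`. -/
theorem hasSum_kernelSeries (A : ChebW s →L[ℂ] ChebW r) {c : ℕ → ℂ} (hc : RapidDecay c) :
    HasSum (fun p => c p • (ad s r ^ (2 * p)) A) (kernelSeries A c) := by
  refine Summable.hasSum (Summable.of_norm ?_)
  refine ((hc (‖ad s r‖ ^ 2) (by positivity)).mul_right ‖A‖).of_nonneg_of_le
    (fun p => norm_nonneg _) fun p => ?_
  have hpow : ∀ n, ‖(ad s r ^ n) A‖ ≤ ‖ad s r‖ ^ n * ‖A‖ := fun n => by
    induction n with
    | zero => simp
    | succ n ih =>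
      rw [pow_succ', mul_apply_eq_comp, pow_succ', mul_assoc]
      exact (ContinuousLinearMap.le_opNorm _ _).trans (by gcongr)
  rw [norm_smul, mul_assoc, ← pow_mul]
  gcongr
  exact hpow _

theorem isCompactOperator_of_hasSum {A : ℕ → ChebW s →L[ℂ] ChebW r} {B : ChebW s →L[ℂ] ChebW r}
    (h : HasSum A B) (hA : ∀ p, IsCompactOperator (A p)) : IsCompactOperator B :=
  isCompactOperator_of_tendsto h.tendsto_sum_nat
    (Eventually.of_forall fun _ => isCompactOperator_sum _ _ fun p _ => hA p)

/-- Every term with `p ≥ 1` is an iterated commutator of the compact operator `ad A`, and norm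
limits of compact operators are compact. -/
theorem isCompactOperator_kernelSeries_sub {A : ChebW s →L[ℂ] ChebW r} {c : ℕ → ℂ}
    (hc : RapidDecay c) (hA : IsCompactOperator (ad s r A)) :
    IsCompactOperator (kernelSeries A c - c 0 • A) := by
  have h := (hasSum_nat_add_iff' 1).2 (hasSum_kernelSeries A hc)
  simp only [Finset.range_one, Finset.sum_singleton, mul_zero, pow_zero, one_apply_eq_self] at h
  refine isCompactOperator_of_hasSum h fun p => ?_
  refine IsCompactOperator.smul ?_ (c (p + 1))
  have := isCompactOperator_ad_pow hA (2 * p + 1)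
  rwa [← mul_apply_eq_comp, ← pow_succ, show 2 * p + 1 + 1 = 2 * (p + 1) by ring] at this

theorem isCompactOperator_kernelSeries {A : ChebW s →L[ℂ] ChebW r} {c : ℕ → ℂ}
    (hc : RapidDecay c) (hA : IsCompactOperator A) : IsCompactOperator (kernelSeries A c) :=
  isCompactOperator_of_hasSum (hasSum_kernelSeries A hc) fun p =>
    (isCompactOperator_ad_pow hA (2 * p)).smul (c p)

/-- On the segment `|t - τ| ≤ 2`, so the series is dominated by `‖c_p‖ 4^p`. Together with the bound
`C`, uniform in `t`, this allows summation under the integral sign and then termwise computation of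
the coefficients. -/
theorem HasKernel.kernelSeries {A : ChebW s →L[ℂ] ChebW r} {c : ℕ → ℂ} {K : ℝ → ℝ → ℂ} {C : ℝ}
    (hA : HasKernel A K) (hK : KernelBound K C) (hc : RapidDecay c) :
    HasKernel (kernelSeries A c) (fun t τ => K t τ * powSum c ((t - τ) ^ 2)) := fun n => by
  have hle : ∀ t ∈ Ioo (-1 : ℝ) 1, ∀ τ ∈ Ioo (-1 : ℝ) 1, ∀ p : ℕ,
      ‖c p * ((t : ℂ) - τ) ^ (2 * p)‖ ≤ ‖c p‖ * 4 ^ p := fun t ht τ hτ p => by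
    rw [norm_mul, norm_pow, ← Complex.ofReal_sub, Complex.norm_real, Real.norm_eq_abs, pow_mul]
    gcongr
    have : |t - τ| ≤ 2 := abs_le.2 ⟨by linarith [ht.1, hτ.2], by linarith [ht.2, hτ.1]⟩
    nlinarith [abs_nonneg (t - τ)]
  have h4 := hc 4 (by norm_num)
  have hterm : ∀ t τ : ℝ, HasSum (fun p => c p * ((t : ℂ) - τ) ^ (2 * p)) (powSum c ((t - τ) ^ 2)) :=
    fun t τ => by
      refine (hc.summable_mul_pow ((t - τ) ^ 2)).hasSum.congr_fun fun p => ?_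
      rw [pow_mul]; push_cast; rfl
  have hp : ∀ p, HasKernel (c p • (ChebW.ad s r ^ (2 * p)) A)
      (fun t τ => c p * ((t - τ) ^ (2 * p) * K t τ)) := fun p => (hA.ad_pow (2 * p)).smul (c p)
  have hbound : ∀ p, ∀ t ∈ Ioo (-1 : ℝ) 1,
      ∫ τ in Ioo (-1) 1, ‖c p * ((t - τ) ^ (2 * p) * K t τ) * (chebTFun n τ / chebWeight τ)‖ ≤
        ‖c p‖ * 4 ^ p * C := fun p t ht => by
    refine le_trans ?_ (mul_le_mul_of_nonneg_left (hK n t ht) (by positivity))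
    rw [← integral_const_mul]
    refine integral_mono_of_nonneg (Eventually.of_forall fun τ => norm_nonneg _)
      (((hA n).1 t ht).norm.const_mul _) ?_
    filter_upwards [ae_restrict_mem measurableSet_Ioo] with τ hτ
    rw [← mul_assoc, mul_assoc _ (K t τ), norm_mul]
    gcongr
    exact hle t ht τ hτ p
  have hsum : ∀ t ∈ Ioo (-1 : ℝ) 1, HasSum
      (fun p => ∫ τ in Ioo (-1) 1, c p * ((t - τ) ^ (2 * p) * K t τ) * (chebTFun n τ / chebWeight τ))
      (∫ τ in Ioo (-1) 1, K t τ * powSum c ((t - τ) ^ 2) * (chebTFun n τ / chebWeight τ)) :=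
    fun t ht => by
      have := hasSum_integral_of_summable_integral_norm (fun p => (hp p n).1 t ht)
        ((h4.mul_right C).of_nonneg_of_le (fun p => integral_nonneg fun τ => norm_nonneg _)
          fun p => hbound p t ht)
      have e : ∀ τ : ℝ, ∑' p, c p * ((t - τ) ^ (2 * p) * K t τ) * (chebTFun n τ / chebWeight τ) =
          K t τ * powSum c ((t - τ) ^ 2) * (chebTFun n τ / chebWeight τ) := fun τ => by
        rw [← (hterm t τ).tsum_eq, ← tsum_mul_left, ← tsum_mul_right]
        exact tsum_congr fun p => by ring
      simpa only [e] using this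
  refine ⟨fun t ht => ?_, ?_⟩
  · refine (Integrable.bdd_mul (c := ∑' p, ‖c p‖ * 4 ^ p) ((hA n).1 t ht)
      (f := fun τ => powSum c ((t - τ) ^ 2)) ?_ ?_).congr
      (Eventually.of_forall fun τ => ?_)
    · exact (hc.continuous_powSum.comp (by fun_prop)).aestronglyMeasurable
    · filter_upwards [ae_restrict_mem measurableSet_Ioo] with τ hτ
      rw [← (hterm t τ).tsum_eq]
      exact tsum_of_norm_bounded h4.hasSum (hle t ht τ hτ)
    · ring
  · have hU : HasSum (fun p => (c p • (ChebW.ad s r ^ (2 * p)) A) (chebT s n))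
        (_root_.kernelSeries A c (chebT s n)) :=
      (hasSum_kernelSeries A hc).mapL (ContinuousLinearMap.apply ℂ (ChebW r) (chebT s n))
    refine (Represents.hasSum (fun p => (hp p n).2) (fun p t ht => ?_) (h4.mul_right C) hU).congr
      fun t ht => (hsum t ht).tsum_eq
    exact (norm_integral_le_integral_norm _).trans (hbound p t ht)

end Series

/-! ### The Helmholtz operators as compact perturbations of the model operators. -/

section Operators

open ChebW

variable (s : ℝ)

/-- The operator with kernel `-1/(2π) log|t-τ| ∑ c_p (t-τ)^{2p} + ∑ d_p (t-τ)^{2p}`. -/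
noncomputable def logSeriesOp (c d : ℕ → ℂ) : ChebW s →L[ℂ] ChebW (s + 1) :=
  kernelSeries (logOp s) c + kernelSeries (meanOp s (s + 1)) d

theorem hasKernel_logSeriesOp {c d : ℕ → ℂ} (hc : RapidDecay c) (hd : RapidDecay d) :
    HasKernel (logSeriesOp s c d) (fun t τ =>
      ((-1 / (2 * π) * Real.log |t - τ| : ℝ) : ℂ) * powSum c ((t - τ) ^ 2) +
        powSum d ((t - τ) ^ 2)) := by
  obtain ⟨C, hC⟩ := exists_kernelBound_log
  refine (((hasKernel_logOp s).kernelSeries hC hc).add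
    ((hasKernel_meanOp s (s + 1)).kernelSeries kernelBound_one hd)).congr fun t _ τ _ _ => ?_
  rw [one_mul]

theorem isCompactOperator_logSeriesOp_sub {c d : ℕ → ℂ} (hc : RapidDecay c) (hd : RapidDecay d)
    (h0 : c 0 = 1) : IsCompactOperator (logSeriesOp s c d - logOp s) := by
  have h1 := isCompactOperator_kernelSeries_sub hc (isCompactOperator_ad_logOp s)
  have h2 := isCompactOperator_kernelSeries hd (isCompactOperator_meanOp s (s + 1))
  have := h1.add h2
  rw [h0, one_smul] at this
  have e : logSeriesOp s c d - logOp s =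
      kernelSeries (logOp s) c - logOp s + kernelSeries (meanOp s (s + 1)) d := by
    rw [logSeriesOp]; abel
  rw [e]
  exact this

theorem realizes_logSeriesOp {k : ℝ} (hk : 0 < k) :
    Realizes (logSeriesOp s (besselCoeff k) (regCoeff k)) (IsV1 k) := fun n => by
  have h := (hasKernel_logSeriesOp s (rapidDecay_besselCoeff k) (rapidDecay_regCoeff k)).congr
    (L := fun t τ => helmholtzFund k (segPoint t) (segPoint τ))
    fun t _ τ _ hne => (helmholtzFund_segPoint hk hne).symm
  refine ⟨_, fun t ht => ?_, (h n).2⟩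
  rw [intervalIntegrable_iff_integrableOn_Ioo_neg_one_one, integral_neg_one_one]
  exact ⟨(h n).1 t ht, rfl⟩

/-- The difference of the hypersingular operator and its principal part, before the embedding. -/
noncomputable def hyperRemainder (k : ℝ) : ChebW s →L[ℂ] ChebW (s + 1) :=
  logSeriesOp s (besselCoeff₂ k) (regCoeff₂ k) -
    ((logSeriesOp s (besselCoeff₂ k) (regCoeff₂ k)).comp (mulX s)).comp (mulX s)

/-- The density is `w` rather than `1 / w`. Since `w = (1 - τ²) / w`, the change of density is
composition on the right with `1 - X²`, where `X` is multiplication by the variable. -/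
theorem hasKernel_hyperRemainder (k : ℝ) :
    HasKernel (hyperRemainder s k) (fun t τ =>
      (((-1 / (2 * π) * Real.log |t - τ| : ℝ) : ℂ) * powSum (besselCoeff₂ k) ((t - τ) ^ 2) +
        powSum (regCoeff₂ k) ((t - τ) ^ 2)) * (1 - (τ : ℂ) ^ 2)) := by
  have h := hasKernel_logSeriesOp s (rapidDecay_besselCoeff₂ k) (rapidDecay_regCoeff₂ k)
  exact (h.sub h.comp_mulX.comp_mulX).congr fun t _ τ _ _ => by ring

theorem Represents.emb {s : ℝ} {u : ChebW (s + 1)} {f : ℝ → ℂ} (h : Represents u f) :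
    Represents (ChebW.emb s u) f :=
  ⟨h.1, fun n => by rw [ChebW.coeff_emb, h.2]⟩

/-- The hypersingular operator. -/
noncomputable def hyperSeriesOp (hs : -1 / 2 < s) (k : ℝ) : ChebW (s + 1) →L[ℂ] ChebW s :=
  hyperOp s hs + ((emb s).comp (hyperRemainder s k)).comp (emb s)

/-- The remainder acts after the embedding `W^{s+1} → W^s`, which is compact. -/
theorem isCompactOperator_hyperSeriesOp_sub (hs : -1 / 2 < s) (k : ℝ) :
    IsCompactOperator (hyperSeriesOp s hs k - hyperOp s hs) := by
  rw [hyperSeriesOp, add_sub_cancel_left]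
  exact (isCompactOperator_emb s).clm_comp ((emb s).comp (hyperRemainder s k))

theorem tendsto_finitePart_chebTFun (n : ℕ) {t : ℝ} (ht : t ∈ Ioo (-1 : ℝ) 1) :
    Tendsto (fun ε : ℝ => (∫ τ in truncSet t ε,
      ((1 / (2 * π) * ((τ - t) ^ 2)⁻¹ : ℝ) : ℂ) * (chebWeight τ * chebTFun n τ)) -
      (chebWeight t * chebTFun n t / π) / (ε : ℂ)) (𝓝[>] 0) (𝓝 (chQ n t : ℂ)) := by
  have h := ((tendsto_finitePart_chT n ht).const_mul (1 / (2 * π)))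
  have hpi := Real.pi_pos.ne'
  rw [show 1 / (2 * π) * (2 * π * chQ n t) = chQ n t by field_simp] at h
  refine ((Complex.continuous_ofReal.tendsto _).comp h).congr fun ε => ?_
  have e : ∀ τ, ((1 / (2 * π) * ((τ - t) ^ 2)⁻¹ : ℝ) : ℂ) * (chebWeight τ * chebTFun n τ) =
      ((1 / (2 * π) * (((τ - t) ^ 2)⁻¹ * (√(1 - τ ^ 2) * chT n τ)) : ℝ) : ℂ) := fun τ => by
    rw [chebWeight_eq, chebTFun_eq]; push_cast; ring
  simp only [e, Function.comp_apply]
  rw [integral_complex_ofReal, integral_const_mul, chebWeight_eq, chebTFun_eq]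
  have hpi' : (π : ℂ) ≠ 0 := by exact_mod_cast hpi
  push_cast
  field_simp

theorem integrableOn_truncSet_finitePart (n : ℕ) {t ε : ℝ} (hε : 0 < ε) :
    IntegrableOn (fun τ => ((1 / (2 * π) * ((τ - t) ^ 2)⁻¹ : ℝ) : ℂ) *
      (chebWeight τ * chebTFun n τ)) (truncSet t ε) := by
  have hc : IntegrableOn (fun τ => chebWeight τ * chebTFun n τ) (Ioo (-1) 1) :=
    ((continuous_chebWeight.mul (continuous_chebTFun n)).integrableOn_Icc).mono_set Ioo_subset_Icc_self
  refine (integrableOn_truncSet_smul hc (h := fun τ => 1 / (2 * π) * ((τ - t) ^ 2)⁻¹)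
    (by fun_prop) (C := 1 / (2 * π) * (ε ^ 2)⁻¹) fun τ hτ => ?_).congr_fun (fun τ _ => ?_)
    (measurableSet_truncSet t ε)
  · rw [abs_of_nonneg (by positivity), ← sq_abs (τ - t), abs_sub_comm]
    have := hτ.2.le
    gcongr
  · exact Complex.real_smul

/-- Only the part `1/(2π(τ-t)²)` of the kernel needs a finite part, which is the polynomial `chQ`.
The rest is integrable, so its truncated integrals simply converge. -/
theorem realizes_hyperSeriesOp (hs : -1 / 2 < s) {k : ℝ} (hk : 0 < k) :
    Realizes (hyperSeriesOp s hs k) (IsV2 k) := fun n => by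
  have h := hasKernel_hyperRemainder s k n
  have hr := (represents_hyperOp_chebT hs n).add h.2.emb
  rw [← emb_chebT s n, ← ContinuousLinearMap.comp_apply, ← ContinuousLinearMap.comp_apply,
    ← add_apply, ← hyperSeriesOp] at hr
  refine ⟨_, fun t ht => ?_, hr⟩
  have e : ∀ ε > 0, ∀ τ ∈ truncSet t ε, ((1 / (2 * π) * ((τ - t) ^ 2)⁻¹ : ℝ) : ℂ) *
      (chebWeight τ * chebTFun n τ) +
      (((-1 / (2 * π) * Real.log |t - τ| : ℝ) : ℂ) * powSum (besselCoeff₂ k) ((t - τ) ^ 2) +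
        powSum (regCoeff₂ k) ((t - τ) ^ 2)) * (1 - (τ : ℂ) ^ 2) * (chebTFun n τ / chebWeight τ) =
      hyperKernel k t τ * (chebWeight τ * chebTFun n τ) := fun ε hε τ hτ => by
    have hne : t ≠ τ := fun h0 => ne_of_mem_truncSet hε hτ (by rw [h0, sub_self])
    have hw := chebWeight_ne_zero hτ.1
    rw [hyperKernel_eq hk hne, ← chebWeight_sq hτ.1]
    field_simp
  have i1 := fun ε (hε : 0 < ε) => integrableOn_truncSet_finitePart n (t := t) hε
  have i2 := fun ε => (h.1 t ht).mono_set (truncSet_subset t ε)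
  -- The divergent coefficient is `2 w(t) T_n(t)` from the finite part lemma, times the factor
  -- `1/(2π)` of the kernel.
  refine ⟨fun ε hε => ?_, chebWeight t * chebTFun n t / π, ?_⟩
  · exact ((i1 ε hε).add (i2 ε)).congr_fun (e ε hε) (measurableSet_truncSet t ε)
  · refine ((tendsto_finitePart_chebTFun n ht).add (tendsto_integral_truncSet (h.1 t ht) t)).congr' ?_
    filter_upwards [self_mem_nhdsWithin] with ε hε
    change _ = (∫ τ in truncSet t ε, hyperKernel k t τ * (chebWeight τ * chebTFun n τ)) - _
    rw [← setIntegral_congr_fun (measurableSet_truncSet t ε) (e ε hε),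
      integral_add (i1 ε hε) (i2 ε)]
    ring

end Operators

/-! ### Assembly of the result. -/

/-- Compact perturbations of two operators perturb their product compactly. -/
theorem IsCompactOperator.comp_sub_comp {E F G : Type*} [NormedAddCommGroup E] [NormedSpace ℂ E]
    [NormedAddCommGroup F] [NormedSpace ℂ F] [NormedAddCommGroup G] [NormedSpace ℂ G]
    {A P : F →L[ℂ] G} {B Q : E →L[ℂ] F} (h1 : IsCompactOperator (A - P))
    (h2 : IsCompactOperator (B - Q)) : IsCompactOperator (A.comp B - P.comp Q) := by
  have e : A.comp B - P.comp Q = (A - P).comp B + P.comp (B - Q) := by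
    ext u; simp
  rw [e]
  exact (h1.comp_clm B).add (h2.clm_comp P)

theorem Realizes.eq_of_isV1 {s r k : ℝ} {A B : ChebW s →L[ℂ] ChebW r} (hA : Realizes A (IsV1 k))
    (hB : Realizes B (IsV1 k)) : A = B :=
  Realizes.unique (R := IsV1 k) (fun _ _ _ h h' => h.eqOn h') hA hB

theorem Realizes.eq_of_isV2 {s r k : ℝ} {A B : ChebW s →L[ℂ] ChebW r} (hA : Realizes A (IsV2 k))
    (hB : Realizes B (IsV2 k)) : A = B :=
  Realizes.unique (R := IsV2 k) (fun _ _ _ h h' => h.eqOn h') hA hB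

theorem Realizes.eq_of_isV1Principal {s r : ℝ} {A B : ChebW s →L[ℂ] ChebW r}
    (hA : Realizes A IsV1Principal) (hB : Realizes B IsV1Principal) : A = B :=
  Realizes.unique (R := IsV1Principal) (fun _ _ _ h h' => h.eqOn h') hA hB

theorem Realizes.eq_of_isV2Principal {s r : ℝ} {A B : ChebW s →L[ℂ] ChebW r}
    (hA : Realizes A IsV2Principal) (hB : Realizes B IsV2Principal) : A = B :=
  Realizes.unique (R := IsV2Principal) (fun _ _ _ h h' => h.eqOn h') hA hB

theorem proposition3p7 (k : ℝ) (hk : 0 < k) (s : ℝ) (hs : -1 / 2 < s) :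
    -- the weighted operators and their principal parts define unique bounded operators
    (∃! V₁ : ChebW s →L[ℂ] ChebW (s + 1), Realizes V₁ (IsV1 k)) ∧
    (∃! V₂ : ChebW (s + 1) →L[ℂ] ChebW s, Realizes V₂ (IsV2 k)) ∧
    (∃! P₁ : ChebW s →L[ℂ] ChebW (s + 1), Realizes P₁ IsV1Principal) ∧
    (∃! P₂ : ChebW (s + 1) →L[ℂ] ChebW s, Realizes P₂ IsV2Principal) ∧
    ∀ (V₁ P₁ : ChebW s →L[ℂ] ChebW (s + 1)) (V₂ P₂ : ChebW (s + 1) →L[ℂ] ChebW s),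
      Realizes V₁ (IsV1 k) → Realizes V₂ (IsV2 k) →
      Realizes P₁ IsV1Principal → Realizes P₂ IsV2Principal →
      -- the operators are compact perturbations of the principal parts
      IsCompactOperator (V₁.comp V₂ - P₁.comp P₂) ∧
      IsCompactOperator (V₂.comp V₁ - P₂.comp P₁) ∧
      -- the principal part is upper triangular, with diagonal entries `eₙ dₙ = λₙ`
      (∀ n : ℕ, eEig n * dEig n = discreteEig n ∧
        (P₁.comp P₂) (ChebW.chebT (s + 1) n) =
          ((eEig n * dEig n : ℝ) : ℂ) • ChebW.chebT (s + 1) n +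
          ((eEig n - eEig (n - 2) : ℝ) : ℂ) •
            ∑ j ∈ (Finset.range n).filter (fun j => j % 2 = n % 2),
              (((if j = 0 then 1 / 2 else 1) * dEig j : ℝ) : ℂ) • ChebW.chebT (s + 1) j) ∧
      -- the point spectra of the principal parts coincide, and are known
      pointSpectrum (P₁.comp P₂) = pointSpectrum (P₂.comp P₁) ∧
      pointSpectrum (P₁.comp P₂) =
        Set.range (fun n : ℕ => (discreteEig n : ℂ)) ∪ complementarySpectrum s := by
  have hV₁ := realizes_logSeriesOp s hk
  have hV₂ := realizes_hyperSeriesOp s hs hk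
  have hP₁ := realizes_logOp s
  have hP₂ := realizes_hyperOp hs
  refine ⟨⟨_, hV₁, fun A hA => hA.eq_of_isV1 hV₁⟩, ⟨_, hV₂, fun A hA => hA.eq_of_isV2 hV₂⟩,
    ⟨_, hP₁, fun A hA => hA.eq_of_isV1Principal hP₁⟩,
    ⟨_, hP₂, fun A hA => hA.eq_of_isV2Principal hP₂⟩, fun V₁ P₁ V₂ P₂ h1 h2 h3 h4 => ?_⟩
  -- By uniqueness any realizing operators are the explicit ones, so every claim is checked on
  -- these.
  rw [h1.eq_of_isV1 hV₁, h2.eq_of_isV2 hV₂, h3.eq_of_isV1Principal hP₁, h4.eq_of_isV2Principal hP₂]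
  have c1 := isCompactOperator_logSeriesOp_sub s (rapidDecay_besselCoeff k) (rapidDecay_regCoeff k)
    (besselCoeff_zero k)
  have c2 := isCompactOperator_hyperSeriesOp_sub s hs k
  refine ⟨c1.comp_sub_comp c2, c2.comp_sub_comp c1, fun n => ⟨eEig_mul_dEig n, ?_⟩,
    ChebW.pointSpectrum_comp_comm _, ?_⟩
  · exact ChebW.logOp_hyperOp_chebT hs n
  · rw [ChebW.pointSpectrum_comp_comm]
    exact ChebW.pointSpectrum_hyperOp_logOp hs
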